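/- Let $\mathfrak m_0(x)=1/\sqrt{\pi}$ and $\mathfrak m_k(x)=\sqrt{2/\pi}\,\cos(kx)$, $k\ge 1$, be the Fourier cosine basis of $L_2((0,\pi))$. Let $\dot W=\{\dot W(h): h\in L_2((0,\pi))\}$ be a Gaussian white noise on a probability space $(\Omega,\mathcal F,\mathbb P)$, that is, a family of Gaussian random variables with $\mathbb E\,\dot W(h)=0$ and $\mathbb E\,\dot W(g)\dot W(h)=\int_0^\pi g(x)h(x)\,dx$. Put $\xi_k=\dot W(\mathfrak m_k)$. Let $\mathcal J$ be the set of finitely supported sequences $\alpha=(\alpha_k)_{k\ge0}$ of non-negative integers, with $|\alpha|=\sum_k\alpha_k$, let $\varepsilon(k)\in\mathcal J$ be the $k$-th unit sequence, and let $$\xi_\alpha=\prod_k \frac{\mathrm{He}_{\alpha_k}(\xi_k)}{\sqrt{\alpha_k!}},\qquad \alpha\in\mathcal J,$$ where $\mathrm{He}_n(x)=(-1)^n e^{x^2/2}\frac{d^n}{dx^n}e^{-x^2/2}$. Let $L_2(W;\mathbb R)$ be the set of square-integrable random variables that are measurable with respect to $\sigma(\dot W(h): h\in L_2((0,\pi)))$,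 and, for $q>1$, let $$L_{2,q}(W;\mathbb R)=\Big\{\eta\in L_2(W;\mathbb R):\ \sum_{\alpha\in\mathcal J} q^{|\alpha|}\,\big(\mathbb E(\eta\,\xi_\alpha)\big)^2<\infty\Big\}.$$ Consider the equation $u_t=u_{xx}+u\diamond\dot W(x)$, $t>0$, $0<x<\pi$ (with $\diamond$ the Wick product), with $u_x(t,0)=u_x(t,\pi)=0$ and non-random initial condition $u(0,x)=u_0(x)$. A chaos solution is a family of functions $u_\alpha(t,x)$, $\alpha\in\mathcal J$, solving the propagator $$\frac{\partial u_\alpha}{\partial t}=\frac{\partial^2 u_\alpha}{\partial x^2}+\sum_{k:\,\alpha_k>0}\sqrt{\alpha_k}\,\mathfrak m_k\,u_{\alpha-\varepsilon(k)},\qquad \frac{\partial u_\alpha}{\partial x}(t,0)=\frac{\partial u_\alpha}{\partial x}(t,\pi)=0,\qquad u_\alpha(0,\cdot)=\begin{cases}u_0,&|\alpha|=0,\\ 0,&|\alpha|>0.\end{cases}$$ Here a solution is understood in the weak sense: each $u_\alpha$ is continuous on $(0,\infty)\times[0,\pi]$ and integrable on $(0,T)\times(0,\pi)$ for every $T>0$,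 and for all $t>0$ and all $\varphi\in C^2$ with $\varphi'(0)=\varphi'(\pi)=0$, $$\int_0^\pi u_\alpha(t,x)\varphi(x)\,dx=\int_0^\pi u_\alpha(0,x)\varphi(x)\,dx+\int_0^t\!\int_0^\pi\Big(u_\alpha(s,x)\varphi''(x)+\sum_{k:\,\alpha_k>0}\sqrt{\alpha_k}\,\mathfrak m_k(x)u_{\alpha-\varepsilon(k)}(s,x)\varphi(x)\Big)dx\,ds .$$ **Theorem.** Let $u_0\in L_p((0,\pi))$ for some $1\le p\le\infty$. Then there is a unique chaos solution $\{u_\alpha\}_{\alpha\in\mathcal J}$ (unique as functions on $(0,\infty)\times[0,\pi]$). For every $t>0$ and $x\in[0,\pi]$ the series $$u(t,x)=\sum_{\alpha\in\mathcal J}u_\alpha(t,x)\,\xi_\alpha$$ converges unconditionally in mean square to a random variable $u(t,x)\in L_2(W;\mathbb R)$ with $\mathbb E\big(u(t,x)\xi_\alpha\big)=u_\alpha(t,x)$ for all $\alpha\in\mathcal J$, and $$u(t,x)\in\bigcap_{q>1}L_{2,q}(W;\mathbb R).$$ Consequently $\mathbb E|u(t,x)|^r<\infty$ for every $1\le r<\infty$.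 -/

import Mathlib

open MeasureTheory ProbabilityTheory Filter Topology Set
open scoped ENNReal

noncomputable section

namespace WickHeat

/-! ## White noise on `L₂((0,π))` -/

/-- Lebesgue measure on the interval `(0,π)`. -/
def mu : Measure ℝ := volume.restrict (Ioo 0 Real.pi)

/-- The Hilbert space `L₂((0,π))`. -/
abbrev L2 : Type := Lp ℝ 2 mu

/-- The Fourier cosine basis of `L₂((0,π))`, indexed from `0`. -/
def cosBasis (k : ℕ) (x : ℝ) : ℝ :=
  if k = 0 then 1 / Real.sqrt Real.pi else Real.sqrt (2 / Real.pi) * Real.cos (k * x)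

theorem continuous_cosBasis (k : ℕ) : Continuous (cosBasis k) := by
  unfold cosBasis
  split_ifs <;> fun_prop

instance : IsFiniteMeasure mu := ⟨by simp [mu]⟩

theorem memLp_cosBasis (k : ℕ) : MemLp (cosBasis k) 2 mu := by
  refine MemLp.of_bound (continuous_cosBasis k).aestronglyMeasurable
    (|1 / Real.sqrt Real.pi| + |Real.sqrt (2 / Real.pi)|) (Eventually.of_forall fun x => ?_)
  unfold cosBasis
  split_ifs
  · simp only [Real.norm_eq_abs]
    linarith [abs_nonneg (Real.sqrt (2 / Real.pi))]
  · rw [Real.norm_eq_abs, abs_mul]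
    have h1 := Real.abs_cos_le_one (k * x)
    have h2 := abs_nonneg (Real.sqrt (2 / Real.pi))
    have h3 := abs_nonneg (1 / Real.sqrt Real.pi)
    nlinarith

/-- The cosine basis functions as elements of `L₂((0,π))`. -/
def cosBasisL2 (k : ℕ) : L2 := (memLp_cosBasis k).toLp (cosBasis k)

variable {Ω : Type*} [MeasurableSpace Ω]

/-- `W` is a Gaussian white noise on `L₂((0,π))`: a family of Gaussian random variables
indexed by `L₂((0,π))`, with mean zero and `E (W g * W h) = (g, h)`. -/
structure IsWhiteNoise (P : Measure Ω) (W : L2 → Ω → ℝ) : Prop where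
  measurable : ∀ h, Measurable (W h)
  gaussian : ∀ h, HasGaussianLaw (W h) P
  mean_zero : ∀ h, ∫ ω, W h ω ∂P = 0
  covariance : ∀ g h, ∫ ω, W g ω * W h ω ∂P = inner ℝ g h

/-- The sigma-algebra on `Ω` generated by all the random variables `W h`. -/
abbrev noiseSigma (W : L2 → Ω → ℝ) : MeasurableSpace Ω :=
  ⨆ h, MeasurableSpace.comap (W h) inferInstance

/-! ## Chaos spaces -/

/-- Multi-indices: finitely supported sequences of natural numbers. -/
abbrev MultiIndex : Type := ℕ →₀ ℕ

/-- The orthonormal (Cameron-Martin) basis element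
`ξ_α = ∏ₖ He_{α k}(ξ k) / √((α k)!)`, where `ξ k = W (m k)`.
`Polynomial.hermite n` is the probabilists' Hermite polynomial. -/
def xi (W : L2 → Ω → ℝ) (α : MultiIndex) (ω : Ω) : ℝ :=
  ∏ k ∈ α.support,
    Polynomial.aeval (W (cosBasisL2 k) ω) (Polynomial.hermite (α k)) /
      Real.sqrt (Nat.factorial (α k))

/-- The chaos coefficient `η_α = E (η ξ_α)`. -/
def chaosCoeff (P : Measure Ω) (W : L2 → Ω → ℝ) (η : Ω → ℝ) (α : MultiIndex) : ℝ :=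
  ∫ ω, η ω * xi W α ω ∂P

/-- Membership in `L₂(W; ℝ)`: square integrable and measurable with respect to the noise. -/
def MemL2W (P : Measure Ω) (W : L2 → Ω → ℝ) (η : Ω → ℝ) : Prop :=
  Measurable[noiseSigma W] η ∧ MemLp η 2 P

/-- Membership in `L_{2,q}(W; ℝ)`, for `q > 1`: `η ∈ L₂(W; ℝ)` and
`∑ q ^ |α| |η_α|² < ∞`. -/
def MemL2qW (P : Measure Ω) (W : L2 → Ω → ℝ) (q : ℝ) (η : Ω → ℝ) : Prop :=
  MemL2W P W η ∧
    Summable fun α : MultiIndex => q ^ (∑ k ∈ α.support, α k) * chaosCoeff P W η α ^ 2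

/-- `η = ∑ c_α ξ_α`, the series converging unconditionally in mean square. -/
def HasChaosExpansion (P : Measure Ω) (W : L2 → Ω → ℝ) (c : MultiIndex → ℝ)
    (η : Ω → ℝ) : Prop :=
  Tendsto (fun s : Finset MultiIndex => eLpNorm (fun ω => η ω - ∑ α ∈ s, c α * xi W α ω) 2 P)
    atTop (𝓝 0)

/-! ## The chaos solution -/

/-- `v` is a weak solution on `(0,∞) × [0,π]` of `v_t = v_xx + f` with Neumann boundary
conditions `v_x(t,0) = v_x(t,π) = 0` and initial condition `v(0,·) = v₀`, continuous for `t > 0`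
(so that point values make sense). The boundary condition is encoded in the choice of the
test functions and the initial condition in the integrated form of the equation. -/
structure IsNeumannHeatSolution (v₀ : ℝ → ℝ) (f v : ℝ → ℝ → ℝ) : Prop where
  continuousOn : ContinuousOn (fun z : ℝ × ℝ => v z.1 z.2) (Ioi 0 ×ˢ Icc 0 Real.pi)
  integrableOn : ∀ T : ℝ, 0 < T →
    IntegrableOn (fun z : ℝ × ℝ => v z.1 z.2) (Ioo 0 T ×ˢ Ioo 0 Real.pi)
  weak : ∀ φ : ℝ → ℝ, ContDiff ℝ 2 φ → deriv φ 0 = 0 → deriv φ Real.pi = 0 →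
    ∀ t : ℝ, 0 < t →
      ∫ x in (0 : ℝ)..Real.pi, v t x * φ x =
        (∫ x in (0 : ℝ)..Real.pi, v₀ x * φ x) +
          ∫ s in (0 : ℝ)..t, ∫ x in (0 : ℝ)..Real.pi,
            (v s x * deriv (deriv φ) x + f s x * φ x)

/-- The family `U α t x` is a chaos solution of `u_t = u_xx + u ⋄ Ẇ(x)` on `(0,π)` with Neumann
boundary conditions and initial condition `u₀`: it satisfies the propagator
`∂ₜ U_α = ∂ₓₓ U_α + ∑ₖ √(α k) m_k U_{α - ε(k)}`, with `U_0(0,·) = u₀` and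
`U_α(0,·) = 0` for `|α| > 0`. -/
def IsChaosSolution (u₀ : ℝ → ℝ) (U : MultiIndex → ℝ → ℝ → ℝ) : Prop :=
  ∀ α : MultiIndex,
    IsNeumannHeatSolution (if α = 0 then u₀ else 0)
      (fun t x => ∑ k ∈ α.support,
        Real.sqrt (α k) * cosBasis k x * U (α - Finsupp.single k 1) t x)
      (U α)

end WickHeat

end

/-!
The propagator is solved explicitly with the cosine basis. If the forcing `f` is continuous for
`t > 0` and `O(t ^ (-3/4))` near `t = 0`, then the cosine series whose coefficients are given by
variation of constants (`heatSol`) converges absolutely for `t > 0`, is again in this class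
(`isAdmissible_heatSol`) and is a weak solution, as one sees by pairing it with the cosine series of
a test function (`isNeumannHeatSolution_heatSol`). The initial condition only enters through its
bounded cosine coefficients, so integrability of `u₀` is enough. Conversely, testing a weak solution
with the cosines shows that each of its modes satisfies a scalar linear equation, and a continuous
function is determined by its cosine coefficients; this gives uniqueness
(`IsNeumannHeatSolution.unique`). Existence and uniqueness of the chaos solution follow by induction
on the order of the multi-index.

The point of the argument is that `∑_{|α| = n} u_α(t,x)²` decays superexponentially in `n`
(`sum_sq_chaosSol_le`). By Duhamel's formula `u_α(t,x)` is the integral over `s` of the heat kernel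
paired with the forcing at time `s`. For fixed `s`, the Cauchy–Schwarz inequality over the `k` in
the support of `α` costs a factor `n + 1`, and Bessel's inequality for the functions
`y ↦ p(t-s,x,y) u_β(s,y)` removes the sum over `k`. What remains is the bound for the order `n`
times the squared `L₂` norm of the heat kernel, which is `O((t-s) ^ (-3/4))`
(`sum_sq_integral_mul_forcing_le`). Minkowski's inequality in `s` then turns a bound by
`c_n t ^ (γ_n - 1)` into one with `c_{n+1} = √((n + 1) K) B(γ_n, 5/8) c_n` and
`γ_{n+1} = γ_n + 5/8`. Since `B(γ_n, 5/8) = O(n ^ (-5/8))`, the ratio `c_{n+1} / c_n` tends to zero,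
and `∑_α q ^ |α| u_α(t,x)²` converges for every `q`
(`summable_pow_degree_mul_chaosSol_sq`).

On the probabilistic side, white noise is almost surely linear because it preserves inner products;
hence the `ξ_k` are jointly Gaussian and uncorrelated, so independent, and the `ξ_α` are orthonormal.
Square summability of the coefficients gives the mean square limit. It is constructed in `L²` of the
noise sigma-algebra, which makes it measurable with respect to the noise
(`IsWhiteNoise.exists_hasChaosExpansion`).

For the moments a weak form of hypercontractivity is enough: for every `m` there is some `q` with
`E (∑ c_α ξ_α) ^ (2m) ≤ (∑ q ^ |α| c_α²) ^ m` (`IsStdGaussSeq.exists_integral_sum_pow_le`). It is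
proved by splitting off one Gaussian variable at a time. Conditionally on the others, the part `b`
of positive degree in that variable is centred, so that in the expansion of `E (a + b) ^ (2m)` the
linear term vanishes and `b` enters only quadratically (`integral_add_pow_le`); and it is small
because the `2m`-th moments of Hermite polynomials grow only geometrically in the degree
(`exists_integral_hermiteFun_pow_le`). The constant therefore does not deteriorate with the number
of variables, and the bound passes to the limit by Fatou's lemma.
-/

noncomputable section

namespace WickHeat

/-! ### The cosine basis -/

/-- The amplitude of the cosine basis: `cosBasis k x = cosAmp k * cos (k x)` for every `k`. -/
def cosAmp (k : ℕ) : ℝ := if k = 0 then 1 / √Real.pi else √(2 / Real.pi)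

lemma cosBasis_eq (k : ℕ) (x : ℝ) : cosBasis k x = cosAmp k * Real.cos (k * x) := by
  unfold cosBasis cosAmp
  split_ifs with h <;> simp [h]

lemma cosAmp_pos (k : ℕ) : 0 < cosAmp k := by
  have := Real.pi_pos
  unfold cosAmp
  split_ifs <;> positivity

lemma cosAmp_le_one (k : ℕ) : cosAmp k ≤ 1 := by
  have hp := Real.pi_gt_three
  unfold cosAmp
  split_ifs
  · rw [div_le_one (by positivity)]
    exact Real.one_le_sqrt.mpr (by linarith)
  · rw [Real.sqrt_le_left zero_le_one, one_pow, div_le_one (by positivity)]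
    linarith

lemma abs_cosBasis_le (k : ℕ) (x : ℝ) : |cosBasis k x| ≤ 1 := by
  rw [cosBasis_eq, abs_mul, abs_of_pos (cosAmp_pos k)]
  exact mul_le_one₀ (cosAmp_le_one k) (abs_nonneg _) (Real.abs_cos_le_one _)

lemma integral_cos_int_mul (n : ℤ) :
    ∫ x in (0 : ℝ)..Real.pi, Real.cos (n * x) = if n = 0 then Real.pi else 0 := by
  split_ifs with h
  · simp [h]
  · rw [intervalIntegral.integral_comp_mul_left (f := Real.cos) (by exact_mod_cast h)]
    simp [Real.sin_int_mul_pi]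

lemma cosAmp_sq (k : ℕ) : cosAmp k ^ 2 = if k = 0 then 1 / Real.pi else 2 / Real.pi := by
  have := Real.pi_pos
  unfold cosAmp
  split_ifs
  · rw [div_pow, Real.sq_sqrt this.le, one_pow]
  · rw [Real.sq_sqrt (by positivity)]

lemma integral_cosBasis_mul (j k : ℕ) :
    ∫ x in (0 : ℝ)..Real.pi, cosBasis j x * cosBasis k x = if j = k then 1 else 0 := by
  have h1 : ∀ x : ℝ, cosBasis j x * cosBasis k x = cosAmp j * cosAmp k / 2 *
      (Real.cos (((j - k : ℤ) : ℝ) * x) + Real.cos (((j + k : ℤ) : ℝ) * x)) := fun x => by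
    push_cast
    rw [cosBasis_eq, cosBasis_eq, sub_mul, add_mul, Real.cos_sub, Real.cos_add]
    ring
  have hi : ∀ n : ℤ, IntervalIntegrable (fun x : ℝ => Real.cos (n * x)) volume 0 Real.pi :=
    fun n => (by fun_prop : Continuous _).intervalIntegrable _ _
  simp_rw [h1]
  rw [intervalIntegral.integral_const_mul, intervalIntegral.integral_add (hi _) (hi _),
    integral_cos_int_mul, integral_cos_int_mul]
  have hp := Real.pi_pos.ne'
  rcases eq_or_ne j k with rfl | hjk
  · rw [mul_div_assoc, ← mul_div_assoc, ← sq, cosAmp_sq]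
    rcases eq_or_ne j 0 with rfl | hj
    · simp; field_simp; norm_num
    · have : ¬ (j + j : ℤ) = 0 := by omega
      simp only [hj, this, sub_self, if_true, if_false]; field_simp; norm_num
  · rw [if_neg (by omega), if_neg (by omega), if_neg hjk]
    simp

lemma deriv_cosBasis (k : ℕ) :
    deriv (cosBasis k) = fun x => -(k * cosAmp k * Real.sin (k * x)) := by
  funext x
  have : cosBasis k = fun x => cosAmp k * Real.cos (k * x) := funext (cosBasis_eq k)
  rw [this]
  have h := (((hasDerivAt_id x).const_mul (k : ℝ)).cos).const_mul (cosAmp k)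
  simp only [id] at h
  rw [h.deriv]
  ring

lemma deriv_deriv_cosBasis (k : ℕ) (x : ℝ) :
    deriv (deriv (cosBasis k)) x = -(k : ℝ) ^ 2 * cosBasis k x := by
  rw [deriv_cosBasis, cosBasis_eq]
  have h := ((((hasDerivAt_id x).const_mul (k : ℝ)).sin).const_mul (k * cosAmp k)).neg
  simp only [id] at h
  erw [h.deriv]
  ring

lemma contDiff_cosBasis (k : ℕ) {n : WithTop ℕ∞} : ContDiff ℝ n (cosBasis k) := by
  have : cosBasis k = fun x => cosAmp k * Real.cos (k * x) := funext (cosBasis_eq k)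
  rw [this]
  fun_prop

lemma deriv_cosBasis_zero (k : ℕ) : deriv (cosBasis k) 0 = 0 := by
  simp [deriv_cosBasis]

lemma deriv_cosBasis_pi (k : ℕ) : deriv (cosBasis k) Real.pi = 0 := by
  simp [deriv_cosBasis, Real.sin_nat_mul_pi]

/-- The `k`-th cosine coefficient of `g`. -/
def cosCoeff (g : ℝ → ℝ) (k : ℕ) : ℝ := ∫ x in (0 : ℝ)..Real.pi, g x * cosBasis k x

lemma cos_mul_mem_span_cosBasis {p : ℝ → ℝ} (hp : p ∈ Submodule.span ℝ (range cosBasis)) :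
    (fun x => Real.cos x * p x) ∈ Submodule.span ℝ (range cosBasis) := by
  have hcos : ∀ k : ℕ, (fun x : ℝ => Real.cos (k * x)) ∈ Submodule.span ℝ (range cosBasis) := by
    intro k
    have h := Submodule.smul_mem _ (cosAmp k)⁻¹
      (Submodule.subset_span (s := range cosBasis) (mem_range_self k) (R := ℝ))
    convert h using 1
    funext x
    have := (cosAmp_pos k).ne'
    simp [cosBasis_eq, this]
  induction hp using Submodule.span_induction with
  | mem p hp =>
    obtain ⟨k, rfl⟩ := hp
    rcases k with _ | k
    · convert Submodule.smul_mem _ (cosAmp 0) (hcos 1) using 1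
      funext x
      simp [cosBasis_eq, mul_comm]
    · convert Submodule.smul_mem _ (cosAmp (k + 1) / 2)
        (Submodule.add_mem _ (hcos (k + 2)) (hcos k)) using 1
      funext x
      have h1 : ((k + 2 : ℕ) : ℝ) * x = (k + 1 : ℕ) * x + x := by push_cast; ring
      have h2 : (k : ℝ) * x = (k + 1 : ℕ) * x - x := by push_cast; ring
      simp only [Pi.smul_apply, Pi.add_apply, smul_eq_mul, cosBasis_eq, h1, h2, Real.cos_add,
        Real.cos_sub]
      ring
  | zero =>
    convert Submodule.zero_mem (Submodule.span ℝ (range cosBasis)) using 1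
    funext x
    simp
  | add p q _ _ hp hq =>
    convert Submodule.add_mem _ hp hq using 1
    funext x
    simp [mul_add]
  | smul c p _ hp =>
    convert Submodule.smul_mem _ c hp using 1
    funext x
    simp only [Pi.smul_apply, smul_eq_mul]
    ring

/-- Cosine polynomials are uniformly dense in `C([0,π])`: substitute `cos x` into the polynomials
that approximate `g ∘ arccos` on `[-1,1]`. -/
lemma exists_cosine_polynomial_near {g : ℝ → ℝ} (hg : ContinuousOn g (Icc 0 Real.pi)) {ε : ℝ}
    (hε : 0 < ε) : ∃ p ∈ Submodule.span ℝ (range cosBasis),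
      ∀ x ∈ Icc 0 Real.pi, |p x - g x| < ε := by
  obtain ⟨P, hP⟩ := exists_polynomial_near_of_continuousOn (-1) 1 (fun y => g (Real.arccos y))
    (hg.comp Real.continuous_arccos.continuousOn
      fun y _ => ⟨Real.arccos_nonneg y, Real.arccos_le_pi y⟩) ε hε
  refine ⟨fun x => P.eval (Real.cos x), ?_, fun x hx => ?_⟩
  · have hpow : ∀ n : ℕ, (fun x => Real.cos x ^ n) ∈ Submodule.span ℝ (range cosBasis) := by
      intro n
      induction n with
      | zero =>
        have h := Submodule.smul_mem _ (cosAmp 0)⁻¹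
          (Submodule.subset_span (s := range cosBasis) (mem_range_self 0) (R := ℝ))
        convert h using 1
        funext x
        have := (cosAmp_pos 0).ne'
        simp [cosBasis_eq, this]
      | succ n ih => simpa only [pow_succ'] using cos_mul_mem_span_cosBasis ih
    simp_rw [Polynomial.eval_eq_sum_range]
    have := Submodule.sum_mem (Submodule.span ℝ (range cosBasis))
      (t := Finset.range (P.natDegree + 1)) (f := fun i => P.coeff i • fun x : ℝ => Real.cos x ^ i)
      fun i _ => Submodule.smul_mem _ _ (hpow i)
    convert this using 1
    funext x
    simp
  · have := hP (Real.cos x) ⟨Real.neg_one_le_cos x, Real.cos_le_one x⟩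
    rwa [Real.arccos_cos hx.1 hx.2] at this

lemma continuous_of_mem_span_cosBasis {p : ℝ → ℝ}
    (hp : p ∈ Submodule.span ℝ (range cosBasis)) : Continuous p := by
  induction hp using Submodule.span_induction with
  | mem p hp =>
    obtain ⟨k, rfl⟩ := hp
    exact continuous_cosBasis k
  | zero => exact continuous_const
  | add p q _ _ hp hq => exact hp.add hq
  | smul c p _ hp => exact hp.const_smul c

lemma intervalIntegrable_of_continuousOn_pi {g : ℝ → ℝ} (hg : ContinuousOn g (Icc 0 Real.pi)) :
    IntervalIntegrable g volume 0 Real.pi :=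
  hg.intervalIntegrable_of_Icc Real.pi_pos.le

/-- Completeness of the cosine basis among continuous functions. -/
lemma eq_zero_of_cosCoeff_eq_zero {g : ℝ → ℝ} (hg : ContinuousOn g (Icc 0 Real.pi))
    (h0 : ∀ k, cosCoeff g k = 0) : ∀ x ∈ Icc 0 Real.pi, g x = 0 := by
  have hspan : ∀ p ∈ Submodule.span ℝ (range cosBasis),
      ∫ x in (0 : ℝ)..Real.pi, g x * p x = 0 := by
    intro p hp
    induction hp using Submodule.span_induction with
    | mem p hp =>
      obtain ⟨k, rfl⟩ := hp
      exact h0 k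
    | zero => simp
    | add p q hp' hq' hp hq =>
      simp_rw [Pi.add_apply, mul_add]
      rw [intervalIntegral.integral_add, hp, hq, add_zero]
      · exact intervalIntegrable_of_continuousOn_pi
          (hg.mul (continuous_of_mem_span_cosBasis hp').continuousOn)
      · exact intervalIntegrable_of_continuousOn_pi
          (hg.mul (continuous_of_mem_span_cosBasis hq').continuousOn)
    | smul c p _ hp =>
      simp_rw [Pi.smul_apply, smul_eq_mul, mul_left_comm _ c]
      rw [intervalIntegral.integral_const_mul, hp, mul_zero]
  obtain ⟨C, hC⟩ := isCompact_Icc.exists_bound_of_continuousOn hg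
  have hC0 : 0 ≤ C := (norm_nonneg _).trans (hC 0 ⟨le_rfl, Real.pi_pos.le⟩)
  have hsq : ∫ x in (0 : ℝ)..Real.pi, g x ^ 2 = 0 := by
    have hle : ∀ ε > 0, ∫ x in (0 : ℝ)..Real.pi, g x ^ 2 ≤ 0 + ε := by
      intro ε hε
      have hp := Real.pi_pos
      obtain ⟨p, hp1, hp2⟩ := exists_cosine_polynomial_near hg
        (ε := ε / ((C + 1) * Real.pi)) (by positivity)
      have hgp : ContinuousOn p (Icc 0 Real.pi) :=
        (continuous_of_mem_span_cosBasis hp1).continuousOn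
      have h1 : ∫ x in (0 : ℝ)..Real.pi, g x ^ 2 = ∫ x in (0 : ℝ)..Real.pi, g x * (g x - p x) := by
        have h0 : ∫ x in (0 : ℝ)..Real.pi, g x * (g x - p x) =
            (∫ x in (0 : ℝ)..Real.pi, g x ^ 2) - ∫ x in (0 : ℝ)..Real.pi, g x * p x := by
          rw [← intervalIntegral.integral_sub]
          · congr 1; funext x; ring
          · exact intervalIntegrable_of_continuousOn_pi (hg.pow 2)
          · exact intervalIntegrable_of_continuousOn_pi (hg.mul hgp)
        rw [h0, hspan p hp1, sub_zero]
      have h2 : ‖∫ x in (0 : ℝ)..Real.pi, g x * (g x - p x)‖ ≤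
          (C * (ε / ((C + 1) * Real.pi))) * |Real.pi - 0| := by
        refine intervalIntegral.norm_integral_le_of_norm_le_const fun x hx => ?_
        rw [uIoc_of_le hp.le] at hx
        have hx' : x ∈ Icc 0 Real.pi := ⟨hx.1.le, hx.2⟩
        rw [norm_mul]
        refine mul_le_mul (hC x hx') ?_ (norm_nonneg _) hC0
        rw [Real.norm_eq_abs, abs_sub_comm]
        exact (hp2 x hx').le
      rw [h1]
      refine (le_abs_self _).trans (h2.trans ?_)
      rw [sub_zero, abs_of_pos hp, zero_add]
      have : C * (ε / ((C + 1) * Real.pi)) * Real.pi = ε * (C / (C + 1)) := by field_simp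
      rw [this]
      refine mul_le_of_le_one_right hε.le ?_
      rw [div_le_one (by positivity)]
      linarith
    refine le_antisymm (le_of_forall_pos_le_add hle) ?_
    exact intervalIntegral.integral_nonneg Real.pi_pos.le fun x _ => sq_nonneg _
  intro x hx
  by_contra hne
  have hpos := intervalIntegral.integral_pos Real.pi_pos (hg.pow 2) (fun x _ => sq_nonneg (g x))
    ⟨x, hx, by have := sq_pos_of_ne_zero hne; exact this⟩
  exact hpos.ne' hsq

/-- Bessel's inequality. -/
lemma sum_cosCoeff_sq_le {g : ℝ → ℝ} (hg : ContinuousOn g (Icc 0 Real.pi)) (K : Finset ℕ) :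
    ∑ k ∈ K, cosCoeff g k ^ 2 ≤ ∫ x in (0 : ℝ)..Real.pi, g x ^ 2 := by
  set S : ℝ → ℝ := fun x => ∑ k ∈ K, cosCoeff g k * cosBasis k x with hS
  have hSc : Continuous S := by
    refine continuous_finsetSum _ fun k _ => continuous_const.mul (continuous_cosBasis k)
  have hm : ∀ k, Continuous (cosBasis k) := continuous_cosBasis
  have h1 : ∫ x in (0 : ℝ)..Real.pi, g x * S x = ∑ k ∈ K, cosCoeff g k ^ 2 := by
    have : ∀ x, g x * S x = ∑ k ∈ K, cosCoeff g k * (g x * cosBasis k x) := fun x => by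
      simp_rw [hS, Finset.mul_sum, mul_left_comm]
    simp_rw [this]
    rw [intervalIntegral.integral_finsetSum]
    · simp_rw [intervalIntegral.integral_const_mul, sq]; rfl
    · intro k _
      exact intervalIntegrable_of_continuousOn_pi
        (continuousOn_const.mul (hg.mul (hm k).continuousOn))
  have h2 : ∫ x in (0 : ℝ)..Real.pi, S x * S x = ∑ k ∈ K, cosCoeff g k ^ 2 := by
    have : ∀ x, S x * S x = ∑ k ∈ K, ∑ j ∈ K,
        (cosCoeff g k * cosCoeff g j) * (cosBasis k x * cosBasis j x) := fun x => by
      simp_rw [hS, Finset.sum_mul_sum]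
      refine Finset.sum_congr rfl fun k _ => Finset.sum_congr rfl fun j _ => by ring
    simp_rw [this]
    rw [intervalIntegral.integral_finsetSum]
    · refine Finset.sum_congr rfl fun k hk => ?_
      rw [intervalIntegral.integral_finsetSum]
      · simp_rw [intervalIntegral.integral_const_mul, integral_cosBasis_mul]
        simp [hk, sq]
      · intro j _
        exact (by fun_prop : Continuous _).intervalIntegrable _ _
    · intro k _
      refine Continuous.intervalIntegrable ?_ _ _
      exact continuous_finsetSum _ fun j _ => by fun_prop
  have h3 : 0 ≤ ∫ x in (0 : ℝ)..Real.pi, (g x - S x) ^ 2 :=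
    intervalIntegral.integral_nonneg Real.pi_pos.le fun x _ => sq_nonneg _
  have h4 : ∫ x in (0 : ℝ)..Real.pi, (g x - S x) ^ 2 =
      (∫ x in (0 : ℝ)..Real.pi, g x ^ 2) - 2 * (∫ x in (0 : ℝ)..Real.pi, g x * S x) +
        ∫ x in (0 : ℝ)..Real.pi, S x * S x := by
    rw [← intervalIntegral.integral_const_mul, ← intervalIntegral.integral_sub,
      ← intervalIntegral.integral_add]
    · congr 1; funext x; ring
    all_goals
      refine intervalIntegrable_of_continuousOn_pi ?_
      have := hSc.continuousOn (s := Icc 0 Real.pi)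
      fun_prop
  rw [h4, h1, h2] at h3
  linarith

/-! ### Absolutely convergent cosine series -/

/-- The cosine series with coefficients `b`. -/
def cosSeries (b : ℕ → ℝ) (x : ℝ) : ℝ := ∑' j, b j * cosBasis j x

lemma summable_cosSeries {b : ℕ → ℝ} (hb : Summable b) (x : ℝ) :
    Summable fun j => b j * cosBasis j x := by
  refine Summable.of_norm_bounded hb.norm fun j => ?_
  rw [norm_mul]
  exact mul_le_of_le_one_right (norm_nonneg _) (abs_cosBasis_le j x)

lemma continuous_cosSeries {b : ℕ → ℝ} (hb : Summable b) : Continuous (cosSeries b) := by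
  refine continuous_tsum (fun j => continuous_const.mul (continuous_cosBasis j)) hb.norm
    fun j x => ?_
  rw [norm_mul]
  exact mul_le_of_le_one_right (norm_nonneg _) (abs_cosBasis_le j x)

/-- Parseval's identity for an absolutely convergent cosine series. -/
lemma hasSum_integral_cosSeries_mul {b : ℕ → ℝ} (hb : Summable b) {g : ℝ → ℝ}
    (hg : IntervalIntegrable g volume 0 Real.pi) :
    HasSum (fun j => b j * cosCoeff g j) (∫ x in (0 : ℝ)..Real.pi, cosSeries b x * g x) := by
  have := intervalIntegral.hasSum_integral_of_dominated_convergence (a := 0) (b := Real.pi)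
    (μ := volume) (F := fun j x => b j * cosBasis j x * g x)
    (f := fun x => cosSeries b x * g x) (fun j x => |b j| * |g x|) ?_ ?_ ?_ ?_ ?_
  · have h2 : ∀ j, b j * cosCoeff g j =
        ∫ x in (0 : ℝ)..Real.pi, b j * cosBasis j x * g x := fun j => by
      rw [cosCoeff, ← intervalIntegral.integral_const_mul]
      congr 1; funext x; ring
    simpa only [h2] using this
  · intro j
    have h1 : AEStronglyMeasurable (fun x => b j * cosBasis j x)
      (volume.restrict (uIoc 0 Real.pi)) :=
      (continuous_const.mul (continuous_cosBasis j)).aestronglyMeasurable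
    exact h1.mul hg.aestronglyMeasurable_restrict_uIoc
  · refine fun j => Eventually.of_forall fun x _ => ?_
    rw [norm_mul, norm_mul, Real.norm_eq_abs, Real.norm_eq_abs, Real.norm_eq_abs]
    exact mul_le_mul_of_nonneg_right
      (mul_le_of_le_one_right (abs_nonneg _) (abs_cosBasis_le j x)) (abs_nonneg _)
  · exact Eventually.of_forall fun x _ => hb.abs.mul_right _
  · simp_rw [tsum_mul_right]
    exact hg.abs.const_mul _
  · exact Eventually.of_forall fun x _ => (summable_cosSeries hb x).hasSum.mul_right _

lemma cosCoeff_cosSeries {b : ℕ → ℝ} (hb : Summable b) (k : ℕ) :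
    cosCoeff (cosSeries b) k = b k := by
  have h := hasSum_integral_cosSeries_mul hb ((continuous_cosBasis k).intervalIntegrable 0 Real.pi)
  have h2 : (fun j => b j * cosCoeff (cosBasis k) j) = fun j => if j = k then b k else 0 := by
    funext j
    rw [cosCoeff, integral_cosBasis_mul]
    split_ifs with h1 h2 h2
    · rw [h2, mul_one]
    · exact absurd h1.symm h2
    · exact absurd h2.symm h1
    · rw [mul_zero]
  rw [h2] at h
  exact h.unique (hasSum_ite_eq k (b k))

lemma hasSum_sq_cosSeries {b : ℕ → ℝ} (hb : Summable b) :
    HasSum (fun j => b j ^ 2) (∫ x in (0 : ℝ)..Real.pi, cosSeries b x ^ 2) := by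
  have h := hasSum_integral_cosSeries_mul hb ((continuous_cosSeries hb).intervalIntegrable 0 Real.pi)
  simp_rw [cosCoeff_cosSeries hb, ← sq] at h
  exact h

/-! ### The beta integral and the heat weights -/

lemma beta_integral_unit {a b : ℝ} (ha : 0 < a) (hb : 0 < b) :
    IntervalIntegrable (fun x : ℝ => x ^ (a - 1) * (1 - x) ^ (b - 1)) volume 0 1 ∧
      ∫ x in (0 : ℝ)..1, x ^ (a - 1) * (1 - x) ^ (b - 1) = beta a b := by
  have heq : ∀ x ∈ Ioc (0 : ℝ) 1, (x : ℂ) ^ ((a : ℂ) - 1) * (1 - (x : ℂ)) ^ ((b : ℂ) - 1) =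
      ((x ^ (a - 1) * (1 - x) ^ (b - 1) : ℝ) : ℂ) := fun x hx => by
    push_cast
    rw [Complex.ofReal_cpow hx.1.le, Complex.ofReal_cpow (by linarith [hx.2])]
    push_cast
    rfl
  have hc := Complex.betaIntegral_convergent (u := a) (v := b) (by simpa) (by simpa)
  have hint : IntervalIntegrable (fun x : ℝ => x ^ (a - 1) * (1 - x) ^ (b - 1)) volume 0 1 := by
    have h2 := hc.norm
    rw [intervalIntegrable_iff_integrableOn_Ioc_of_le zero_le_one] at h2 ⊢
    refine h2.congr_fun (fun x hx => ?_) measurableSet_Ioc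
    simp only
    rw [heq x hx, Complex.norm_real, Real.norm_of_nonneg]
    exact mul_nonneg (Real.rpow_nonneg hx.1.le _) (Real.rpow_nonneg (by linarith [hx.2]) _)
  refine ⟨hint, ?_⟩
  rw [beta_eq_betaIntegralReal a b ha hb, Complex.betaIntegral,
    intervalIntegral.integral_of_le (μ := volume) (E := ℂ) zero_le_one,
    setIntegral_congr_fun measurableSet_Ioc heq,
    ← intervalIntegral.integral_of_le zero_le_one, intervalIntegral.integral_ofReal,
    Complex.ofReal_re]

/-- The beta integral on `(0,t)`. -/
lemma beta_integral {a b t : ℝ} (ha : 0 < a) (hb : 0 < b) (ht : 0 < t) :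
    IntervalIntegrable (fun s : ℝ => s ^ (a - 1) * (t - s) ^ (b - 1)) volume 0 t ∧
      ∫ s in (0 : ℝ)..t, s ^ (a - 1) * (t - s) ^ (b - 1) = t ^ (a + b - 1) * beta a b := by
  obtain ⟨h1, h2⟩ := beta_integral_unit ha hb
  set f : ℝ → ℝ := fun x => x ^ (a - 1) * (1 - x) ^ (b - 1) with hf
  have heq : ∀ s ∈ Ioc (0 : ℝ) t, t ^ (a + b - 2) * f (t⁻¹ * s) =
      s ^ (a - 1) * (t - s) ^ (b - 1) := fun s hs => by
    have e1 : 1 - t⁻¹ * s = t⁻¹ * (t - s) := by field_simp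
    simp only [hf]
    rw [e1, Real.mul_rpow (by positivity) hs.1.le, Real.mul_rpow (by positivity)
      (by linarith [hs.2]), Real.inv_rpow ht.le, Real.inv_rpow ht.le]
    have e2 : a + b - 2 = (a - 1) + (b - 1) := by ring
    rw [e2, Real.rpow_add ht]
    have := (Real.rpow_pos_of_pos ht (a - 1)).ne'
    have := (Real.rpow_pos_of_pos ht (b - 1)).ne'
    field_simp
  have h3 : IntervalIntegrable (fun s => t ^ (a + b - 2) * f (t⁻¹ * s)) volume 0 t := by
    have := (h1.comp_mul_left (c := t⁻¹)).const_mul (t ^ (a + b - 2))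
    simpa using this
  constructor
  · rw [intervalIntegrable_iff_integrableOn_Ioc_of_le ht.le] at h3 ⊢
    exact h3.congr_fun heq measurableSet_Ioc
  · rw [intervalIntegral.integral_of_le ht.le, ← setIntegral_congr_fun measurableSet_Ioc heq,
      ← intervalIntegral.integral_of_le ht.le, intervalIntegral.integral_const_mul,
      intervalIntegral.integral_comp_mul_left f (inv_pos.mpr ht).ne']
    simp only [mul_zero, inv_mul_cancel₀ ht.ne', inv_inv, smul_eq_mul, h2]
    rw [← mul_assoc, ← Real.rpow_add_one ht.ne']
    congr 2
    ring

/-- The weights `(1 + k²)^(-3/4)`, which control the heat semigroup on the cosine basis. -/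
def heatWeight (k : ℕ) : ℝ := (1 + (k : ℝ) ^ 2) ^ (-(3 / 4) : ℝ)

lemma heatWeight_pos (k : ℕ) : 0 < heatWeight k := by unfold heatWeight; positivity

lemma summable_heatWeight : Summable heatWeight := by
  have h : Summable fun k : ℕ => (k : ℝ) ^ (-(3 / 2) : ℝ) :=
    Real.summable_nat_rpow.mpr (by norm_num)
  refine Summable.of_norm_bounded_eventually_nat h ?_
  filter_upwards [eventually_gt_atTop 0] with k hk
  have hk' : (0 : ℝ) < k := by exact_mod_cast hk
  rw [Real.norm_of_nonneg (heatWeight_pos k).le, heatWeight,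
    show (-(3 / 2) : ℝ) = 2 * (-(3 / 4)) by norm_num, Real.rpow_mul hk'.le]
  refine Real.rpow_le_rpow_of_nonpos (by positivity) ?_ (by norm_num)
  rw [Real.rpow_two]
  linarith

lemma inv_one_add_sq_le_heatWeight (k : ℕ) : (1 + (k : ℝ) ^ 2)⁻¹ ≤ heatWeight k := by
  rw [heatWeight, ← Real.rpow_neg_one]
  exact Real.rpow_le_rpow_of_exponent_le (by nlinarith [sq_nonneg (k : ℝ)]) (by norm_num)

lemma exp_neg_sq_mul_le (k : ℕ) {r : ℝ} (hr : 0 < r) :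
    Real.exp (-(k : ℝ) ^ 2 * r) ≤ Real.exp r * heatWeight k * r ^ (-(3 / 4) : ℝ) := by
  have hz : 0 < (1 + (k : ℝ) ^ 2) * r := by positivity
  set z := (1 + (k : ℝ) ^ 2) * r with hzdef
  have h1 : z ^ (3 / 4 : ℝ) ≤ Real.exp z := by
    refine le_trans ?_ (Real.add_one_le_exp z)
    rcases le_total z 1 with h | h
    · have := Real.rpow_le_one hz.le h (z := 3 / 4) (by norm_num)
      linarith
    · have := Real.rpow_le_rpow_of_exponent_le h (show (3 / 4 : ℝ) ≤ 1 by norm_num)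
      rw [Real.rpow_one] at this
      linarith
  have h2 : Real.exp (-z) ≤ z ^ (-(3 / 4) : ℝ) := by
    rw [Real.exp_neg, Real.rpow_neg hz.le]
    exact inv_anti₀ (by positivity) h1
  have h3 : Real.exp (-(k : ℝ) ^ 2 * r) = Real.exp r * Real.exp (-z) := by
    rw [← Real.exp_add, hzdef]; congr 1; ring
  rw [h3, mul_assoc]
  refine mul_le_mul_of_nonneg_left (h2.trans_eq ?_) (Real.exp_pos _).le
  rw [hzdef, Real.mul_rpow (by positivity) hr.le, heatWeight]

lemma exp_neg_sq_mul_le_of_le (k : ℕ) {r T : ℝ} (hr : 0 < r) (hT : r ≤ T) :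
    Real.exp (-(k : ℝ) ^ 2 * r) ≤ Real.exp T * heatWeight k * r ^ (-(3 / 4) : ℝ) := by
  refine (exp_neg_sq_mul_le k hr).trans ?_
  have := heatWeight_pos k
  gcongr

/-! ### Admissible functions and the solution operator -/

/-- The class in which the heat equation is solved: continuous functions on `(0,∞) × [0,π]`
that are `O(t^(-3/4))` as `t → 0`, uniformly in `x`. -/
structure IsAdmissible (f : ℝ → ℝ → ℝ) : Prop where
  continuousOn : ContinuousOn (fun z : ℝ × ℝ => f z.1 z.2) (Ioi 0 ×ˢ Icc 0 Real.pi)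
  bound : ∀ T : ℝ, 0 < T → ∃ C, 0 ≤ C ∧
    ∀ t ∈ Ioc 0 T, ∀ x ∈ Icc 0 Real.pi, |f t x| ≤ C * t ^ (-(3 / 4) : ℝ)

lemma continuousOn_slice {f : ℝ → ℝ → ℝ}
    (hf : ContinuousOn (fun z : ℝ × ℝ => f z.1 z.2) (Ioi 0 ×ˢ Icc 0 Real.pi)) {t : ℝ}
    (ht : 0 < t) : ContinuousOn (f t) (Icc 0 Real.pi) := by
  have : ContinuousOn (fun x : ℝ => (t, x)) (Icc 0 Real.pi) := by fun_prop
  exact hf.comp this fun x hx => ⟨ht, hx⟩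

lemma intervalIntegrable_rpow_neg {T : ℝ} :
    IntervalIntegrable (fun s : ℝ => s ^ (-(3 / 4) : ℝ)) volume 0 T :=
  intervalIntegral.intervalIntegrable_rpow' (by norm_num)

namespace IsAdmissible

variable {f g : ℝ → ℝ → ℝ}

lemma zero : IsAdmissible (fun _ _ => 0) :=
  ⟨continuousOn_const, fun T _ => ⟨0, le_rfl, fun t _ x _ => by simp⟩⟩

lemma add (hf : IsAdmissible f) (hg : IsAdmissible g) :
    IsAdmissible fun t x => f t x + g t x := by
  refine ⟨hf.continuousOn.add hg.continuousOn, fun T hT => ?_⟩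
  obtain ⟨C, hC, h1⟩ := hf.bound T hT
  obtain ⟨D, hD, h2⟩ := hg.bound T hT
  refine ⟨C + D, add_nonneg hC hD, fun t ht x hx => ?_⟩
  rw [add_mul]
  exact (abs_add_le _ _).trans (add_le_add (h1 t ht x hx) (h2 t ht x hx))

lemma sum {ι : Type*} (s : Finset ι) {F : ι → ℝ → ℝ → ℝ} (hF : ∀ i ∈ s, IsAdmissible (F i)) :
    IsAdmissible fun t x => ∑ i ∈ s, F i t x := by
  classical
  induction s using Finset.induction_on with
  | empty => simpa using zero
  | insert a s ha ih =>
    simp_rw [Finset.sum_insert ha]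
    exact (hF a (Finset.mem_insert_self a s)).add
      (ih fun i hi => hF i (Finset.mem_insert_of_mem hi))

lemma mul_cosBasis (hf : IsAdmissible f) (c : ℝ) (k : ℕ) :
    IsAdmissible fun t x => c * cosBasis k x * f t x := by
  refine ⟨?_, fun T hT => ?_⟩
  · have : ContinuousOn (fun z : ℝ × ℝ => c * cosBasis k z.2) (Ioi 0 ×ˢ Icc 0 Real.pi) :=
      (continuous_const.mul ((continuous_cosBasis k).comp continuous_snd)).continuousOn
    exact this.mul hf.continuousOn
  · obtain ⟨C, hC, h1⟩ := hf.bound T hT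
    refine ⟨|c| * C, mul_nonneg (abs_nonneg _) hC, fun t ht x hx => ?_⟩
    rw [abs_mul, abs_mul, mul_assoc |c| C]
    exact mul_le_mul (mul_le_of_le_one_right (abs_nonneg _) (abs_cosBasis_le k x)) (h1 t ht x hx)
      (abs_nonneg _) (abs_nonneg _)

lemma integrableOn (hf : IsAdmissible f) {T : ℝ} (hT : 0 < T) :
    IntegrableOn (fun z : ℝ × ℝ => f z.1 z.2) (Ioo 0 T ×ˢ Ioo 0 Real.pi) := by
  obtain ⟨C, hC, h1⟩ := hf.bound T hT
  have hm : MeasurableSet (Ioo (0 : ℝ) T ×ˢ Ioo (0 : ℝ) Real.pi) :=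
    measurableSet_Ioo.prod measurableSet_Ioo
  have hsub : Ioo (0 : ℝ) T ×ˢ Ioo (0 : ℝ) Real.pi ⊆ Ioi 0 ×ˢ Icc 0 Real.pi :=
    prod_mono Ioo_subset_Ioi_self Ioo_subset_Icc_self
  have hb : IntegrableOn (fun z : ℝ × ℝ => C * z.1 ^ (-(3 / 4) : ℝ))
      (Ioo 0 T ×ˢ Ioo 0 Real.pi) := by
    rw [IntegrableOn, Measure.volume_eq_prod, ← Measure.prod_restrict]
    have h2 : Integrable (fun s : ℝ => C * s ^ (-(3 / 4) : ℝ)) (volume.restrict (Ioo 0 T)) :=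
      (((intervalIntegrable_iff_integrableOn_Ioo_of_le hT.le).mp
        intervalIntegrable_rpow_neg).const_mul C)
    exact h2.comp_fst _
  refine Integrable.mono' hb ((hf.continuousOn.mono hsub).aestronglyMeasurable hm) ?_
  refine (ae_restrict_iff' hm).mpr (Eventually.of_forall fun z hz => ?_)
  exact h1 z.1 ⟨hz.1.1, hz.1.2.le⟩ z.2 ⟨hz.2.1.le, hz.2.2.le⟩

lemma abs_cosCoeff_le (hf : IsAdmissible f) {T : ℝ} (hT : 0 < T) :
    ∃ C, 0 ≤ C ∧ ∀ t ∈ Ioc 0 T, ∀ k, |cosCoeff (f t) k| ≤ C * t ^ (-(3 / 4) : ℝ) := by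
  obtain ⟨C, hC, h1⟩ := hf.bound T hT
  refine ⟨C * Real.pi, mul_nonneg hC Real.pi_pos.le, fun t ht k => ?_⟩
  have := intervalIntegral.norm_integral_le_of_norm_le_const (a := 0) (b := Real.pi)
    (f := fun x => f t x * cosBasis k x) (C := C * t ^ (-(3 / 4) : ℝ)) fun x hx => by
      rw [uIoc_of_le Real.pi_pos.le] at hx
      rw [norm_mul]
      exact (mul_le_of_le_one_right (norm_nonneg _) (abs_cosBasis_le k x)).trans
        (h1 t ht x ⟨hx.1.le, hx.2⟩)
  rw [sub_zero, abs_of_pos Real.pi_pos] at this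
  rw [mul_right_comm]
  exact this

lemma continuousOn_cosCoeff (hf : IsAdmissible f) (k : ℕ) :
    ContinuousOn (fun t => cosCoeff (f t) k) (Ioi 0) := by
  intro t₀ ht₀
  rw [mem_Ioi] at ht₀
  refine ContinuousAt.continuousWithinAt ?_
  obtain ⟨C, hC, h1⟩ := hf.bound (2 * t₀) (by positivity)
  have hnhds : Ioo (t₀ / 2) (2 * t₀) ∈ 𝓝 t₀ := Ioo_mem_nhds (by linarith) (by linarith)
  refine intervalIntegral.continuousAt_of_dominated_interval
    (bound := fun _ => C * (t₀ / 2) ^ (-(3 / 4) : ℝ)) ?_ ?_ ?_ ?_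
  · filter_upwards [hnhds] with t ht
    rw [uIoc_of_le Real.pi_pos.le]
    have := (continuousOn_slice hf.continuousOn (t := t) (by linarith [ht.1])).mul
      (continuous_cosBasis k).continuousOn
    exact (this.mono Ioc_subset_Icc_self).aestronglyMeasurable measurableSet_Ioc
  · filter_upwards [hnhds] with t ht
    refine Eventually.of_forall fun x hx => ?_
    rw [uIoc_of_le Real.pi_pos.le] at hx
    rw [norm_mul]
    refine (mul_le_of_le_one_right (norm_nonneg _) (abs_cosBasis_le k x)).trans
      ((h1 t ⟨by linarith [ht.1], ht.2.le⟩ x ⟨hx.1.le, hx.2⟩).trans ?_)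
    exact mul_le_mul_of_nonneg_left
      (Real.rpow_le_rpow_of_nonpos (by positivity) ht.1.le (by norm_num)) hC
  · exact intervalIntegrable_const
  · refine Eventually.of_forall fun x hx => ?_
    rw [uIoc_of_le Real.pi_pos.le] at hx
    refine ContinuousAt.mul ?_ continuousAt_const
    have h2 : ContinuousOn (fun t : ℝ => (t, x)) (Ioi 0) := by fun_prop
    have h3 : ContinuousOn (fun t => f t x) (Ioi 0) :=
      hf.continuousOn.comp h2 fun t ht => ⟨ht, hx.1.le, hx.2⟩
    exact h3.continuousAt (Ioi_mem_nhds ht₀)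

lemma intervalIntegrable_mul_cosCoeff (hf : IsAdmissible f) (k : ℕ) {e : ℝ → ℝ}
    (he : Continuous e) {t : ℝ} (ht : 0 ≤ t) :
    IntervalIntegrable (fun s => e s * cosCoeff (f s) k) volume 0 t := by
  rcases ht.eq_or_lt with rfl | ht
  · exact IntervalIntegrable.refl
  obtain ⟨C, hC, h1⟩ := hf.abs_cosCoeff_le ht
  refine IntervalIntegrable.continuousOn_mul ?_ he.continuousOn
  refine (intervalIntegrable_rpow_neg.const_mul C).mono_fun' ?_ ?_
  · rw [uIoc_of_le ht.le]
    exact ((hf.continuousOn_cosCoeff k).mono Ioc_subset_Ioi_self).aestronglyMeasurable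
      measurableSet_Ioc
  · rw [uIoc_of_le ht.le]
    exact (ae_restrict_iff' measurableSet_Ioc).mpr (Eventually.of_forall fun s hs => h1 s hs k)

end IsAdmissible

/-- The `k`-th cosine coefficient of the solution of `v_t = v_xx + f` with initial coefficients
`a`, by variation of constants. -/
def heatMode (a : ℕ → ℝ) (f : ℝ → ℝ → ℝ) (k : ℕ) (t : ℝ) : ℝ :=
  Real.exp (-(k : ℝ) ^ 2 * t) *
    (a k + ∫ s in (0 : ℝ)..t, Real.exp ((k : ℝ) ^ 2 * s) * cosCoeff (f s) k)

/-- The solution of `v_t = v_xx + f` with Neumann boundary conditions and initial cosine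
coefficients `a`, as a cosine series. -/
def heatSol (a : ℕ → ℝ) (f : ℝ → ℝ → ℝ) (t x : ℝ) : ℝ :=
  cosSeries (fun k => heatMode a f k t) x

lemma heatMode_eq (a : ℕ → ℝ) (f : ℝ → ℝ → ℝ) (k : ℕ) (t : ℝ) :
    heatMode a f k t = Real.exp (-(k : ℝ) ^ 2 * t) * a k +
      ∫ s in (0 : ℝ)..t, Real.exp (-(k : ℝ) ^ 2 * (t - s)) * cosCoeff (f s) k := by
  rw [heatMode, mul_add, ← intervalIntegral.integral_const_mul]
  congr 2
  funext s
  rw [← mul_assoc, ← Real.exp_add]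
  congr 2
  ring

section Solution

variable {a : ℕ → ℝ} {A : ℝ} {f : ℝ → ℝ → ℝ}

lemma abs_heatMode_le (ha : ∀ k, |a k| ≤ A) (hf : IsAdmissible f) {T : ℝ} (hT : 0 < T) :
    ∃ C, 0 ≤ C ∧ ∀ t ∈ Ioc 0 T, ∀ k, |heatMode a f k t| ≤ C * heatWeight k * t ^ (-(3 / 4) : ℝ) := by
  obtain ⟨C, hC, h1⟩ := hf.abs_cosCoeff_le hT
  have hA : 0 ≤ A := (abs_nonneg _).trans (ha 0)
  have hB : 0 < beta (1 / 4) (1 / 4) := beta_pos (by norm_num) (by norm_num)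
  refine ⟨Real.exp T * (A + C * (T ^ (1 / 4 : ℝ) * beta (1 / 4) (1 / 4))), by positivity,
    fun t ht k => ?_⟩
  obtain ⟨hi, hv⟩ := beta_integral (a := 1 / 4) (b := 1 / 4) (by norm_num) (by norm_num) ht.1
  have hw := heatWeight_pos k
  have e1 : (1 / 4 - 1 : ℝ) = -(3 / 4) := by norm_num
  rw [e1] at hi hv
  have h2 : ‖∫ s in (0 : ℝ)..t, Real.exp (-(k : ℝ) ^ 2 * (t - s)) * cosCoeff (f s) k‖ ≤
      ∫ s in (0 : ℝ)..t, (Real.exp T * heatWeight k * C) *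
        (s ^ (-(3 / 4) : ℝ) * (t - s) ^ (-(3 / 4) : ℝ)) := by
    refine intervalIntegral.norm_integral_le_of_norm_le ht.1.le ?_ (hi.const_mul _)
    have hne : ∀ᵐ s : ℝ, s ≠ t := by simp [ae_iff]
    filter_upwards [hne] with s hst hs
    rw [norm_mul, Real.norm_of_nonneg (Real.exp_pos _).le]
    have hst' : 0 < t - s := sub_pos.mpr (lt_of_le_of_ne hs.2 hst)
    calc _ ≤ (Real.exp T * heatWeight k * (t - s) ^ (-(3 / 4) : ℝ)) *
          (C * s ^ (-(3 / 4) : ℝ)) :=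
          mul_le_mul (exp_neg_sq_mul_le_of_le k hst' (by linarith [hs.1, ht.2]))
            (h1 s ⟨hs.1, hs.2.trans ht.2⟩ k) (abs_nonneg _) (by positivity)
      _ = _ := by ring
  rw [intervalIntegral.integral_const_mul, hv] at h2
  have h3 : |Real.exp (-(k : ℝ) ^ 2 * t) * a k| ≤
      (Real.exp T * heatWeight k * t ^ (-(3 / 4) : ℝ)) * A := by
    rw [abs_mul, abs_of_pos (Real.exp_pos _)]
    have := ht.1
    exact mul_le_mul (exp_neg_sq_mul_le_of_le k ht.1 ht.2) (ha k) (abs_nonneg _) (by positivity)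
  have h4 : t ^ (1 / 4 + 1 / 4 - 1 : ℝ) ≤ T ^ (1 / 4 : ℝ) * t ^ (-(3 / 4) : ℝ) := by
    rw [show (1 / 4 + 1 / 4 - 1 : ℝ) = 1 / 4 + -(3 / 4) by norm_num, Real.rpow_add ht.1]
    have := ht.1
    exact mul_le_mul_of_nonneg_right (Real.rpow_le_rpow ht.1.le ht.2 (by norm_num))
      (by positivity)
  rw [heatMode_eq]
  refine (abs_add_le _ _).trans ((add_le_add h3 h2).trans ?_)
  have h5 := mul_le_mul_of_nonneg_left (mul_le_mul_of_nonneg_right h4 hB.le)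
    (show 0 ≤ Real.exp T * heatWeight k * C by positivity)
  linarith [h5]

lemma summable_heatMode (ha : ∀ k, |a k| ≤ A) (hf : IsAdmissible f) {t : ℝ} (ht : 0 < t) :
    Summable fun k => heatMode a f k t := by
  obtain ⟨C, -, h⟩ := abs_heatMode_le ha hf ht
  exact Summable.of_norm_bounded ((summable_heatWeight.mul_left C).mul_right _)
    fun k => h t ⟨ht, le_rfl⟩ k

lemma continuousOn_heatMode (hf : IsAdmissible f) (k : ℕ) {T : ℝ} (hT : 0 ≤ T) :
    ContinuousOn (heatMode a f k) (Icc 0 T) := by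
  have h := intervalIntegral.continuousOn_primitive_interval' (a := 0)
    (hf.intervalIntegrable_mul_cosCoeff k
      (by fun_prop : Continuous fun s : ℝ => Real.exp ((k : ℝ) ^ 2 * s)) hT) left_mem_uIcc
  rw [uIcc_of_le hT] at h
  unfold heatMode
  fun_prop

lemma hasDerivAt_heatMode (hf : IsAdmissible f) (k : ℕ) {t : ℝ} (ht : 0 < t) :
    HasDerivAt (heatMode a f k) (-(k : ℝ) ^ 2 * heatMode a f k t + cosCoeff (f t) k) t := by
  have hc : ContinuousOn (fun s => Real.exp ((k : ℝ) ^ 2 * s) * cosCoeff (f s) k) (Ioi 0) := by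
    have := hf.continuousOn_cosCoeff k
    fun_prop
  have h1 := intervalIntegral.integral_hasDerivAt_right
    (hf.intervalIntegrable_mul_cosCoeff k
      (by fun_prop : Continuous fun s : ℝ => Real.exp ((k : ℝ) ^ 2 * s)) ht.le)
    (hc.stronglyMeasurableAtFilter isOpen_Ioi t ht) (hc.continuousAt (Ioi_mem_nhds ht))
  have h2 := ((hasDerivAt_id t).const_mul (-(k : ℝ) ^ 2)).exp
  have h3 := h2.mul (h1.const_add (a k))
  refine h3.congr_deriv ?_
  have h4 : Real.exp (-(k : ℝ) ^ 2 * t) * Real.exp ((k : ℝ) ^ 2 * t) = 1 := by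
    rw [← Real.exp_add]; simp
  simp only [id, heatMode]
  linear_combination (cosCoeff (f t) k) * h4

/-- The equation for the `k`-th mode, in integrated form. -/
lemma heatMode_integral_eq (hf : IsAdmissible f) (k : ℕ) {t : ℝ} (ht : 0 < t) :
    ∫ s in (0 : ℝ)..t, (-(k : ℝ) ^ 2 * heatMode a f k s + cosCoeff (f s) k) =
      heatMode a f k t - a k := by
  have hc := continuousOn_heatMode (a := a) hf k ht.le
  rw [intervalIntegral.integral_eq_sub_of_hasDerivAt_of_le ht.le hc
    (fun s hs => hasDerivAt_heatMode hf k hs.1)]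
  · simp [heatMode]
  · refine IntervalIntegrable.add ?_ ?_
    · exact (hc.intervalIntegrable_of_Icc ht.le).const_mul _
    · simpa using hf.intervalIntegrable_mul_cosCoeff k (e := fun _ => 1) continuous_const ht.le

lemma isAdmissible_heatSol (ha : ∀ k, |a k| ≤ A) (hf : IsAdmissible f) :
    IsAdmissible (heatSol a f) := by
  constructor
  · rintro ⟨t₀, x₀⟩ ⟨ht₀, -⟩
    rw [mem_Ioi] at ht₀
    refine ContinuousAt.continuousWithinAt ?_
    obtain ⟨C, hC, h1⟩ := abs_heatMode_le ha hf (T := 2 * t₀) (by positivity)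
    have hcont : ContinuousOn (fun z : ℝ × ℝ => heatSol a f z.1 z.2)
        (Ioo (t₀ / 2) (2 * t₀) ×ˢ univ) := by
      refine continuousOn_tsum (u := fun k => C * heatWeight k * (t₀ / 2) ^ (-(3 / 4) : ℝ)) ?_
        ((summable_heatWeight.mul_left C).mul_right _) ?_
      · intro k
        refine ContinuousOn.mul ?_ ((continuous_cosBasis k).comp continuous_snd).continuousOn
        refine (continuousOn_heatMode hf k (T := 2 * t₀) (by positivity)).comp
          continuous_fst.continuousOn fun z hz => ⟨?_, hz.1.2.le⟩
        linarith [hz.1.1]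
      · rintro k ⟨t, x⟩ ⟨ht, -⟩
        simp only at ht
        rw [norm_mul]
        refine (mul_le_of_le_one_right (norm_nonneg _) (abs_cosBasis_le k x)).trans
          ((h1 t ⟨by linarith [ht.1], ht.2.le⟩ k).trans ?_)
        have := heatWeight_pos k
        exact mul_le_mul_of_nonneg_left
          (Real.rpow_le_rpow_of_nonpos (by positivity) ht.1.le (by norm_num)) (by positivity)
    exact hcont.continuousAt (prod_mem_nhds (Ioo_mem_nhds (by linarith) (by linarith)) univ_mem)
  · intro T hT
    obtain ⟨C, hC, h1⟩ := abs_heatMode_le ha hf hT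
    refine ⟨C * ∑' k, heatWeight k, mul_nonneg hC (tsum_nonneg fun k => (heatWeight_pos k).le),
      fun t ht x _ => ?_⟩
    rw [← tsum_mul_left, ← tsum_mul_right]
    refine (tsum_of_norm_bounded (f := fun k => heatMode a f k t * cosBasis k x)
      ((summable_heatWeight.mul_left C).mul_right _).hasSum fun k => ?_)
    rw [norm_mul]
    exact (mul_le_of_le_one_right (norm_nonneg _) (abs_cosBasis_le k x)).trans (h1 t ht k)

end Solution

/-! ### The solution operator yields weak solutions -/

lemma abs_cosCoeff_le_integral {g : ℝ → ℝ} (hg : IntervalIntegrable g volume 0 Real.pi) (k : ℕ) :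
    |cosCoeff g k| ≤ ∫ x in (0 : ℝ)..Real.pi, |g x| := by
  refine intervalIntegral.norm_integral_le_of_norm_le (f := fun x => g x * cosBasis k x)
    Real.pi_pos.le (Eventually.of_forall fun x _ => ?_) hg.abs
  rw [norm_mul]
  exact mul_le_of_le_one_right (norm_nonneg _) (abs_cosBasis_le k x)

/-- Green's formula: the cosine coefficients of `φ''` when `φ` satisfies the Neumann boundary
conditions. -/
lemma cosCoeff_deriv_deriv {φ : ℝ → ℝ} (hφ : ContDiff ℝ 2 φ) (h0 : deriv φ 0 = 0)
    (hpi : deriv φ Real.pi = 0) (k : ℕ) :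
    cosCoeff (deriv (deriv φ)) k = -(k : ℝ) ^ 2 * cosCoeff φ k := by
  have key : ∀ ψ : ℝ → ℝ, ContDiff ℝ 2 ψ → (∀ x, HasDerivAt ψ (deriv ψ x) x) ∧
      (∀ x, HasDerivAt (deriv ψ) (deriv (deriv ψ) x) x) ∧ Continuous (deriv (deriv ψ)) := by
    intro ψ hψ
    have h1 : ContDiff ℝ 1 (deriv ψ) := ContDiff.deriv' hψ
    exact ⟨fun x => (hψ.differentiable (by norm_num) x).hasDerivAt,
      fun x => (h1.differentiable (by norm_num) x).hasDerivAt, h1.continuous_deriv le_rfl⟩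
  obtain ⟨a1, a2, a3⟩ := key φ hφ
  obtain ⟨b1, b2, b3⟩ := key (cosBasis k) (contDiff_cosBasis k)
  have hd : ∀ x, HasDerivAt (fun x => deriv φ x * cosBasis k x - φ x * deriv (cosBasis k) x)
      (deriv (deriv φ) x * cosBasis k x - -(k : ℝ) ^ 2 * (φ x * cosBasis k x)) x := fun x => by
    refine (((a2 x).mul (b1 x)).sub ((a1 x).mul (b2 x))).congr_deriv ?_
    rw [deriv_deriv_cosBasis]
    ring
  have hφc := hφ.continuous
  have hmc := continuous_cosBasis k
  have hI := intervalIntegral.integral_eq_sub_of_hasDerivAt (a := 0) (b := Real.pi)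
    (fun x _ => hd x) ((by fun_prop : Continuous _).intervalIntegrable _ _)
  rw [intervalIntegral.integral_sub ((by fun_prop : Continuous _).intervalIntegrable _ _)
    ((by fun_prop : Continuous _).intervalIntegrable _ _), intervalIntegral.integral_const_mul,
    h0, hpi, deriv_cosBasis_zero, deriv_cosBasis_pi] at hI
  simp only [cosCoeff]
  linarith

lemma abs_cosCoeff_le_of_contDiff {φ : ℝ → ℝ} (hφ : ContDiff ℝ 2 φ) (h0 : deriv φ 0 = 0)
    (hpi : deriv φ Real.pi = 0) : ∃ M, 0 ≤ M ∧ ∀ k, |cosCoeff φ k| ≤ M * (1 + (k : ℝ) ^ 2)⁻¹ := by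
  have h1 := abs_cosCoeff_le_integral (hφ.continuous.intervalIntegrable 0 Real.pi)
  have hd : Continuous (deriv (deriv φ)) :=
    (ContDiff.deriv' hφ : ContDiff ℝ 1 (deriv φ)).continuous_deriv le_rfl
  have h2 := abs_cosCoeff_le_integral (hd.intervalIntegrable 0 Real.pi)
  refine ⟨_, (abs_nonneg _).trans (add_le_add (h1 0) (h2 0) |>.trans' (abs_add_le _ _)),
    fun k => ?_⟩
  rw [← div_eq_mul_inv, le_div_iff₀ (by positivity), mul_add, mul_one]
  refine add_le_add (h1 k) ?_
  have := h2 k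
  rwa [cosCoeff_deriv_deriv hφ h0 hpi, abs_mul, abs_neg, abs_of_nonneg (sq_nonneg _),
    mul_comm] at this

lemma cosSeries_cosCoeff_eq {φ : ℝ → ℝ} (hφ : Continuous φ) (hs : Summable (cosCoeff φ)) :
    ∀ x ∈ Icc 0 Real.pi, cosSeries (cosCoeff φ) x = φ x := by
  have hc := continuous_cosSeries hs
  intro x hx
  have := eq_zero_of_cosCoeff_eq_zero (g := fun x => φ x - cosSeries (cosCoeff φ) x)
    (hφ.sub hc).continuousOn (fun k => ?_) x hx
  · linarith
  · have hm := continuous_cosBasis k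
    simp only [cosCoeff, sub_mul]
    rw [intervalIntegral.integral_sub ((by fun_prop : Continuous _).intervalIntegrable _ _)
      ((by fun_prop : Continuous _).intervalIntegrable _ _)]
    exact sub_eq_zero.mpr (cosCoeff_cosSeries hs k).symm

/-- The weak formulation is checked mode by mode: by Parseval's identity both sides are series in
the cosine coefficients of the test function, which are `O(k⁻²)`. -/
theorem isNeumannHeatSolution_heatSol {v₀ : ℝ → ℝ} (hv : IntervalIntegrable v₀ volume 0 Real.pi)
    {f : ℝ → ℝ → ℝ} (hf : IsAdmissible f) :
    IsNeumannHeatSolution v₀ f (heatSol (cosCoeff v₀) f) := by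
  have ha := abs_cosCoeff_le_integral hv
  have hadm := isAdmissible_heatSol ha hf
  refine ⟨hadm.continuousOn, fun T hT => hadm.integrableOn hT, fun φ hφ h0 hpi t ht => ?_⟩
  obtain ⟨M, hM, hφM⟩ := abs_cosCoeff_le_of_contDiff hφ h0 hpi
  have hφs : Summable (cosCoeff φ) := by
    refine Summable.of_norm_bounded (summable_heatWeight.mul_left M) fun k => ?_
    exact (hφM k).trans (mul_le_mul_of_nonneg_left (inv_one_add_sq_le_heatWeight k) hM)
  have hφeq := cosSeries_cosCoeff_eq hφ.continuous hφs
  have hφ2 : Continuous (deriv (deriv φ)) :=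
    (ContDiff.deriv' hφ : ContDiff ℝ 1 (deriv φ)).continuous_deriv le_rfl
  have hpair : ∀ g : ℝ → ℝ, IntervalIntegrable g volume 0 Real.pi →
      HasSum (fun k => cosCoeff φ k * cosCoeff g k) (∫ x in (0 : ℝ)..Real.pi, g x * φ x) := by
    intro g hg
    convert hasSum_integral_cosSeries_mul hφs hg using 1
    refine intervalIntegral.integral_congr fun x hx => ?_
    rw [uIcc_of_le Real.pi_pos.le] at hx
    simp only [hφeq x hx, mul_comm]
  have hslice : ∀ s > 0, HasSum (fun k => cosCoeff φ k *
      (-(k : ℝ) ^ 2 * heatMode (cosCoeff v₀) f k s + cosCoeff (f s) k))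
      (∫ x in (0 : ℝ)..Real.pi,
        (heatSol (cosCoeff v₀) f s x * deriv (deriv φ) x + f s x * φ x)) := by
    intro s hs
    have hfs := continuousOn_slice hf.continuousOn hs
    have hvs := continuousOn_slice hadm.continuousOn hs
    have h1 : HasSum (fun k => heatMode (cosCoeff v₀) f k s * cosCoeff (deriv (deriv φ)) k)
        (∫ x in (0 : ℝ)..Real.pi, heatSol (cosCoeff v₀) f s x * deriv (deriv φ) x) :=
      hasSum_integral_cosSeries_mul (summable_heatMode ha hf hs)
        (hφ2.intervalIntegrable 0 Real.pi)
    have h2 := hpair (f s) (intervalIntegrable_of_continuousOn_pi hfs)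
    have i1 : IntervalIntegrable (fun x => heatSol (cosCoeff v₀) f s x * deriv (deriv φ) x)
      volume 0 Real.pi := intervalIntegrable_of_continuousOn_pi (hvs.mul hφ2.continuousOn)
    have i2 : IntervalIntegrable (fun x => f s x * φ x) volume 0 Real.pi :=
      intervalIntegrable_of_continuousOn_pi (hfs.mul hφ.continuous.continuousOn)
    rw [intervalIntegral.integral_add i1 i2]
    convert h1.add h2 using 1
    funext k
    rw [cosCoeff_deriv_deriv hφ h0 hpi]
    ring
  obtain ⟨C, hC, hbC⟩ := abs_heatMode_le ha hf ht
  obtain ⟨D, hD, hbD⟩ := hf.abs_cosCoeff_le ht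
  have htime := intervalIntegral.hasSum_integral_of_dominated_convergence (a := 0) (b := t)
    (μ := volume) (F := fun k s => cosCoeff φ k *
      (-(k : ℝ) ^ 2 * heatMode (cosCoeff v₀) f k s + cosCoeff (f s) k))
    (f := fun s => ∫ x in (0 : ℝ)..Real.pi,
        (heatSol (cosCoeff v₀) f s x * deriv (deriv φ) x + f s x * φ x))
    (fun k s => (M * (C + D) * heatWeight k) * s ^ (-(3 / 4) : ℝ)) ?_ ?_ ?_ ?_ ?_
  · have h1 : ∀ k, ∫ s in (0 : ℝ)..t, cosCoeff φ k *
        (-(k : ℝ) ^ 2 * heatMode (cosCoeff v₀) f k s + cosCoeff (f s) k) =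
        heatMode (cosCoeff v₀) f k t * cosCoeff φ k - cosCoeff φ k * cosCoeff v₀ k := fun k => by
      rw [intervalIntegral.integral_const_mul, heatMode_integral_eq hf k ht]
      ring
    simp_rw [h1] at htime
    have h2 := (hasSum_integral_cosSeries_mul (summable_heatMode ha hf ht)
      (hφ.continuous.intervalIntegrable 0 Real.pi)).sub (hpair v₀ hv)
    have h3 := htime.unique h2
    rw [h3]
    simp only [heatSol]
    ring
  · intro k
    rw [uIoc_of_le ht.le]
    have h1 := (continuousOn_heatMode (a := cosCoeff v₀) hf k ht.le).mono Ioc_subset_Icc_self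
    have h2 := (hf.continuousOn_cosCoeff k).mono (Ioc_subset_Ioi_self : Ioc 0 t ⊆ Ioi 0)
    have h3 : ContinuousOn (fun s => cosCoeff φ k *
      (-(k : ℝ) ^ 2 * heatMode (cosCoeff v₀) f k s + cosCoeff (f s) k)) (Ioc 0 t) := by fun_prop
    exact h3.aestronglyMeasurable measurableSet_Ioc
  · refine fun k => Eventually.of_forall fun s hs => ?_
    rw [uIoc_of_le ht.le] at hs
    have hs0 := hs.1
    have hw := heatWeight_pos k
    have e1 : |(-(k : ℝ) ^ 2 * heatMode (cosCoeff v₀) f k s + cosCoeff (f s) k)| ≤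
        (k : ℝ) ^ 2 * (C * heatWeight k * s ^ (-(3 / 4) : ℝ)) + D * s ^ (-(3 / 4) : ℝ) := by
      refine (abs_add_le _ _).trans (add_le_add ?_ (hbD s hs k))
      rw [abs_mul, abs_neg, abs_of_nonneg (sq_nonneg _)]
      exact mul_le_mul_of_nonneg_left (hbC s hs k) (sq_nonneg _)
    rw [norm_mul]
    have e2 := mul_le_mul (hφM k) e1 (abs_nonneg _) (by positivity)
    refine e2.trans ?_
    have e3 : (1 + (k : ℝ) ^ 2)⁻¹ * (k : ℝ) ^ 2 ≤ 1 := by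
      rw [inv_mul_le_one₀ (by positivity)]; linarith
    have e4 := inv_one_add_sq_le_heatWeight k
    have e5 : 0 ≤ s ^ (-(3 / 4) : ℝ) := by positivity
    calc _ = M * C * heatWeight k * s ^ (-(3 / 4) : ℝ) * ((1 + (k : ℝ) ^ 2)⁻¹ * (k : ℝ) ^ 2) +
          M * D * s ^ (-(3 / 4) : ℝ) * (1 + (k : ℝ) ^ 2)⁻¹ := by ring
      _ ≤ M * C * heatWeight k * s ^ (-(3 / 4) : ℝ) * 1 +
          M * D * s ^ (-(3 / 4) : ℝ) * heatWeight k := by gcongr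
      _ = _ := by ring
  · exact Eventually.of_forall fun s _ => (summable_heatWeight.mul_left _).mul_right _
  · simp_rw [tsum_mul_right]
    exact intervalIntegrable_rpow_neg.const_mul _
  · refine Eventually.of_forall fun s hs => ?_
    rw [uIoc_of_le ht.le] at hs
    exact hslice s hs.1

/-! ### Uniqueness of weak solutions -/

lemma intervalIntegrable_cosCoeff_slice {v : ℝ → ℝ → ℝ} {T : ℝ} (hT : 0 ≤ T)
    (hv : IntegrableOn (fun z : ℝ × ℝ => v z.1 z.2) (Ioo 0 T ×ˢ Ioo 0 Real.pi)) (k : ℕ) :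
    IntervalIntegrable (fun s => cosCoeff (v s) k) volume 0 T := by
  have h1 : IntegrableOn (fun z : ℝ × ℝ => v z.1 z.2 * cosBasis k z.2)
      (Ioo 0 T ×ˢ Ioo 0 Real.pi) := by
    refine Integrable.mul_bdd (c := 1) hv ?_ (Eventually.of_forall fun z => abs_cosBasis_le k z.2)
    exact ((continuous_cosBasis k).comp continuous_snd).aestronglyMeasurable
  rw [IntegrableOn, Measure.volume_eq_prod, ← Measure.prod_restrict] at h1
  rw [intervalIntegrable_iff_integrableOn_Ioo_of_le hT]
  have h2 := h1.integral_prod_left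
  simp only [cosCoeff, intervalIntegral.integral_of_le Real.pi_pos.le,
    integral_Ioc_eq_integral_Ioo]
  exact h2

/-- The modes of a weak solution satisfy the integrated equations. -/
lemma IsNeumannHeatSolution.cosCoeff_eq {v₀ : ℝ → ℝ} {f v : ℝ → ℝ → ℝ}
    (h : IsNeumannHeatSolution v₀ f v)
    (hfc : ContinuousOn (fun z : ℝ × ℝ => f z.1 z.2) (Ioi 0 ×ˢ Icc 0 Real.pi))
    (hfi : ∀ T : ℝ, 0 < T →
      IntegrableOn (fun z : ℝ × ℝ => f z.1 z.2) (Ioo 0 T ×ˢ Ioo 0 Real.pi))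
    (k : ℕ) {t : ℝ} (ht : 0 < t) :
    cosCoeff (v t) k = cosCoeff v₀ k - (k : ℝ) ^ 2 * (∫ s in (0 : ℝ)..t, cosCoeff (v s) k) +
      ∫ s in (0 : ℝ)..t, cosCoeff (f s) k := by
  have h1 := h.weak (cosBasis k) (contDiff_cosBasis k) (deriv_cosBasis_zero k)
    (deriv_cosBasis_pi k) t ht
  have hvI := intervalIntegrable_cosCoeff_slice ht.le (h.integrableOn t ht) k
  have hfI := intervalIntegrable_cosCoeff_slice ht.le (hfi t ht) k
  have h2 : ∫ s in (0 : ℝ)..t, ∫ x in (0 : ℝ)..Real.pi,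
      (v s x * deriv (deriv (cosBasis k)) x + f s x * cosBasis k x) =
      ∫ s in (0 : ℝ)..t, (-(k : ℝ) ^ 2 * cosCoeff (v s) k + cosCoeff (f s) k) := by
    refine intervalIntegral.integral_congr_ae (Eventually.of_forall fun s hs => ?_)
    rw [uIoc_of_le ht.le] at hs
    have c1 : IntervalIntegrable (fun x => v s x * cosBasis k x) volume 0 Real.pi :=
      intervalIntegrable_of_continuousOn_pi
        ((continuousOn_slice h.continuousOn hs.1).mul (continuous_cosBasis k).continuousOn)
    have c2 : IntervalIntegrable (fun x => f s x * cosBasis k x) volume 0 Real.pi :=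
      intervalIntegrable_of_continuousOn_pi
        ((continuousOn_slice hfc hs.1).mul (continuous_cosBasis k).continuousOn)
    simp_rw [deriv_deriv_cosBasis, mul_left_comm _ (-(k : ℝ) ^ 2)]
    rw [intervalIntegral.integral_add (c1.const_mul _) c2, intervalIntegral.integral_const_mul]
    rfl
  rw [h2, intervalIntegral.integral_add (hvI.const_mul _) hfI,
    intervalIntegral.integral_const_mul] at h1
  change cosCoeff (v t) k = cosCoeff v₀ k + _ at h1
  rw [h1]
  ring

/-- A locally integrable solution of `D' = -c D`, `D(0) = 0`, in integrated form, vanishes. -/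
lemma eq_zero_of_eq_neg_mul_integral {D : ℝ → ℝ} {c : ℝ}
    (hi : ∀ T > 0, IntervalIntegrable D volume 0 T)
    (h : ∀ t > 0, D t = -c * ∫ s in (0 : ℝ)..t, D s) : ∀ t > 0, D t = 0 := by
  intro t ht
  set G : ℝ → ℝ := fun t => ∫ s in (0 : ℝ)..t, D s with hG
  have hGc : ∀ T > 0, ContinuousOn G (Icc 0 T) := fun T hT => by
    have := intervalIntegral.continuousOn_primitive_interval' (a := 0) (hi T hT) left_mem_uIcc
    rwa [uIcc_of_le (le_of_lt hT)] at this
  have hDc : ContinuousOn D (Ioi 0) := by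
    have h1 : ContinuousOn (fun t => -c * G t) (Ioi 0) := by
      intro s hs
      rw [mem_Ioi] at hs
      have := (hGc (2 * s) (by positivity)).continuousAt (x := s)
        (Icc_mem_nhds hs (by linarith))
      exact (continuousAt_const.mul this).continuousWithinAt
    exact h1.congr h
  have hder : ∀ s > 0, HasDerivAt G (D s) s := fun s hs =>
    intervalIntegral.integral_hasDerivAt_right (hi s hs)
      (hDc.stronglyMeasurableAtFilter isOpen_Ioi s hs) (hDc.continuousAt (Ioi_mem_nhds hs))
  have hH : ∀ s ∈ Ioo 0 t, HasDerivAt (fun s => Real.exp (c * s) * G s) 0 s := fun s hs => by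
    have h1 := ((hasDerivAt_id s).const_mul c).exp.mul (hder s hs.1)
    refine h1.congr_deriv ?_
    rw [h s hs.1]
    simp only [id, hG]
    ring
  have hcont : ContinuousOn (fun s => Real.exp (c * s) * G s) (Icc 0 t) := by
    have := hGc t ht
    fun_prop
  have h2 := intervalIntegral.integral_eq_sub_of_hasDerivAt_of_le ht.le hcont hH
    intervalIntegrable_const
  have h3 : G 0 = 0 := by simp [hG]
  have h4 : G t = 0 := by
    simp only [intervalIntegral.integral_zero, h3, mul_zero, sub_zero] at h2
    exact (mul_eq_zero.mp h2.symm).resolve_left (Real.exp_pos _).ne'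
  rw [h t ht]
  simp only [hG] at h4
  rw [h4, mul_zero]

theorem IsNeumannHeatSolution.unique {v₀ : ℝ → ℝ} {f g v w : ℝ → ℝ → ℝ}
    (hv : IsNeumannHeatSolution v₀ f v) (hw : IsNeumannHeatSolution v₀ g w)
    (hfc : ContinuousOn (fun z : ℝ × ℝ => f z.1 z.2) (Ioi 0 ×ˢ Icc 0 Real.pi))
    (hfi : ∀ T : ℝ, 0 < T →
      IntegrableOn (fun z : ℝ × ℝ => f z.1 z.2) (Ioo 0 T ×ˢ Ioo 0 Real.pi))
    (hfg : ∀ t > 0, ∀ x ∈ Icc 0 Real.pi, f t x = g t x) :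
    ∀ t > 0, ∀ x ∈ Icc 0 Real.pi, v t x = w t x := by
  have hgc : ContinuousOn (fun z : ℝ × ℝ => g z.1 z.2) (Ioi 0 ×ˢ Icc 0 Real.pi) :=
    hfc.congr fun z hz => (hfg z.1 hz.1 z.2 hz.2).symm
  have hgi : ∀ T : ℝ, 0 < T →
      IntegrableOn (fun z : ℝ × ℝ => g z.1 z.2) (Ioo 0 T ×ˢ Ioo 0 Real.pi) := fun T hT =>
    (hfi T hT).congr_fun (fun z hz => hfg z.1 hz.1.1 z.2 ⟨hz.2.1.le, hz.2.2.le⟩)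
      (measurableSet_Ioo.prod measurableSet_Ioo)
  have hmode : ∀ k, ∀ t > 0, cosCoeff (v t) k - cosCoeff (w t) k = 0 := by
    intro k
    have hvI := fun T (hT : 0 < T) =>
      intervalIntegrable_cosCoeff_slice hT.le (hv.integrableOn T hT) k
    have hwI := fun T (hT : 0 < T) =>
      intervalIntegrable_cosCoeff_slice hT.le (hw.integrableOn T hT) k
    refine eq_zero_of_eq_neg_mul_integral (D := fun t => cosCoeff (v t) k - cosCoeff (w t) k)
      (c := (k : ℝ) ^ 2) (fun T hT => (hvI T hT).sub (hwI T hT)) fun t ht => ?_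
    have h1 := hv.cosCoeff_eq hfc hfi k ht
    have h2 := hw.cosCoeff_eq hgc hgi k ht
    have h3 : ∫ s in (0 : ℝ)..t, cosCoeff (f s) k = ∫ s in (0 : ℝ)..t, cosCoeff (g s) k := by
      refine intervalIntegral.integral_congr_ae (Eventually.of_forall fun s hs => ?_)
      rw [uIoc_of_le ht.le] at hs
      refine intervalIntegral.integral_congr fun x hx => ?_
      rw [uIcc_of_le Real.pi_pos.le] at hx
      simp only [hfg s hs.1 x hx]
    rw [intervalIntegral.integral_sub (hvI t ht) (hwI t ht)]
    simp only [h1, h2, h3]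
    ring
  intro t ht x hx
  have c1 := continuousOn_slice hv.continuousOn ht
  have c2 := continuousOn_slice hw.continuousOn ht
  refine sub_eq_zero.mp (eq_zero_of_cosCoeff_eq_zero (g := fun x => v t x - w t x) (c1.sub c2)
    (fun k => ?_) x hx)
  rw [← hmode k t ht]
  have hm := (continuous_cosBasis k).continuousOn (s := Icc 0 Real.pi)
  simp only [cosCoeff, sub_mul]
  exact intervalIntegral.integral_sub (intervalIntegrable_of_continuousOn_pi (c1.mul hm))
    (intervalIntegrable_of_continuousOn_pi (c2.mul hm))

/-! ### Existence and uniqueness of the chaos solution -/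

/-- The forcing term of the propagator. -/
def forcing (U : MultiIndex → ℝ → ℝ → ℝ) (α : MultiIndex) (t x : ℝ) : ℝ :=
  ∑ k ∈ α.support, √(α k) * cosBasis k x * U (α - Finsupp.single k 1) t x

lemma degree_sub_single {α : MultiIndex} {k : ℕ} (hk : k ∈ α.support) :
    (α - Finsupp.single k 1).degree + 1 = α.degree := by
  have h : α - Finsupp.single k 1 + Finsupp.single k 1 = α :=
    tsub_add_cancel_of_le (Finsupp.single_le_iff.mpr
      (Nat.one_le_iff_ne_zero.mpr (Finsupp.mem_support_iff.mp hk)))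
  conv_rhs => rw [← h]
  rw [map_add, Finsupp.degree_single]

/-- The solution of the propagator for multi-indices of order `n`, by recursion on `n`. (The value
at a multi-index of another order is irrelevant.) -/
def chaosLevel (u₀ : ℝ → ℝ) : ℕ → MultiIndex → ℝ → ℝ → ℝ
  | 0, _ => heatSol (cosCoeff u₀) fun _ _ => 0
  | n + 1, α => heatSol (cosCoeff 0) (forcing (chaosLevel u₀ n) α)

/-- The chaos solution. -/
def chaosSol (u₀ : ℝ → ℝ) (α : MultiIndex) : ℝ → ℝ → ℝ := chaosLevel u₀ α.degree α

lemma chaosSol_zero (u₀ : ℝ → ℝ) :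
    chaosSol u₀ 0 = heatSol (cosCoeff u₀) fun _ _ => 0 := by
  rw [chaosSol, map_zero, chaosLevel]

lemma chaosSol_of_ne_zero (u₀ : ℝ → ℝ) {α : MultiIndex} (hα : α ≠ 0) :
    chaosSol u₀ α = heatSol (cosCoeff 0) (forcing (chaosSol u₀) α) := by
  have hd : α.degree ≠ 0 := fun h => hα ((Finsupp.degree_eq_zero_iff α).mp h)
  obtain ⟨n, hn⟩ := Nat.exists_eq_succ_of_ne_zero hd
  rw [chaosSol, hn, chaosLevel]
  congr 1
  funext t x
  refine Finset.sum_congr rfl fun k hk => ?_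
  have : (α - Finsupp.single k 1).degree = n := by have := degree_sub_single hk; omega
  rw [chaosSol, this]

lemma isAdmissible_forcing {U : MultiIndex → ℝ → ℝ → ℝ} {α : MultiIndex}
    (h : ∀ k ∈ α.support, IsAdmissible (U (α - Finsupp.single k 1))) :
    IsAdmissible (forcing U α) :=
  IsAdmissible.sum _ fun k hk => (h k hk).mul_cosBasis _ k

lemma abs_cosCoeff_zero_le (k : ℕ) : |cosCoeff 0 k| ≤ 0 := by simp [cosCoeff]

lemma isAdmissible_chaosSol {u₀ : ℝ → ℝ} (hu : IntervalIntegrable u₀ volume 0 Real.pi)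
    (α : MultiIndex) : IsAdmissible (chaosSol u₀ α) := by
  induction h : α.degree generalizing α with
  | zero =>
    rw [(Finsupp.degree_eq_zero_iff α).mp h, chaosSol_zero]
    exact isAdmissible_heatSol (abs_cosCoeff_le_integral hu) IsAdmissible.zero
  | succ n ih =>
    have hα : α ≠ 0 := by rintro rfl; simp at h
    rw [chaosSol_of_ne_zero u₀ hα]
    refine isAdmissible_heatSol abs_cosCoeff_zero_le (isAdmissible_forcing fun k hk => ih _ ?_)
    have := degree_sub_single hk
    omega

theorem isChaosSolution_chaosSol {u₀ : ℝ → ℝ} (hu : IntervalIntegrable u₀ volume 0 Real.pi) :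
    IsChaosSolution u₀ (chaosSol u₀) := by
  intro α
  by_cases hα : α = 0
  · subst hα
    simp only [if_true, Finsupp.support_zero, Finset.sum_empty]
    rw [chaosSol_zero]
    exact isNeumannHeatSolution_heatSol hu IsAdmissible.zero
  · rw [if_neg hα, chaosSol_of_ne_zero u₀ hα]
    exact isNeumannHeatSolution_heatSol intervalIntegrable_const
      (isAdmissible_forcing fun k _ => isAdmissible_chaosSol hu _)

/-- Any chaos solution agrees with the constructed one. -/
theorem IsChaosSolution.eq_chaosSol {u₀ : ℝ → ℝ} (hu : IntervalIntegrable u₀ volume 0 Real.pi)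
    {U : MultiIndex → ℝ → ℝ → ℝ} (hU : IsChaosSolution u₀ U) (α : MultiIndex) :
    ∀ t > 0, ∀ x ∈ Icc 0 Real.pi, U α t x = chaosSol u₀ α t x := by
  induction h : α.degree using Nat.strong_induction_on generalizing α with
  | _ n ih =>
    have hadm : IsAdmissible (forcing (chaosSol u₀) α) :=
      isAdmissible_forcing fun k _ => isAdmissible_chaosSol hu _
    intro t ht x hx
    refine ((isChaosSolution_chaosSol hu α).unique (hU α) hadm.continuousOn
      (fun T hT => hadm.integrableOn hT) (fun s hs y hy => ?_) t ht x hx).symm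
    refine Finset.sum_congr rfl fun k hk => ?_
    rw [ih _ (by have := degree_sub_single hk; omega) _ rfl s hs y hy]

/-! ### Duhamel's formula -/

/-- The Neumann heat kernel on `(0,π)`. -/
def heatKernel (r x y : ℝ) : ℝ :=
  cosSeries (fun j => Real.exp (-(j : ℝ) ^ 2 * r) * cosBasis j x) y

/-- The total mass of the heat weights. -/
def heatMass (T : ℝ) : ℝ := Real.exp T * ∑' k, heatWeight k

lemma heatMass_pos (T : ℝ) : 0 < heatMass T :=
  mul_pos (Real.exp_pos _) (summable_heatWeight.tsum_pos (fun k => (heatWeight_pos k).le) 0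
    (heatWeight_pos 0))

lemma abs_heatKernel_coeff_le {r T : ℝ} (hr : 0 < r) (hT : r ≤ T) (x : ℝ) (j : ℕ) :
    |Real.exp (-(j : ℝ) ^ 2 * r) * cosBasis j x| ≤
      Real.exp T * heatWeight j * r ^ (-(3 / 4) : ℝ) := by
  rw [abs_mul, abs_of_pos (Real.exp_pos _)]
  exact (mul_le_of_le_one_right (Real.exp_pos _).le (abs_cosBasis_le j x)).trans
    (exp_neg_sq_mul_le_of_le j hr hT)

lemma summable_heatKernel_coeff {r : ℝ} (hr : 0 < r) (x : ℝ) :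
    Summable fun j : ℕ => Real.exp (-(j : ℝ) ^ 2 * r) * cosBasis j x :=
  Summable.of_norm_bounded ((summable_heatWeight.mul_left _).mul_right _)
    fun j => abs_heatKernel_coeff_le hr le_rfl x j

lemma continuous_heatKernel {r : ℝ} (hr : 0 < r) (x : ℝ) : Continuous (heatKernel r x) :=
  continuous_cosSeries (summable_heatKernel_coeff hr x)

lemma integral_heatKernel_sq_le {r T : ℝ} (hr : 0 < r) (hT : r ≤ T) (x : ℝ) :
    ∫ y in (0 : ℝ)..Real.pi, heatKernel r x y ^ 2 ≤ heatMass T * r ^ (-(3 / 4) : ℝ) := by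
  have h := hasSum_sq_cosSeries (summable_heatKernel_coeff hr x)
  rw [heatMass, ← tsum_mul_left, ← tsum_mul_right]
  refine hasSum_le (fun j => ?_) h ((summable_heatWeight.mul_left _).mul_right _).hasSum
  rw [← sq_abs]
  refine (pow_le_of_le_one (abs_nonneg _) ?_ two_ne_zero).trans
    (abs_heatKernel_coeff_le hr hT x j)
  rw [abs_mul, abs_of_pos (Real.exp_pos _)]
  refine mul_le_one₀ ?_ (abs_nonneg _) (abs_cosBasis_le j x)
  rw [Real.exp_le_one_iff]
  nlinarith [sq_nonneg (j : ℝ)]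

/-- Duhamel's formula for the solution with vanishing initial condition. -/
lemma heatSol_eq_integral {f : ℝ → ℝ → ℝ} (hf : IsAdmissible f) {t : ℝ} (ht : 0 < t) (x : ℝ) :
    IntervalIntegrable
      (fun s => ∫ y in (0 : ℝ)..Real.pi, heatKernel (t - s) x y * f s y) volume 0 t ∧
    heatSol (cosCoeff 0) f t x =
      ∫ s in (0 : ℝ)..t, ∫ y in (0 : ℝ)..Real.pi, heatKernel (t - s) x y * f s y := by
  set F : ℕ → ℝ → ℝ := fun j s =>
    Real.exp (-(j : ℝ) ^ 2 * (t - s)) * cosBasis j x * cosCoeff (f s) j with hF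
  obtain ⟨C, hC, hbC⟩ := hf.abs_cosCoeff_le ht
  obtain ⟨hbi, -⟩ := beta_integral (a := 1 / 4) (b := 1 / 4) (by norm_num) (by norm_num) ht
  rw [show (1 / 4 - 1 : ℝ) = -(3 / 4) by norm_num] at hbi
  have hne : ∀ᵐ s : ℝ, s ≠ t := by simp [ae_iff]
  have hbound : ∀ j s, s ∈ Ioc 0 t → s ≠ t → ‖F j s‖ ≤
      (Real.exp t * C * heatWeight j) * (s ^ (-(3 / 4) : ℝ) * (t - s) ^ (-(3 / 4) : ℝ)) := by
    intro j s hs hst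
    have hst' : 0 < t - s := sub_pos.mpr (lt_of_le_of_ne hs.2 hst)
    have hw := heatWeight_pos j
    rw [norm_mul]
    calc _ ≤ (Real.exp t * heatWeight j * (t - s) ^ (-(3 / 4) : ℝ)) *
          (C * s ^ (-(3 / 4) : ℝ)) :=
          mul_le_mul (abs_heatKernel_coeff_le hst' (by linarith [hs.1]) x j) (hbC s hs j)
            (abs_nonneg _) (by positivity)
      _ = _ := by ring
  have hmeas : ∀ j, AEStronglyMeasurable (F j) (volume.restrict (uIoc 0 t)) := fun j => by
    rw [uIoc_of_le ht.le]
    have h2 := (hf.continuousOn_cosCoeff j).mono (Ioc_subset_Ioi_self : Ioc 0 t ⊆ Ioi 0)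
    have h3 : ContinuousOn (F j) (Ioc 0 t) := by fun_prop
    exact h3.aestronglyMeasurable measurableSet_Ioc
  have hsum : ∀ s ∈ Ioc 0 t, s ≠ t →
      HasSum (fun j => F j s) (∫ y in (0 : ℝ)..Real.pi, heatKernel (t - s) x y * f s y) := by
    intro s hs hst
    have hst' : 0 < t - s := sub_pos.mpr (lt_of_le_of_ne hs.2 hst)
    exact hasSum_integral_cosSeries_mul (summable_heatKernel_coeff hst' x)
      (intervalIntegrable_of_continuousOn_pi (continuousOn_slice hf.continuousOn hs.1))
  constructor
  · have hdom := hbi.const_mul (Real.exp t * C * ∑' j, heatWeight j)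
    refine hdom.mono_fun' ?_ ?_
    · refine aestronglyMeasurable_of_tendsto_ae atTop
        (f := fun n s => ∑ j ∈ Finset.range n, F j s) (fun n => ?_) ?_
      · exact Finset.aestronglyMeasurable_fun_sum _ fun j _ => hmeas j
      · rw [uIoc_of_le ht.le, ae_restrict_iff' measurableSet_Ioc]
        filter_upwards [hne] with s hst hs
        exact (hsum s hs hst).tendsto_sum_nat
    · rw [uIoc_of_le ht.le, EventuallyLE, ae_restrict_iff' measurableSet_Ioc]
      filter_upwards [hne] with s hst hs
      rw [← (hsum s hs hst).tsum_eq, ← tsum_mul_left, ← tsum_mul_right]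
      exact tsum_of_norm_bounded ((summable_heatWeight.mul_left _).mul_right _).hasSum
        fun j => hbound j s hs hst
  · have htime := intervalIntegral.hasSum_integral_of_dominated_convergence (a := 0) (b := t)
      (μ := volume) (F := F)
      (f := fun s => ∫ y in (0 : ℝ)..Real.pi, heatKernel (t - s) x y * f s y)
      (fun j s => (Real.exp t * C * heatWeight j) *
        (s ^ (-(3 / 4) : ℝ) * (t - s) ^ (-(3 / 4) : ℝ))) hmeas ?_ ?_ ?_ ?_
    · rw [← htime.tsum_eq]
      refine tsum_congr fun j => ?_
      simp only [heatMode_eq]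
      simp only [cosCoeff, Pi.zero_apply, zero_mul, intervalIntegral.integral_zero, mul_zero,
        zero_add, hF]
      rw [← intervalIntegral.integral_mul_const]
      congr 1
      funext s
      ring
    · intro j
      filter_upwards [hne] with s hst hs
      rw [uIoc_of_le ht.le] at hs
      exact hbound j s hs hst
    · exact Eventually.of_forall fun s _ => (summable_heatWeight.mul_left _).mul_right _
    · simp_rw [tsum_mul_right]
      exact hbi.const_mul _
    · filter_upwards [hne] with s hst hs
      rw [uIoc_of_le ht.le] at hs
      exact hsum s hs hst

/-! ### Growth of the chaos solution in the order of the chaos -/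

/-- One step of the propagator, at a fixed time: the Cauchy-Schwarz inequality over the indices
`k` in the support (the weights `α k` add up to `n + 1`), then Bessel's inequality. -/
lemma sum_sq_integral_mul_forcing_le {U : MultiIndex → ℝ → ℝ → ℝ} (hU : ∀ α, IsAdmissible (U α))
    {n : ℕ} {s A : ℝ} (hs : 0 < s)
    (hA : ∀ B : Finset MultiIndex, (∀ β ∈ B, β.degree = n) → ∀ y ∈ Icc 0 Real.pi,
      ∑ β ∈ B, U β s y ^ 2 ≤ A)
    {p : ℝ → ℝ} (hp : Continuous p) (S : Finset MultiIndex) (hS : ∀ α ∈ S, α.degree = n + 1) :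
    ∑ α ∈ S, (∫ y in (0 : ℝ)..Real.pi, p y * forcing U α s y) ^ 2 ≤
      (n + 1) * (A * ∫ y in (0 : ℝ)..Real.pi, p y ^ 2) := by
  have hUc : ∀ β, ContinuousOn (U β s) (Icc 0 Real.pi) := fun β =>
    continuousOn_slice (hU β).continuousOn hs
  have hpU : ∀ β, ContinuousOn (fun y => p y * U β s y) (Icc 0 Real.pi) := fun β =>
    hp.continuousOn.mul (hUc β)
  set h : ℕ → MultiIndex → ℝ := fun k β => cosCoeff (fun y => p y * U β s y) k with hh
  have h1 : ∀ α, ∫ y in (0 : ℝ)..Real.pi, p y * forcing U α s y =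
      ∑ k ∈ α.support, √(α k) * h k (α - Finsupp.single k 1) := by
    intro α
    have : ∀ y, p y * forcing U α s y = ∑ k ∈ α.support,
        √(α k) * ((p y * U (α - Finsupp.single k 1) s y) * cosBasis k y) := fun y => by
      rw [forcing, Finset.mul_sum]
      exact Finset.sum_congr rfl fun k _ => by ring
    simp_rw [this]
    rw [intervalIntegral.integral_finsetSum]
    · simp_rw [intervalIntegral.integral_const_mul]
      rfl
    · intro k _
      exact (intervalIntegrable_of_continuousOn_pi
        ((hpU _).mul (continuous_cosBasis k).continuousOn)).const_mul _
  have h2 : ∀ α ∈ S, (∫ y in (0 : ℝ)..Real.pi, p y * forcing U α s y) ^ 2 ≤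
      (n + 1) * ∑ k ∈ α.support, h k (α - Finsupp.single k 1) ^ 2 := by
    intro α hα
    rw [h1]
    refine (Finset.sum_mul_sq_le_sq_mul_sq _ _ _).trans_eq ?_
    congr 1
    simp_rw [Real.sq_sqrt (Nat.cast_nonneg _)]
    have := hS α hα
    rw [Finsupp.degree_apply] at this
    exact_mod_cast this
  -- The map `(α, k) ↦ (α - ε(k), k)` is injective, so the remaining double sum is part of a sum
  -- over all `β` of order `n` and all `k`, to which Bessel's inequality applies for each `β`.
  set K : Finset ℕ := S.biUnion fun α => α.support with hK
  set I : Finset (Σ _ : MultiIndex, ℕ) := S.sigma fun α => α.support with hI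
  set B : Finset MultiIndex := I.image fun i => i.1 - Finsupp.single i.2 1 with hB
  have hmem : ∀ i ∈ I, i.1 ∈ S ∧ i.2 ∈ i.1.support := fun i hi => Finset.mem_sigma.mp hi
  have hBdeg : ∀ β ∈ B, β.degree = n := by
    intro β hβ
    obtain ⟨i, hi, rfl⟩ := Finset.mem_image.mp hβ
    have := degree_sub_single (hmem i hi).2
    rw [hS _ (hmem i hi).1] at this
    omega
  have hinj : Set.InjOn (fun i : (Σ _ : MultiIndex, ℕ) => (i.1 - Finsupp.single i.2 1, i.2)) I := by
    rintro ⟨α, k⟩ hi ⟨β, l⟩ hj hij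
    simp only [Prod.mk.injEq] at hij
    obtain ⟨hαβ, rfl⟩ := hij
    have hle : ∀ γ : MultiIndex, k ∈ γ.support → Finsupp.single k 1 ≤ γ := fun γ hγ =>
      Finsupp.single_le_iff.mpr (Nat.one_le_iff_ne_zero.mpr (Finsupp.mem_support_iff.mp hγ))
    have e1 := tsub_add_cancel_of_le (hle α (hmem _ hi).2)
    have e2 := tsub_add_cancel_of_le (hle β (hmem _ hj).2)
    rw [← e1, ← e2, hαβ]
  have h3 : ∑ α ∈ S, ∑ k ∈ α.support, h k (α - Finsupp.single k 1) ^ 2 ≤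
      ∑ β ∈ B, ∑ k ∈ K, h k β ^ 2 := by
    rw [Finset.sum_sigma', ← Finset.sum_product' B K fun β k => h k β ^ 2,
      ← Finset.sum_image (f := fun q : MultiIndex × ℕ => h q.2 q.1 ^ 2) hinj]
    refine Finset.sum_le_sum_of_subset_of_nonneg ?_ fun _ _ _ => sq_nonneg _
    intro q hq
    obtain ⟨i, hi, rfl⟩ := Finset.mem_image.mp hq
    exact Finset.mem_product.mpr ⟨Finset.mem_image_of_mem _ hi,
      Finset.mem_biUnion.mpr ⟨i.1, (hmem i hi).1, (hmem i hi).2⟩⟩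
  have h4 : ∑ β ∈ B, ∑ k ∈ K, h k β ^ 2 ≤ A * ∫ y in (0 : ℝ)..Real.pi, p y ^ 2 := by
    refine (Finset.sum_le_sum fun β _ => sum_cosCoeff_sq_le (hpU β) K).trans ?_
    have hi : ∀ β ∈ B, IntervalIntegrable (fun y => (p y * U β s y) ^ 2) volume 0 Real.pi :=
      fun β _ => intervalIntegrable_of_continuousOn_pi ((hpU β).pow 2)
    rw [← intervalIntegral.integral_finsetSum hi, ← intervalIntegral.integral_const_mul]
    refine intervalIntegral.integral_mono_on Real.pi_pos.le ?_
      (((hp.pow 2).intervalIntegrable _ _).const_mul _) fun y hy => ?_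
    · exact intervalIntegrable_of_continuousOn_pi
        (continuousOn_finsetSum _ fun β _ => (hpU β).pow 2)
    · simp_rw [mul_pow, ← Finset.mul_sum, mul_comm A]
      exact mul_le_mul_of_nonneg_left (hA B hBdeg y hy) (sq_nonneg _)
  calc _ ≤ ∑ α ∈ S, (n + 1) * ∑ k ∈ α.support, h k (α - Finsupp.single k 1) ^ 2 :=
        Finset.sum_le_sum h2
    _ ≤ _ := by
        rw [← Finset.mul_sum]
        exact mul_le_mul_of_nonneg_left (h3.trans h4) (by positivity)

/-- The growth estimate for the multi-indices of order `n` has the form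
`C t ^ (growthExp n - 1)`. The first step contributes `t ^ (-3/4)`, the admissible singularity, and
each further step gains `5/8`, because the `L₂` norm of the heat kernel is at most a multiple of
`r ^ (5/8 - 1)`. -/
def growthExp (n : ℕ) : ℝ := 1 / 4 + 5 / 8 * n

lemma growthExp_pos (n : ℕ) : 0 < growthExp n := by unfold growthExp; positivity

/-- The constants in the growth estimate: `√(n + 1)` comes from the weights `√(α k)` of the
propagator and the beta function from the convolution in time of two power singularities. Their
product behaves like `n ^ (1/2 - 5/8)`, so that the constants decay superexponentially. -/
def growthConst (C K : ℝ) : ℕ → ℝ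
  | 0 => C
  | n + 1 => √((n + 1) * K) * beta (growthExp n) (5 / 8) * growthConst C K n

lemma growthConst_pos {C K : ℝ} (hC : 0 < C) (hK : 0 < K) (n : ℕ) : 0 < growthConst C K n := by
  induction n with
  | zero => exact hC
  | succ n ih =>
    have := beta_pos (growthExp_pos n) (show (0 : ℝ) < 5 / 8 by norm_num)
    rw [growthConst]
    positivity

/-- The growth estimate, by Minkowski's inequality in time applied to Duhamel's formula. -/
theorem sum_sq_chaosSol_le {u₀ : ℝ → ℝ} (hu : IntervalIntegrable u₀ volume 0 Real.pi) {T : ℝ}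
    (hT : 0 < T) : ∃ C, 0 < C ∧ ∀ n (S : Finset MultiIndex), (∀ α ∈ S, α.degree = n) →
      ∀ t ∈ Ioc 0 T, ∀ x ∈ Icc 0 Real.pi,
        ∑ α ∈ S, chaosSol u₀ α t x ^ 2 ≤
          (growthConst C (heatMass T) n * t ^ (growthExp n - 1)) ^ 2 := by
  have hadm := isAdmissible_chaosSol hu
  obtain ⟨C, hC, hb⟩ := (hadm 0).bound T hT
  have hC1 : 0 < C + 1 := by linarith
  refine ⟨C + 1, hC1, fun n => ?_⟩
  have hK := heatMass_pos T
  induction n with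
  | zero =>
    intro S hS t ht x hx
    have hS0 : S ⊆ {0} := fun α hα =>
      Finset.mem_singleton.mpr ((Finsupp.degree_eq_zero_iff α).mp (hS α hα))
    refine (Finset.sum_le_sum_of_subset_of_nonneg hS0 fun _ _ _ => sq_nonneg _).trans ?_
    rw [Finset.sum_singleton, ← sq_abs]
    have := ht.1
    refine pow_le_pow_left₀ (abs_nonneg _) ((hb t ht x hx).trans ?_) 2
    rw [growthConst, growthExp, show (1 / 4 + 5 / 8 * ((0 : ℕ) : ℝ) - 1 : ℝ) = -(3 / 4) by norm_num]
    gcongr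
    linarith
  | succ n ih =>
    intro S hS t ht x hx
    have ht0 := ht.1
    have hcn := growthConst_pos hC1 hK n
    set c := growthConst (C + 1) (heatMass T) n with hc
    set G : MultiIndex → ℝ → ℝ := fun α s =>
      ∫ y in (0 : ℝ)..Real.pi, heatKernel (t - s) x y * forcing (chaosSol u₀) α s y with hG
    have hfor : ∀ α, IsAdmissible (forcing (chaosSol u₀) α) := fun α =>
      isAdmissible_forcing fun k _ => hadm _
    have hrep : ∀ α ∈ S, chaosSol u₀ α t x = ∫ s in (0 : ℝ)..t, G α s := by
      intro α hα
      have hα0 : α ≠ 0 := by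
        rintro rfl
        have := hS 0 hα
        simp at this
      conv_lhs => rw [chaosSol_of_ne_zero u₀ hα0]
      exact (heatSol_eq_integral (hfor α) ht0 x).2
    -- Minkowski by duality: pair Duhamel's formula with the vector `(chaosSol u₀ α t x)_α` itself.
    set Q := √(∑ α ∈ S, chaosSol u₀ α t x ^ 2) with hQ
    have hQ2 : Q ^ 2 = ∑ α ∈ S, chaosSol u₀ α t x ^ 2 :=
      Real.sq_sqrt (Finset.sum_nonneg fun _ _ => sq_nonneg _)
    have hQ0 : 0 ≤ Q := Real.sqrt_nonneg _
    obtain ⟨hbi, hbv⟩ := beta_integral (growthExp_pos n) (show (0 : ℝ) < 5 / 8 by norm_num) ht0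
    set D := √((n + 1) * heatMass T) * c with hD
    have hD0 : 0 ≤ D := by positivity
    have hpt : ∀ s ∈ Ioo 0 t, |∑ α ∈ S, chaosSol u₀ α t x * G α s| ≤
        Q * D * (s ^ (growthExp n - 1) * (t - s) ^ ((5 / 8 : ℝ) - 1)) := by
      intro s hs
      have hs0 := hs.1
      have hts : 0 < t - s := sub_pos.mpr hs.2
      have hstep := sum_sq_integral_mul_forcing_le hadm hs.1
        (fun B hB y hy => ih B hB s ⟨hs.1, hs.2.le.trans ht.2⟩ y hy)
        (continuous_heatKernel hts x) S hS
      have hker := integral_heatKernel_sq_le hts (by linarith [ht.2]) x (T := T)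
      have hGsq : ∑ α ∈ S, G α s ^ 2 ≤
          (D * (s ^ (growthExp n - 1) * (t - s) ^ ((5 / 8 : ℝ) - 1))) ^ 2 := by
        refine hstep.trans ((mul_le_mul_of_nonneg_left (mul_le_mul_of_nonneg_left hker
          (sq_nonneg _)) (by positivity)).trans_eq ?_)
        have e1 : (t - s) ^ (-(3 / 4) : ℝ) = ((t - s) ^ ((5 / 8 : ℝ) - 1)) ^ 2 := by
          rw [← Real.rpow_natCast, ← Real.rpow_mul hts.le]
          norm_num
        have e2 : √((n + 1) * heatMass T) ^ 2 = (n + 1) * heatMass T :=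
          Real.sq_sqrt (by positivity)
        rw [e1, hD]
        simp only [mul_pow]
        rw [e2]
        ring
      refine abs_le_of_sq_le_sq ?_ (by positivity)
      refine (Finset.sum_mul_sq_le_sq_mul_sq _ _ _).trans ?_
      rw [mul_assoc Q D, mul_pow Q, hQ2]
      exact mul_le_mul_of_nonneg_left hGsq (Finset.sum_nonneg fun _ _ => sq_nonneg _)
    have hint : Q ^ 2 = ∫ s in (0 : ℝ)..t, ∑ α ∈ S, chaosSol u₀ α t x * G α s := by
      rw [intervalIntegral.integral_finsetSum fun α _ =>
        (heatSol_eq_integral (hfor α) ht0 x).1.const_mul _, hQ2]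
      refine Finset.sum_congr rfl fun α hα => ?_
      rw [intervalIntegral.integral_const_mul, ← hrep α hα, sq]
    have hle : Q ^ 2 ≤ Q * (D * (t ^ (growthExp n + 5 / 8 - 1) * beta (growthExp n) (5 / 8))) := by
      rw [hint, ← hbv, ← mul_assoc, ← intervalIntegral.integral_const_mul]
      refine (le_abs_self _).trans (intervalIntegral.norm_integral_le_of_norm_le
        (f := fun s => ∑ α ∈ S, chaosSol u₀ α t x * G α s) ht0.le ?_ (hbi.const_mul _))
      have hne : ∀ᵐ s : ℝ, s ≠ t := by simp [ae_iff]
      filter_upwards [hne] with s hst hs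
      exact hpt s ⟨hs.1, lt_of_le_of_ne hs.2 hst⟩
    have hexp : growthExp (n + 1) = growthExp n + 5 / 8 := by
      simp only [growthExp]; push_cast; ring
    have hfinal : Q ≤ growthConst (C + 1) (heatMass T) (n + 1) * t ^ (growthExp (n + 1) - 1) := by
      have hR : growthConst (C + 1) (heatMass T) (n + 1) * t ^ (growthExp (n + 1) - 1) =
          D * (t ^ (growthExp n + 5 / 8 - 1) * beta (growthExp n) (5 / 8)) := by
        rw [growthConst, hexp, ← hc, hD]
        ring
      rw [hR]
      rcases hQ0.eq_or_lt with h0 | h0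
      · rw [← h0, ← hR]
        have := growthConst_pos hC1 hK (n + 1)
        positivity
      · rw [sq] at hle
        exact le_of_mul_le_mul_left hle h0
    rw [← hQ2]
    exact pow_le_pow_left₀ hQ0 hfinal 2

/-- `Γ` is log-convex, so the beta function decays like the power `-5/8` of its argument. -/
lemma beta_growthExp_le {n : ℕ} (hn : 1 ≤ n) :
    beta (growthExp n) (5 / 8) ≤ Real.Gamma (5 / 8) * ((n : ℝ) / 2) ^ (-(5 / 8) : ℝ) := by
  have hn' : (1 : ℝ) ≤ n := by exact_mod_cast hn
  set z := growthExp n - 3 / 8 with hz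
  have hzn : (n : ℝ) / 2 ≤ z := by rw [hz, growthExp]; linarith
  have hz0 : 0 < z := by linarith
  have h1 : Real.Gamma (growthExp n + 5 / 8) = z * Real.Gamma z := by
    rw [← Real.Gamma_add_one hz0.ne', hz]
    congr 1
    ring
  have hG := Real.Gamma_pos_of_pos hz0
  have h2 := Real.Gamma_mul_add_mul_le_rpow_Gamma_mul_rpow_Gamma hz0
    (show 0 < z + 1 by linarith) (show (0 : ℝ) < 5 / 8 by norm_num)
    (show (0 : ℝ) < 3 / 8 by norm_num) (by norm_num)
  have h3 : 5 / 8 * z + 3 / 8 * (z + 1) = growthExp n := by rw [hz]; ring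
  rw [h3, Real.Gamma_add_one hz0.ne', Real.mul_rpow hz0.le hG.le, mul_left_comm,
    ← Real.rpow_add hG] at h2
  norm_num at h2
  have h4 : Real.Gamma (growthExp n) / Real.Gamma (growthExp n + 5 / 8) ≤
      ((n : ℝ) / 2) ^ (-(5 / 8) : ℝ) := by
    rw [h1, div_le_iff₀ (by positivity)]
    have h5 : z ^ (-(5 / 8) : ℝ) ≤ ((n : ℝ) / 2) ^ (-(5 / 8) : ℝ) :=
      Real.rpow_le_rpow_of_nonpos (by positivity) hzn (by norm_num)
    refine h2.trans ?_
    have h6 : z ^ (3 / 8 : ℝ) = z ^ (-(5 / 8) : ℝ) * z := by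
      rw [← Real.rpow_add_one hz0.ne']; norm_num
    rw [h6, mul_assoc]
    exact mul_le_mul_of_nonneg_right h5 (by positivity)
  have hG5 := Real.Gamma_pos_of_pos (show (0 : ℝ) < 5 / 8 by norm_num)
  rw [beta, mul_comm (Real.Gamma (growthExp n)), mul_div_assoc]
  exact mul_le_mul_of_nonneg_left h4 hG5.le

lemma summable_pow_mul_growthConst_sq {C K : ℝ} (hC : 0 < C) (hK : 0 < K) {q : ℝ} (hq : 0 < q) :
    Summable fun n => q ^ n * growthConst C K n ^ 2 := by
  have hpos := growthConst_pos hC hK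
  have hfpos : ∀ n, 0 < q ^ n * growthConst C K n ^ 2 := fun n =>
    mul_pos (pow_pos hq n) (pow_pos (hpos n) 2)
  have hratio : ∀ n, ‖q ^ (n + 1) * growthConst C K (n + 1) ^ 2‖ /
      ‖q ^ n * growthConst C K n ^ 2‖ = q * K * ((n + 1) * beta (growthExp n) (5 / 8) ^ 2) := by
    intro n
    have := (hpos n).ne'
    rw [Real.norm_of_nonneg (hfpos _).le, Real.norm_of_nonneg (hfpos _).le, growthConst, mul_pow,
      mul_pow, Real.sq_sqrt (by positivity), pow_succ]
    field_simp
  set M := Real.Gamma (5 / 8) with hM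
  have hM0 : 0 < M := Real.Gamma_pos_of_pos (by norm_num)
  refine summable_of_ratio_test_tendsto_lt_one zero_lt_one
    (Eventually.of_forall fun n => (hfpos n).ne') ?_
  simp_rw [hratio]
  suffices hs : Tendsto (fun n : ℕ => ((n : ℝ) + 1) * beta (growthExp n) (5 / 8) ^ 2)
      atTop (𝓝 0) by simpa using hs.const_mul (q * K)
  have hlim : Tendsto (fun n : ℕ => 4 * M ^ 2 * ((n : ℝ) / 2) ^ (-(1 / 4) : ℝ)) atTop (𝓝 0) := by
    have := (tendsto_rpow_neg_atTop (show (0 : ℝ) < 1 / 4 by norm_num)).comp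
      ((tendsto_natCast_atTop_atTop (R := ℝ)).atTop_div_const (show (0 : ℝ) < 2 by norm_num))
    simpa using this.const_mul (4 * M ^ 2)
  refine squeeze_zero' (Eventually.of_forall fun n => by positivity) ?_ hlim
  filter_upwards [eventually_ge_atTop 1] with n hn
  have hn' : (1 : ℝ) ≤ n := by exact_mod_cast hn
  have hb := beta_growthExp_le hn
  have hb0 := beta_pos (growthExp_pos n) (show (0 : ℝ) < 5 / 8 by norm_num)
  calc ((n : ℝ) + 1) * beta (growthExp n) (5 / 8) ^ 2
      ≤ (4 * ((n : ℝ) / 2)) * (M * ((n : ℝ) / 2) ^ (-(5 / 8) : ℝ)) ^ 2 := by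
        gcongr
        linarith
    _ = 4 * M ^ 2 * (((n : ℝ) / 2) ^ (-(5 / 8) : ℝ) * ((n : ℝ) / 2) ^ (-(5 / 8) : ℝ) *
          ((n : ℝ) / 2) ^ (1 : ℝ)) := by rw [Real.rpow_one]; ring
    _ = _ := by
        rw [← Real.rpow_add (by positivity), ← Real.rpow_add (by positivity)]
        norm_num

/-- At a point, the chaos coefficients decay faster than geometrically in the degree. -/
theorem summable_pow_degree_mul_chaosSol_sq {u₀ : ℝ → ℝ}
    (hu : IntervalIntegrable u₀ volume 0 Real.pi) {q t x : ℝ} (hq : 0 < q) (ht : 0 < t)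
    (hx : x ∈ Icc 0 Real.pi) :
    Summable fun α : MultiIndex => q ^ α.degree * chaosSol u₀ α t x ^ 2 := by
  obtain ⟨C, hC, h⟩ := sum_sq_chaosSol_le hu ht
  set c := growthConst C (heatMass t) with hc
  have hsum := (summable_pow_mul_growthConst_sq hC (heatMass_pos t)
    (q := q * t ^ (5 / 4 : ℝ)) (by positivity)).mul_right (t ^ (-(3 / 2) : ℝ))
  refine summable_of_sum_le (c := ∑' n, (q * t ^ (5 / 4 : ℝ)) ^ n * c n ^ 2 * t ^ (-(3 / 2) : ℝ))
    (fun α => by positivity) fun S => ?_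
  rw [← Finset.sum_fiberwise_of_maps_to (t := S.image Finsupp.degree) (g := Finsupp.degree)
    fun α hα => Finset.mem_image_of_mem _ hα]
  refine le_trans (Finset.sum_le_sum fun n _ => ?_)
    (hsum.sum_le_tsum (S.image Finsupp.degree) fun n _ => by positivity)
  have h1 : ∑ α ∈ S with α.degree = n, q ^ α.degree * chaosSol u₀ α t x ^ 2 =
      q ^ n * ∑ α ∈ S with α.degree = n, chaosSol u₀ α t x ^ 2 := by
    rw [Finset.mul_sum]
    refine Finset.sum_congr rfl fun α hα => ?_
    rw [(Finset.mem_filter.mp hα).2]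
  rw [h1]
  have h2 := h n (S.filter fun α => α.degree = n) (fun α hα => (Finset.mem_filter.mp hα).2) t
    ⟨ht, le_rfl⟩ x hx
  refine (mul_le_mul_of_nonneg_left h2 (by positivity)).trans_eq ?_
  have h3 : (t ^ (growthExp n - 1)) ^ 2 = (t ^ (5 / 4 : ℝ)) ^ n * t ^ (-(3 / 2) : ℝ) := by
    rw [← Real.rpow_natCast, ← Real.rpow_natCast, ← Real.rpow_mul ht.le, ← Real.rpow_mul ht.le,
      ← Real.rpow_add ht, growthExp]
    congr 1
    push_cast
    ring
  rw [mul_pow, mul_pow, h3]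
  ring

/-! ### Hermite polynomials under the standard Gaussian measure -/

open Polynomial in
lemma derivative_hermite_succ (n : ℕ) :
    derivative (hermite (n + 1)) = ((n : ℤ[X]) + 1) * hermite n := by
  induction n with
  | zero => simp
  | succ n ih =>
    rw [hermite_succ (n + 1), derivative_sub, derivative_mul, derivative_X, ih, derivative_mul]
    have h1 : derivative ((n : ℤ[X]) + 1) = 0 := by simp
    rw [h1]
    have h2 := hermite_succ n
    push_cast
    linear_combination (-(n : ℤ[X]) - 1) * h2

/-- The Hermite polynomial as a real polynomial. -/
def hermiteReal (n : ℕ) : Polynomial ℝ := (Polynomial.hermite n).map (algebraMap ℤ ℝ)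

lemma aeval_hermite (n : ℕ) (x : ℝ) :
    Polynomial.aeval x (Polynomial.hermite n) = (hermiteReal n).eval x := by
  rw [hermiteReal, Polynomial.eval_map_algebraMap]

lemma hermiteReal_zero : hermiteReal 0 = 1 := by
  simp [hermiteReal]

lemma hermiteReal_succ (n : ℕ) :
    hermiteReal (n + 1) = Polynomial.X * hermiteReal n - Polynomial.derivative (hermiteReal n) := by
  simp [hermiteReal, Polynomial.hermite_succ, Polynomial.derivative_map]

lemma derivative_hermiteReal_succ (n : ℕ) :
    Polynomial.derivative (hermiteReal (n + 1)) = ((n : Polynomial ℝ) + 1) * hermiteReal n := by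
  rw [hermiteReal, Polynomial.derivative_map, derivative_hermite_succ]
  simp [hermiteReal]

/-- The normalized Hermite polynomial `He_n / √(n!)` as a function. -/
def hermiteFun (n : ℕ) (x : ℝ) : ℝ :=
  Polynomial.aeval x (Polynomial.hermite n) / √(Nat.factorial n)

lemma hermiteFun_eq (n : ℕ) (x : ℝ) :
    hermiteFun n x = (hermiteReal n).eval x / √(Nat.factorial n) := by
  rw [hermiteFun, aeval_hermite]

lemma hermiteFun_zero (x : ℝ) : hermiteFun 0 x = 1 := by
  simp [hermiteFun_eq, hermiteReal_zero]

lemma continuous_hermiteFun (n : ℕ) : Continuous (hermiteFun n) := by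
  have : hermiteFun n = fun x => (hermiteReal n).eval x / √(Nat.factorial n) :=
    funext (hermiteFun_eq n)
  rw [this]
  exact (hermiteReal n).continuous.div_const _

/-- The standard Gaussian measure on the real line. -/
abbrev stdGauss : Measure ℝ := gaussianReal 0 1

lemma integrable_stdGauss_iff {f : ℝ → ℝ} :
    Integrable f stdGauss ↔ Integrable (fun x => gaussianPDFReal 0 1 x * f x) := by
  rw [stdGauss, gaussianReal_of_var_ne_zero 0 one_ne_zero,
    integrable_withDensity_iff_integrable_smul' (measurable_gaussianPDF _ _)
      (Eventually.of_forall fun _ => gaussianPDF_lt_top)]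
  simp [toReal_gaussianPDF]

lemma integrable_polynomial_stdGauss (p : Polynomial ℝ) :
    Integrable (fun x => p.eval x) stdGauss := by
  simp_rw [Polynomial.eval_eq_sum_range]
  refine integrable_finsetSum _ fun n _ => Integrable.const_mul ?_ _
  have h := (memLp_id_gaussianReal (μ := 0) (v := 1) n).integrable_norm_pow'
  refine h.mono' (by fun_prop) (Eventually.of_forall fun x => ?_)
  simp

/-- Integration by parts for the Gaussian measure. -/
lemma integral_X_mul_stdGauss (p : Polynomial ℝ) :
    ∫ x, x * p.eval x ∂stdGauss = ∫ x, (Polynomial.derivative p).eval x ∂stdGauss := by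
  have hpdf : ∀ x : ℝ, HasDerivAt (gaussianPDFReal 0 1) (-x * gaussianPDFReal 0 1 x) x := by
    intro x
    have h1 : HasDerivAt (fun x : ℝ => -(x - 0) ^ 2 / (2 * ((1 : NNReal) : ℝ))) (-x) x := by
      have := (((hasDerivAt_id x).sub_const 0).pow 2).neg.div_const (2 * ((1 : NNReal) : ℝ))
      refine this.congr_deriv ?_
      simp
      ring
    have h2 := h1.exp.const_mul (√(2 * Real.pi * ((1 : NNReal) : ℝ)))⁻¹
    refine h2.congr_deriv ?_
    rw [gaussianPDFReal_def]
    ring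
  have e1 := integrable_stdGauss_iff.mp (integrable_polynomial_stdGauss (Polynomial.X * p))
  have e2 := integrable_stdGauss_iff.mp
    (integrable_polynomial_stdGauss (Polynomial.derivative p))
  have e3 := integrable_stdGauss_iff.mp (integrable_polynomial_stdGauss p)
  have h := integral_mul_deriv_eq_deriv_mul_of_integrable
    (u := fun x => p.eval x) (v := gaussianPDFReal 0 1)
    (u' := fun x => (Polynomial.derivative p).eval x) (v' := fun x => -x * gaussianPDFReal 0 1 x)
    (fun x _ => p.hasDerivAt x) (fun x _ => hpdf x) ?_ ?_ ?_
  · rw [stdGauss, integral_gaussianReal_eq_integral_smul one_ne_zero,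
      integral_gaussianReal_eq_integral_smul one_ne_zero]
    rw [← neg_inj, ← integral_neg, ← integral_neg, eq_comm, integral_neg]
    simp only [smul_eq_mul]
    refine Eq.trans ?_ (h.symm.trans ?_)
    · congr 1
      refine integral_congr_ae (Eventually.of_forall fun x => ?_)
      simp only
      ring
    · refine integral_congr_ae (Eventually.of_forall fun x => ?_)
      simp only
      ring
  · refine e1.neg.congr (Eventually.of_forall fun x => ?_)
    simp
    ring
  · refine e2.congr (Eventually.of_forall fun x => ?_)
    simp
    ring
  · refine e3.congr (Eventually.of_forall fun x => ?_)
    simp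
    ring

lemma integral_hermiteReal_succ_mul (n : ℕ) (p : Polynomial ℝ) :
    ∫ x, (hermiteReal (n + 1)).eval x * p.eval x ∂stdGauss =
      ∫ x, (hermiteReal n).eval x * (Polynomial.derivative p).eval x ∂stdGauss := by
  have h := integral_X_mul_stdGauss (hermiteReal n * p)
  have i1 := integrable_polynomial_stdGauss (Polynomial.X * (hermiteReal n * p))
  have i2 := integrable_polynomial_stdGauss (Polynomial.derivative (hermiteReal n) * p)
  have i3 := integrable_polynomial_stdGauss (hermiteReal n * Polynomial.derivative p)
  simp only [Polynomial.eval_mul, Polynomial.eval_X] at i1 i2 i3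
  simp only [Polynomial.eval_mul, Polynomial.derivative_mul, Polynomial.eval_add] at h
  rw [integral_add i2 i3] at h
  simp_rw [hermiteReal_succ, Polynomial.eval_sub, Polynomial.eval_mul, Polynomial.eval_X, sub_mul,
    mul_assoc]
  rw [integral_sub i1 i2, h]
  ring

lemma integral_hermiteReal_mul (m n : ℕ) :
    ∫ x, (hermiteReal m).eval x * (hermiteReal n).eval x ∂stdGauss =
      if m = n then (Nat.factorial n : ℝ) else 0 := by
  induction m generalizing n with
  | zero =>
    rcases n with _ | n
    · simp [hermiteReal_zero]
    · have h := integral_hermiteReal_succ_mul n 1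
      simp only [Polynomial.derivative_one, Polynomial.eval_zero, mul_zero, integral_zero,
        Polynomial.eval_one, mul_one] at h
      simp [hermiteReal_zero, h]
  | succ m ih =>
    rw [integral_hermiteReal_succ_mul]
    rcases n with _ | n
    · simp [hermiteReal_zero]
    · rw [derivative_hermiteReal_succ]
      have : ∀ x : ℝ, (hermiteReal m).eval x * (((n : Polynomial ℝ) + 1) * hermiteReal n).eval x =
          (n + 1) * ((hermiteReal m).eval x * (hermiteReal n).eval x) := fun x => by
        simp
        ring
      simp_rw [this]
      rw [integral_const_mul, ih]
      simp only [add_left_inj]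
      split_ifs
      · rw [Nat.factorial_succ]; push_cast; ring
      · simp

/-- The normalized Hermite polynomials are orthonormal. -/
lemma integral_hermiteFun_mul (m n : ℕ) :
    ∫ x, hermiteFun m x * hermiteFun n x ∂stdGauss = if m = n then 1 else 0 := by
  have : ∀ x, hermiteFun m x * hermiteFun n x = (√(Nat.factorial m) * √(Nat.factorial n))⁻¹ *
      ((hermiteReal m).eval x * (hermiteReal n).eval x) := fun x => by
    rw [hermiteFun_eq, hermiteFun_eq, div_mul_div_comm, div_eq_inv_mul]
  simp_rw [this]
  rw [integral_const_mul, integral_hermiteReal_mul]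
  split_ifs with h
  · subst h
    rw [Real.mul_self_sqrt (Nat.cast_nonneg _)]
    exact inv_mul_cancel₀ (by exact_mod_cast Nat.factorial_ne_zero m)
  · simp

lemma integral_hermiteFun_succ (n : ℕ) : ∫ x, hermiteFun (n + 1) x ∂stdGauss = 0 := by
  have := integral_hermiteFun_mul (n + 1) 0
  simpa [hermiteFun_zero] using this

/-- A pointwise bound, by the three-term recurrence. -/
lemma abs_hermiteReal_le (n : ℕ) (x : ℝ) : |(hermiteReal n).eval x| ≤ (|x| + √n) ^ n := by
  induction n using Nat.twoStepInduction with
  | zero => simp [hermiteReal_zero]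
  | one => simp [hermiteReal_succ, hermiteReal_zero]
  | more n ih0 ih1 =>
    rw [hermiteReal_succ, derivative_hermiteReal_succ]
    simp only [Polynomial.eval_sub, Polynomial.eval_mul, Polynomial.eval_X, Polynomial.eval_add,
      Polynomial.eval_natCast, Polynomial.eval_one]
    have hx := abs_nonneg x
    set s := √((n + 2 : ℕ) : ℝ) with hs
    have hs0 : 0 ≤ s := Real.sqrt_nonneg _
    have hs2 : s ^ 2 = n + 2 := by rw [hs, Real.sq_sqrt (Nat.cast_nonneg _)]; push_cast; ring
    have h0 : √(n : ℝ) ≤ s := Real.sqrt_le_sqrt (by push_cast; linarith)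
    have h1 : √((n + 1 : ℕ) : ℝ) ≤ s := Real.sqrt_le_sqrt (by push_cast; linarith)
    have b0 : |(hermiteReal n).eval x| ≤ (|x| + s) ^ n := ih0.trans (by gcongr)
    have b1 : |(hermiteReal (n + 1)).eval x| ≤ (|x| + s) ^ (n + 1) := ih1.trans (by gcongr)
    calc |x * (hermiteReal (n + 1)).eval x - (n + 1) * (hermiteReal n).eval x|
        ≤ |x| * (|x| + s) ^ (n + 1) + (n + 1) * (|x| + s) ^ n := by
          refine (abs_sub _ _).trans ?_
          rw [abs_mul, abs_mul, abs_of_nonneg (show (0 : ℝ) ≤ n + 1 by positivity)]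
          gcongr
      _ = (|x| + s) ^ n * (|x| * (|x| + s) + (n + 1)) := by ring
      _ ≤ (|x| + s) ^ n * (|x| + s) ^ 2 := by
          gcongr
          nlinarith [mul_nonneg hx hs0]
      _ = _ := by ring

/-- A Gaussian-type bound with an exponential dependence on the degree: in
`(|x| + √n)^n ≤ √n^n e^(√n |x|)` the first factor is compared with `√(n!)` and the second is split
by Young's inequality. -/
lemma abs_hermiteFun_le (n : ℕ) (x : ℝ) {L : ℝ} (hL : 0 < L) :
    |hermiteFun n x| ≤ Real.exp (1 / 2 + L) ^ n * Real.exp (x ^ 2 / (4 * L)) := by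
  rcases Nat.eq_zero_or_pos n with rfl | hn
  · rw [hermiteFun_zero, abs_one, pow_zero, one_mul]
    exact Real.one_le_exp (by positivity)
  have hn0 : (0 : ℝ) < n := by exact_mod_cast hn
  have hsn : 0 < √(n : ℝ) := Real.sqrt_pos.mpr hn0
  have hfac : (0 : ℝ) < Nat.factorial n := by exact_mod_cast Nat.factorial_pos n
  have hfs : 0 < √(Nat.factorial n : ℝ) := Real.sqrt_pos.mpr hfac
  have h1 : √(n : ℝ) ^ n ≤ Real.exp (1 / 2) ^ n * √(Nat.factorial n) := by
    refine abs_le_of_sq_le_sq (a := √(n : ℝ) ^ n) ?_ (by positivity) |> (le_abs_self _).trans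
    have := Real.pow_div_factorial_le_exp (n : ℝ) hn0.le n
    rw [div_le_iff₀ hfac] at this
    rw [mul_pow, Real.sq_sqrt hfac.le, ← pow_mul, mul_comm n 2, pow_mul, Real.sq_sqrt hn0.le,
      ← Real.exp_nat_mul, ← Real.exp_nat_mul]
    convert this using 3
    push_cast
    ring
  have h2 : (|x| + √n) ^ n ≤ √(n : ℝ) ^ n * Real.exp (√n * |x|) := by
    have e1 : |x| + √n = √n * (|x| / √n + 1) := by field_simp
    rw [e1, mul_pow]
    refine mul_le_mul_of_nonneg_left ?_ (by positivity)
    refine (pow_le_pow_left₀ (by positivity) (Real.add_one_le_exp _) n).trans_eq ?_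
    rw [← Real.exp_nat_mul]
    congr 1
    field_simp
    rw [Real.sq_sqrt hn0.le, mul_comm]
  have h3 : √n * |x| ≤ n * L + x ^ 2 / (4 * L) := by
    have e : n * L + x ^ 2 / (4 * L) - √n * |x| = (√n * (2 * L) - |x|) ^ 2 / (4 * L) := by
      rw [sub_sq, mul_pow, Real.sq_sqrt hn0.le, sq_abs]
      field_simp
      ring
    have : 0 ≤ (√n * (2 * L) - |x|) ^ 2 / (4 * L) := by positivity
    linarith
  rw [hermiteFun_eq, abs_div, abs_of_pos hfs, div_le_iff₀ hfs]
  refine (abs_hermiteReal_le n x).trans (h2.trans ?_)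
  calc √(n : ℝ) ^ n * Real.exp (√n * |x|)
      ≤ (Real.exp (1 / 2) ^ n * √(Nat.factorial n)) * Real.exp (n * L + x ^ 2 / (4 * L)) := by
        gcongr
    _ = _ := by
        rw [Real.exp_add, Real.exp_add, mul_pow, Real.exp_nat_mul L]
        ring

lemma integrable_exp_sq_stdGauss : Integrable (fun x : ℝ => Real.exp (x ^ 2 / 4)) stdGauss := by
  rw [integrable_stdGauss_iff]
  have h := (integrable_exp_neg_mul_sq (show (0 : ℝ) < 1 / 4 by norm_num)).const_mul
    (√(2 * Real.pi))⁻¹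
  refine h.congr (Eventually.of_forall fun x => ?_)
  simp only [gaussianPDFReal_def, NNReal.coe_one, mul_one, sub_zero]
  rw [mul_assoc, ← Real.exp_add]
  congr 2
  ring

/-- The even moments of the normalized Hermite polynomials grow at most geometrically. -/
lemma exists_integral_hermiteFun_pow_le (m : ℕ) (hm : 1 ≤ m) : ∃ K : ℝ, 1 ≤ K ∧
    ∀ n, ∫ x, hermiteFun n x ^ (2 * m) ∂stdGauss ≤ (K ^ n) ^ (2 * m) := by
  set I := ∫ x, Real.exp (x ^ 2 / 4) ∂stdGauss with hI
  set M := max 1 I with hM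
  have hM1 : 1 ≤ M := le_max_left _ _
  have hm0 : (0 : ℝ) < m := by exact_mod_cast hm
  set E := Real.exp (1 / 2 + 2 * m) with hE
  have hE1 : 1 ≤ E := Real.one_le_exp (by positivity)
  refine ⟨M * E, one_le_mul_of_one_le_of_one_le hM1 hE1, fun n => ?_⟩
  rcases Nat.eq_zero_or_pos n with rfl | hn
  · simp [hermiteFun_zero]
  have hpt : ∀ x, hermiteFun n x ^ (2 * m) ≤ (E ^ n) ^ (2 * m) * Real.exp (x ^ 2 / 4) := by
    intro x
    have h := abs_hermiteFun_le n x (show (0 : ℝ) < 2 * m by positivity)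
    rw [← (even_two_mul m).pow_abs]
    refine (pow_le_pow_left₀ (abs_nonneg _) h _).trans_eq ?_
    rw [mul_pow, ← Real.exp_nat_mul (x ^ 2 / (4 * (2 * m)))]
    congr 2
    push_cast
    field_simp
  refine (integral_mono_of_nonneg (Eventually.of_forall fun x => (even_two_mul m).pow_nonneg _)
    (integrable_exp_sq_stdGauss.const_mul _) (Eventually.of_forall hpt)).trans ?_
  rw [integral_const_mul, mul_pow, mul_pow, mul_comm]
  refine mul_le_mul_of_nonneg_right ?_ (by positivity)
  rw [← pow_mul]
  refine (le_max_right 1 I).trans ?_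
  exact le_self_pow₀ hM1 (by positivity)

/-! ### Products of Hermite polynomials -/

/-- The product `∏ₖ He_{α k}(ξ k) / √((α k)!)`. -/
def hermiteProd {Ω : Type*} (ξ : ℕ → Ω → ℝ) (α : MultiIndex) (ω : Ω) : ℝ :=
  ∏ k ∈ α.support, hermiteFun (α k) (ξ k ω)

lemma xi_eq_hermiteProd {Ω : Type*} (W : L2 → Ω → ℝ) (α : MultiIndex) :
    xi W α = hermiteProd (fun k => W (cosBasisL2 k)) α := rfl

lemma hermiteProd_eq_prod {Ω : Type*} (ξ : ℕ → Ω → ℝ) {α : MultiIndex} {s : Finset ℕ}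
    (hs : α.support ⊆ s) (ω : Ω) : hermiteProd ξ α ω = ∏ k ∈ s, hermiteFun (α k) (ξ k ω) := by
  refine Finset.prod_subset hs fun k _ hk => ?_
  rw [Finsupp.notMem_support_iff.mp hk, hermiteFun_zero]

section StdGauss

variable {Ω : Type*} [MeasurableSpace Ω] {P : Measure Ω}

/-! ### From white noise to independent standard Gaussian variables -/

/-- `ξ` is a sequence of independent standard Gaussian random variables. -/
structure IsStdGaussSeq (P : Measure Ω) (ξ : ℕ → Ω → ℝ) : Prop where
  measurable : ∀ k, Measurable (ξ k)
  indep : iIndepFun ξ P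
  law : ∀ k, P.map (ξ k) = stdGauss

lemma inner_cosBasisL2 (j k : ℕ) :
    inner ℝ (cosBasisL2 j) (cosBasisL2 k) = if j = k then (1 : ℝ) else 0 := by
  rw [← integral_cosBasis_mul, L2.inner_def, intervalIntegral.integral_of_le Real.pi_pos.le,
    integral_Ioc_eq_integral_Ioo, ← mu]
  refine integral_congr_ae ?_
  filter_upwards [(memLp_cosBasis j).coeFn_toLp, (memLp_cosBasis k).coeFn_toLp] with x hj hk
  rw [cosBasisL2, cosBasisL2, hj, hk]
  simp [mul_comm]

namespace IsWhiteNoise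

variable {W : L2 → Ω → ℝ}

lemma memLp_two (hW : IsWhiteNoise P W) (h : L2) : MemLp (W h) 2 P :=
  (hW.gaussian h).memLp_two

/-- White noise is almost surely linear, because it preserves inner products. -/
lemma sum_ae_eq (hW : IsWhiteNoise P W) {ι : Type*} (s : Finset ι) (c : ι → ℝ) (g : ι → L2) :
    (fun ω => ∑ i ∈ s, c i * W (g i) ω) =ᵐ[P] W (∑ i ∈ s, c i • g i) := by
  set w : L2 → Lp ℝ 2 P := fun h => (hW.memLp_two h).toLp (W h) with hw
  have hinner : ∀ g h, inner ℝ (w g) (w h) = inner ℝ g h := by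
    intro g h
    rw [← hW.covariance, L2.inner_def]
    refine integral_congr_ae ?_
    filter_upwards [(hW.memLp_two g).coeFn_toLp, (hW.memLp_two h).coeFn_toLp] with x hj hk
    rw [hw, hj, hk]
    simp [mul_comm]
  have hlin : ∑ i ∈ s, c i • w (g i) = w (∑ i ∈ s, c i • g i) := by
    rw [← sub_eq_zero, ← inner_self_eq_zero (𝕜 := ℝ)]
    simp only [inner_sub_left, inner_sub_right, sum_inner, inner_sum, hinner, inner_smul_left,
      inner_smul_right]
    simp [real_inner_comm, Finset.mul_sum]
  have h1 : (fun ω => ∑ i ∈ s, c i * W (g i) ω) =ᵐ[P] ⇑(∑ i ∈ s, c i • w (g i)) := by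
    have h2 : ∀ i ∈ s, ⇑(c i • w (g i)) =ᵐ[P] fun ω => c i * W (g i) ω := fun i _ => by
      filter_upwards [Lp.coeFn_smul (c i) (w (g i)), (hW.memLp_two (g i)).coeFn_toLp] with ω h3 h4
      rw [h3, Pi.smul_apply, hw, h4, smul_eq_mul]
    have h3 : ∀ᵐ ω ∂P, ∀ i ∈ s, (c i • w (g i)) ω = c i * W (g i) ω :=
      (Finset.eventually_all s).mpr h2
    filter_upwards [h3, Lp.coeFn_finsetSum s fun i => c i • w (g i)] with ω h4 h5
    rw [h5, Finset.sum_apply]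
    exact (Finset.sum_congr rfl fun i hi => h4 i hi).symm
  refine h1.trans ?_
  rw [hlin]
  exact (hW.memLp_two _).coeFn_toLp

lemma isStdGaussSeq [IsProbabilityMeasure P] (hW : IsWhiteNoise P W) :
    IsStdGaussSeq P fun k => W (cosBasisL2 k) := by
  refine ⟨fun k => hW.measurable _, ?_, fun k => ?_⟩
  · rw [iIndepFun_iff_finset]
    intro s
    have hgauss : HasGaussianLaw (fun ω => fun i : s => W (cosBasisL2 i) ω) P := by
      have hm : Measurable fun ω => fun i : s => W (cosBasisL2 i) ω :=
        measurable_pi_lambda _ fun i => hW.measurable _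
      refine ⟨⟨fun L => ?_⟩⟩
      rw [Measure.map_map L.continuous.measurable hm]
      have hL : (⇑L ∘ fun ω => fun i : s => W (cosBasisL2 i) ω) =ᵐ[P]
          W (∑ i : s, L (fun j => if i = j then 1 else 0) • cosBasisL2 i) := by
        refine EventuallyEq.trans (Eventually.of_forall fun ω => ?_)
          (hW.sum_ae_eq Finset.univ (fun i : s => L (fun j => if i = j then 1 else 0))
            fun i => cosBasisL2 i)
        simp only [Function.comp]
        refine (L.toLinearMap.pi_apply_eq_sum_univ _).trans (Finset.sum_congr rfl fun i _ => ?_)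
        rw [smul_eq_mul, mul_comm]
        rfl
      have h1 := ((hW.gaussian _).congr hL.symm).map_eq_gaussianReal
      rw [h1, integral_map hm.aemeasurable (by fun_prop),
        variance_map (by fun_prop) hm.aemeasurable]
      rfl
    refine hgauss.iIndepFun_of_covariance_eq_zero fun i j hij => ?_
    rw [covariance_eq_sub (hW.memLp_two _) (hW.memLp_two _)]
    have h1 := hW.covariance (cosBasisL2 i) (cosBasisL2 j)
    rw [inner_cosBasisL2, if_neg fun h => hij (Subtype.ext h)] at h1
    simp only [Pi.mul_apply, hW.mean_zero, mul_zero, sub_zero]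
    exact h1
  · have h1 := (hW.gaussian (cosBasisL2 k)).map_eq_gaussianReal
    rw [h1, hW.mean_zero, variance_of_integral_eq_zero (hW.measurable _).aemeasurable
      (hW.mean_zero _)]
    have h2 := hW.covariance (cosBasisL2 k) (cosBasisL2 k)
    rw [inner_cosBasisL2, if_pos rfl] at h2
    simp_rw [sq, h2]
    simp

end IsWhiteNoise

/-! ### Random variables with finite moments -/

/-- Finiteness of all moments. -/
def HasAllMoments (P : Measure Ω) (f : Ω → ℝ) : Prop := ∀ p : ℝ≥0∞, p ≠ ∞ → MemLp f p P

namespace HasAllMoments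

lemma mul {f g : Ω → ℝ} (hf : HasAllMoments P f) (hg : HasAllMoments P g) :
    HasAllMoments P fun ω => f ω * g ω := by
  intro p hp
  have h2 : 2 * p ≠ ∞ := ENNReal.mul_ne_top (by simp) hp
  have : ENNReal.HolderTriple (2 * p) (2 * p) p := by
    constructor
    rw [← two_mul, ENNReal.mul_inv (by simp) (by simp), ← mul_assoc,
      ENNReal.mul_inv_cancel (by simp) (by simp), one_mul]
  exact MemLp.mul' (hg _ h2) (hf _ h2)

lemma const [IsFiniteMeasure P] (c : ℝ) : HasAllMoments P fun _ => c := fun _ _ => memLp_const c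

lemma const_mul {f : Ω → ℝ} (hf : HasAllMoments P f) (c : ℝ) :
    HasAllMoments P fun ω => c * f ω := fun p hp => (hf p hp).const_mul c

lemma add {f g : Ω → ℝ} (hf : HasAllMoments P f) (hg : HasAllMoments P g) :
    HasAllMoments P fun ω => f ω + g ω := fun p hp => (hf p hp).add (hg p hp)

lemma sum {ι : Type*} (s : Finset ι) {f : ι → Ω → ℝ} (hf : ∀ i ∈ s, HasAllMoments P (f i)) :
    HasAllMoments P fun ω => ∑ i ∈ s, f i ω := fun p hp =>
  memLp_finsetSum s fun i hi => hf i hi p hp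

lemma prod [IsFiniteMeasure P] {ι : Type*} (s : Finset ι) {f : ι → Ω → ℝ}
    (hf : ∀ i ∈ s, HasAllMoments P (f i)) : HasAllMoments P fun ω => ∏ i ∈ s, f i ω := by
  classical
  induction s using Finset.induction_on with
  | empty => simpa using const 1
  | insert a s ha ih =>
    simp_rw [Finset.prod_insert ha]
    exact (hf a (Finset.mem_insert_self a s)).mul
      (ih fun i hi => hf i (Finset.mem_insert_of_mem hi))

lemma pow [IsFiniteMeasure P] {f : Ω → ℝ} (hf : HasAllMoments P f) (n : ℕ) :
    HasAllMoments P fun ω => f ω ^ n := by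
  induction n with
  | zero => simpa using const 1
  | succ n ih => simpa only [pow_succ] using ih.mul hf

lemma integrable {f : Ω → ℝ} (hf : HasAllMoments P f) : Integrable f P :=
  memLp_one_iff_integrable.mp (hf 1 (by simp))

end HasAllMoments

/-! ### Orthonormality of the Cameron-Martin basis -/

namespace IsStdGaussSeq

variable {ξ : ℕ → Ω → ℝ}

lemma integral_comp (hξ : IsStdGaussSeq P ξ) (k : ℕ) {f : ℝ → ℝ} (hf : Continuous f) :
    ∫ ω, f (ξ k ω) ∂P = ∫ x, f x ∂stdGauss := by
  rw [← hξ.law k, integral_map (hξ.measurable k).aemeasurable hf.aestronglyMeasurable]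

lemma hasAllMoments_hermiteFun [IsProbabilityMeasure P] (hξ : IsStdGaussSeq P ξ) (k n : ℕ) :
    HasAllMoments P fun ω => hermiteFun n (ξ k ω) := by
  have h1 : HasAllMoments P (ξ k) := fun p hp => by
    have := memLp_id_gaussianReal' (μ := 0) (v := 1) p hp
    rw [← stdGauss, ← hξ.law k, memLp_map_measure_iff (by fun_prop)
      (hξ.measurable k).aemeasurable] at this
    exact this
  have h2 : (fun ω => hermiteFun n (ξ k ω)) = fun ω =>
      ∑ i ∈ Finset.range ((hermiteReal n).natDegree + 1),
        ((√(Nat.factorial n))⁻¹ * (hermiteReal n).coeff i) * ξ k ω ^ i := by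
    funext ω
    rw [hermiteFun_eq, Polynomial.eval_eq_sum_range, div_eq_inv_mul, Finset.mul_sum]
    exact Finset.sum_congr rfl fun i _ => by ring
  rw [h2]
  exact HasAllMoments.sum _ fun i _ => (h1.pow i).const_mul _

lemma hasAllMoments_hermiteProd [IsProbabilityMeasure P] (hξ : IsStdGaussSeq P ξ)
    (α : MultiIndex) : HasAllMoments P (hermiteProd ξ α) :=
  HasAllMoments.prod _ fun k _ => hξ.hasAllMoments_hermiteFun k (α k)

/-- The Cameron-Martin basis is orthonormal. -/
lemma integral_hermiteProd_mul [IsProbabilityMeasure P] (hξ : IsStdGaussSeq P ξ)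
    (α β : MultiIndex) :
    ∫ ω, hermiteProd ξ α ω * hermiteProd ξ β ω ∂P = if α = β then 1 else 0 := by
  set s := α.support ∪ β.support with hs
  have h1 : ∀ ω, hermiteProd ξ α ω * hermiteProd ξ β ω =
      ∏ k : s, (fun x => hermiteFun (α k) x * hermiteFun (β k) x) (ξ k ω) := fun ω => by
    rw [hermiteProd_eq_prod ξ Finset.subset_union_left,
      hermiteProd_eq_prod ξ Finset.subset_union_right, ← Finset.prod_mul_distrib,
      ← Finset.prod_coe_sort]
  have hc : ∀ k : ℕ, Continuous fun x => hermiteFun (α k) x * hermiteFun (β k) x := fun k =>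
    (continuous_hermiteFun _).mul (continuous_hermiteFun _)
  simp_rw [h1]
  have hind : iIndepFun (fun k : s => ξ k) P := hξ.indep.precomp Subtype.val_injective
  rw [hind.integral_fun_prod_comp
    (f := fun (k : s) x => hermiteFun (α k) x * hermiteFun (β k) x)
    (fun k => (hξ.measurable k).aemeasurable) fun k => (hc k).aestronglyMeasurable]
  have h2 : ∀ k : s, ∫ ω, hermiteFun (α k) (ξ k ω) * hermiteFun (β k) (ξ k ω) ∂P =
      if α k = β k then 1 else 0 := fun k => by
    rw [hξ.integral_comp k (hc k), integral_hermiteFun_mul]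
  simp_rw [h2]
  split_ifs with h
  · subst h
    simp
  · obtain ⟨k, hk⟩ := DFunLike.ne_iff.mp h
    have hks : k ∈ s := by
      by_contra hks
      rw [hs, Finset.mem_union, not_or, Finsupp.notMem_support_iff,
        Finsupp.notMem_support_iff] at hks
      exact hk (hks.1.trans hks.2.symm)
    exact Finset.prod_eq_zero (Finset.mem_univ ⟨k, hks⟩) (if_neg hk)

end IsStdGaussSeq

end StdGauss

/-! ### Weak hypercontractivity -/

lemma measurable_hermiteProd {Ω : Type*} {ξ : ℕ → Ω → ℝ} {β : MultiIndex} {s : Finset ℕ}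
    (hβ : β.support ⊆ s) :
    Measurable[⨆ k ∈ (s : Set ℕ), MeasurableSpace.comap (ξ k) inferInstance]
      (hermiteProd ξ β) := by
  unfold hermiteProd
  refine Finset.measurable_fun_prod _ fun k hk => ?_
  refine (continuous_hermiteFun _).measurable.comp ?_
  refine (comap_measurable (ξ k)).mono ?_ le_rfl
  exact le_iSup₂_of_le k (hβ hk) le_rfl

section Moments

variable {Ω : Type*} [MeasurableSpace Ω] {P : Measure Ω}

/-- The binomial expansion of an even power up to first order. -/
lemma add_pow_two_mul_le (a b : ℝ) {m : ℕ} (hm : 1 ≤ m) :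
    (a + b) ^ (2 * m) ≤ a ^ (2 * m) + 2 * m * (a ^ (2 * m - 1) * b) +
      4 ^ m * ((a ^ 2) ^ (m - 1) * b ^ 2 + (b ^ 2) ^ m) := by
  obtain ⟨l, rfl⟩ : ∃ l, m = l + 1 := ⟨m - 1, by omega⟩
  set N := 2 * l with hN
  have hterm : ∀ i ∈ Finset.range (N + 1), a ^ (N - i) * b ^ (i + 2) ≤
      (a ^ 2) ^ l * b ^ 2 + (b ^ 2) ^ (l + 1) := by
    intro i hi
    have hi' : i ≤ N := Nat.lt_succ_iff.mp (Finset.mem_range.mp hi)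
    have h1 : |a| ^ (N - i) * |b| ^ i ≤ |a| ^ N + |b| ^ N := by
      rcases le_total |a| |b| with h | h
      · have : |a| ^ (N - i) * |b| ^ i ≤ |b| ^ (N - i) * |b| ^ i := by gcongr
        rw [← pow_add, Nat.sub_add_cancel hi'] at this
        exact this.trans (le_add_of_nonneg_left (by positivity))
      · have : |a| ^ (N - i) * |b| ^ i ≤ |a| ^ (N - i) * |a| ^ i := by gcongr
        rw [← pow_add, Nat.sub_add_cancel hi'] at this
        exact this.trans (le_add_of_nonneg_right (by positivity))
    have h2 : a ^ (N - i) * b ^ (i + 2) ≤ |a| ^ (N - i) * |b| ^ i * b ^ 2 := by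
      rw [pow_add, ← mul_assoc]
      refine mul_le_mul_of_nonneg_right ?_ (sq_nonneg b)
      rw [← abs_pow, ← abs_pow, ← abs_mul]
      exact le_abs_self _
    refine h2.trans ((mul_le_mul_of_nonneg_right h1 (sq_nonneg b)).trans_eq ?_)
    rw [hN, pow_mul, pow_mul, sq_abs, sq_abs]
    ring
  have hexp : (a + b) ^ (2 * (l + 1)) = a ^ (2 * (l + 1)) + 2 * (l + 1) * (a ^ (N + 1) * b) +
      ∑ i ∈ Finset.range (N + 1), a ^ (N - i) * b ^ (i + 2) * ((N + 2).choose (i + 2) : ℝ) := by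
    rw [show 2 * (l + 1) = N + 2 by omega, add_comm a b, add_pow, Finset.sum_range_succ',
      Finset.sum_range_succ']
    have h3 : ∀ i, N + 2 - (i + 1 + 1) = N - i := fun i => by omega
    simp only [h3, Nat.choose_zero_right, Nat.choose_one_right, zero_add, pow_zero, pow_one,
      one_mul, mul_one, Nat.sub_zero, show N + 2 - 1 = N + 1 by omega, Nat.cast_one]
    have h4 : ∑ i ∈ Finset.range (N + 1), b ^ (i + 1 + 1) * a ^ (N - i) *
        ((N + 2).choose (i + 1 + 1) : ℝ) = ∑ i ∈ Finset.range (N + 1),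
          a ^ (N - i) * b ^ (i + 2) * ((N + 2).choose (i + 2) : ℝ) :=
      Finset.sum_congr rfl fun i _ => by ring
    rw [h4, hN]
    push_cast
    ring
  have hchoose : ∑ i ∈ Finset.range (N + 1), ((N + 2).choose (i + 2) : ℝ) ≤ 4 ^ (l + 1) := by
    have h5 := Nat.sum_range_choose (N + 2)
    rw [Finset.sum_range_succ', Finset.sum_range_succ'] at h5
    have h6 : (4 : ℕ) ^ (l + 1) = 2 ^ (N + 2) := by
      rw [hN, show 2 * l + 2 = 2 * (l + 1) by ring, pow_mul]
      norm_num
    have h7 : ∑ i ∈ Finset.range (N + 1), (N + 2).choose (i + 2) ≤ 4 ^ (l + 1) := by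
      rw [h6, ← h5]
      exact (Nat.le_add_right _ _).trans (Nat.le_add_right _ _)
    exact_mod_cast h7
  have hR : 0 ≤ (a ^ 2) ^ l * b ^ 2 + (b ^ 2) ^ (l + 1) := by positivity
  rw [hexp]
  simp only [Nat.add_sub_cancel, show 2 * (l + 1) - 1 = N + 1 by omega]
  push_cast
  refine add_le_add le_rfl ?_
  calc _ ≤ ∑ i ∈ Finset.range (N + 1), ((a ^ 2) ^ l * b ^ 2 + (b ^ 2) ^ (l + 1)) *
        ((N + 2).choose (i + 2) : ℝ) :=
        Finset.sum_le_sum fun i hi => mul_le_mul_of_nonneg_right (hterm i hi) (Nat.cast_nonneg _)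
    _ ≤ _ := by
        rw [← Finset.mul_sum, mul_comm]
        exact mul_le_mul_of_nonneg_right hchoose hR

/-- The two-function inequality behind hypercontractivity: a perturbation `b` that is small in
`L^(2m)` and orthogonal to `a^(2m-1)` contributes only quadratically. -/
lemma integral_add_pow_le [IsProbabilityMeasure P] {a b : Ω → ℝ} (ha : HasAllMoments P a)
    (hb : HasAllMoments P b) {m : ℕ} (hm : 1 ≤ m)
    (hab : ∫ ω, a ω ^ (2 * m - 1) * b ω ∂P = 0) {s z : ℝ} (hs : 0 ≤ s) (hz : 0 ≤ z)
    (hsa : ∫ ω, a ω ^ (2 * m) ∂P ≤ s ^ m)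
    (hzb : ∫ ω, b ω ^ (2 * m) ∂P ≤ (z / 4 ^ (m + 1)) ^ m) :
    ∫ ω, (a ω + b ω) ^ (2 * m) ∂P ≤ (s + z) ^ m := by
  have hpos : ∀ s z : ℝ, 0 < s → 0 < z → ∫ ω, a ω ^ (2 * m) ∂P ≤ s ^ m →
      ∫ ω, b ω ^ (2 * m) ∂P ≤ (z / 4 ^ (m + 1)) ^ m →
      ∫ ω, (a ω + b ω) ^ (2 * m) ∂P ≤ (s + z) ^ m := by
    intro s z hs hz hsa hzb
    set y := z / 4 ^ (m + 1) with hy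
    have hy0 : 0 < y := by positivity
    have ia := (ha.pow (2 * m)).integrable
    have ib := (hb.pow (2 * m)).integrable
    have iab := ((ha.pow (2 * m - 1)).mul hb).integrable
    -- Young's inequality, normalized so that both `L^(2m)` norms become at most one.
    have hmix : ∀ ω, (a ω ^ 2) ^ (m - 1) * b ω ^ 2 ≤ s ^ (m - 1) * y *
        ((s ^ m)⁻¹ * a ω ^ (2 * m) + (y ^ m)⁻¹ * b ω ^ (2 * m)) := by
      intro ω
      obtain ⟨l, rfl⟩ : ∃ l, m = l + 1 := ⟨m - 1, by omega⟩
      have key : ∀ u v : ℝ, 0 ≤ u → 0 ≤ v → u ^ l * v ≤ u ^ (l + 1) + v ^ (l + 1) := by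
        intro u v hu hv
        rcases le_total u v with h | h
        · have : u ^ l * v ≤ v ^ l * v := by gcongr
          rw [← pow_succ] at this
          exact this.trans (le_add_of_nonneg_left (by positivity))
        · have : u ^ l * v ≤ u ^ l * u := by gcongr
          rw [← pow_succ] at this
          exact this.trans (le_add_of_nonneg_right (by positivity))
      have h := key (a ω ^ 2 / s) (b ω ^ 2 / y) (by positivity) (by positivity)
      simp only [Nat.add_sub_cancel]
      have e1 : (a ω ^ 2) ^ l * b ω ^ 2 = s ^ l * y * ((a ω ^ 2 / s) ^ l * (b ω ^ 2 / y)) := by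
        rw [div_pow]
        field_simp
      rw [e1]
      refine mul_le_mul_of_nonneg_left (h.trans_eq ?_) (by positivity)
      rw [div_pow, div_pow, ← pow_mul, ← pow_mul]
      ring
    set R : Ω → ℝ := fun ω => a ω ^ (2 * m) + 2 * m * (a ω ^ (2 * m - 1) * b ω) +
      4 ^ m * (s ^ (m - 1) * y * ((s ^ m)⁻¹ * a ω ^ (2 * m) + (y ^ m)⁻¹ * b ω ^ (2 * m)) +
        b ω ^ (2 * m)) with hR
    have hle : ∀ ω, (a ω + b ω) ^ (2 * m) ≤ R ω := by
      intro ω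
      refine (add_pow_two_mul_le (a ω) (b ω) hm).trans ?_
      rw [← pow_mul (b ω)]
      have := hmix ω
      simp only [hR]
      gcongr
    have i1 : Integrable (fun ω => (s ^ m)⁻¹ * a ω ^ (2 * m) + (y ^ m)⁻¹ * b ω ^ (2 * m)) P :=
      (ia.const_mul _).add (ib.const_mul _)
    have i2 : Integrable (fun ω => s ^ (m - 1) * y *
        ((s ^ m)⁻¹ * a ω ^ (2 * m) + (y ^ m)⁻¹ * b ω ^ (2 * m)) + b ω ^ (2 * m)) P :=
      (i1.const_mul (s ^ (m - 1) * y)).add ib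
    have i3 : Integrable (fun ω => a ω ^ (2 * m) + 2 * m * (a ω ^ (2 * m - 1) * b ω)) P :=
      ia.add (iab.const_mul (2 * m))
    have hRi : Integrable R P := i3.add (i2.const_mul (4 ^ m))
    have hRv : ∫ ω, R ω ∂P = (∫ ω, a ω ^ (2 * m) ∂P) +
        4 ^ m * (s ^ (m - 1) * y * ((s ^ m)⁻¹ * (∫ ω, a ω ^ (2 * m) ∂P) +
          (y ^ m)⁻¹ * ∫ ω, b ω ^ (2 * m) ∂P) + ∫ ω, b ω ^ (2 * m) ∂P) := by
      simp only [hR]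
      rw [integral_add i3 (i2.const_mul (4 ^ m)), integral_add ia (iab.const_mul (2 * m)),
        integral_const_mul, hab, integral_const_mul, integral_add (i1.const_mul _) ib,
        integral_const_mul, integral_add (ia.const_mul _) (ib.const_mul _), integral_const_mul,
        integral_const_mul]
      ring
    refine (integral_mono ((ha.add hb).pow (2 * m)).integrable hRi hle).trans ?_
    rw [hRv]
    have b1 : (s ^ m)⁻¹ * (∫ ω, a ω ^ (2 * m) ∂P) ≤ 1 := by
      rw [inv_mul_le_one₀ (by positivity)]; exact hsa
    have b2 : (y ^ m)⁻¹ * (∫ ω, b ω ^ (2 * m) ∂P) ≤ 1 := by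
      rw [inv_mul_le_one₀ (by positivity)]; exact hzb
    have b3 : y ^ m ≤ z ^ (m - 1) * y := by
      obtain ⟨l, rfl⟩ : ∃ l, m = l + 1 := ⟨m - 1, by omega⟩
      rw [pow_succ, Nat.add_sub_cancel]
      have : y ≤ z := div_le_self hz.le (one_le_pow₀ (by norm_num))
      gcongr
    calc _ ≤ s ^ m + 4 ^ m * (s ^ (m - 1) * y * (1 + 1) + z ^ (m - 1) * y) := by
          have := hzb.trans b3
          gcongr
      _ ≤ s ^ m + 4 ^ m * (2 * y * (s ^ (m - 1) + z ^ (m - 1))) := by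
          have : 0 ≤ z ^ (m - 1) * y := by positivity
          have h4 : (0 : ℝ) < 4 ^ m := by positivity
          nlinarith
      -- The denominator `4 ^ (m + 1)` in the hypothesis on `b` is what cancels the factor `2 * 4 ^ m`.
      _ = s ^ m + z * ((s ^ (m - 1) + z ^ (m - 1)) / 2) := by
          rw [hy, pow_succ]
          field_simp
          ring
      _ ≤ s * (s + z) ^ (m - 1) + z * (s + z) ^ (m - 1) := by
          have h1 : s ^ (m - 1) ≤ (s + z) ^ (m - 1) := by gcongr; linarith
          have h2 : z ^ (m - 1) ≤ (s + z) ^ (m - 1) := by gcongr; linarith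
          have h3 : s ^ m = s * s ^ (m - 1) := by rw [← pow_succ', Nat.sub_add_cancel hm]
          rw [h3]
          gcongr
          linarith
      _ = _ := by rw [← add_mul, ← pow_succ', Nat.sub_add_cancel hm]
  -- The general case follows by continuity.
  have hlim : Tendsto (fun η : ℝ => (s + η + (z + η)) ^ m) (𝓝[>] 0) (𝓝 ((s + z) ^ m)) := by
    have hc : Continuous fun η : ℝ => (s + η + (z + η)) ^ m := by fun_prop
    have := (hc.tendsto 0).mono_left (nhdsWithin_le_nhds (s := Ioi 0))
    simpa using this
  refine ge_of_tendsto hlim ?_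
  filter_upwards [self_mem_nhdsWithin] with η hη
  rw [mem_Ioi] at hη
  refine hpos (s + η) (z + η) (by positivity) (by positivity) (hsa.trans ?_) (hzb.trans ?_)
  · gcongr; linarith
  · gcongr; linarith

lemma eLpNorm_le_ofReal_iff {f : Ω → ℝ} {m : ℕ} (hm : 1 ≤ m)
    (hf : MemLp f (2 * m : ℕ) P) {r : ℝ} (hr : 0 ≤ r) :
    eLpNorm f (2 * m : ℕ) P ≤ ENNReal.ofReal r ↔ ∫ ω, f ω ^ (2 * m) ∂P ≤ r ^ (2 * m) := by
  have h0 : 2 * m ≠ 0 := by omega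
  have hI : 0 ≤ ∫ ω, f ω ^ (2 * m) ∂P := integral_nonneg fun ω => (even_two_mul m).pow_nonneg _
  rw [hf.eLpNorm_eq_integral_rpow_norm (by exact_mod_cast h0) (ENNReal.natCast_ne_top _),
    ENNReal.ofReal_le_ofReal_iff hr]
  simp only [ENNReal.toReal_natCast, Real.rpow_natCast, Real.norm_eq_abs,
    (even_two_mul m).pow_abs]
  rw [Real.rpow_inv_le_iff_of_pos hI hr (by positivity), Real.rpow_natCast]

/-- Minkowski's inequality for even moments. -/
lemma integral_sum_pow_le {ι : Type*} (t : Finset ι) {g : ι → Ω → ℝ} {r : ι → ℝ} {m : ℕ}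
    (hm : 1 ≤ m) (hg : ∀ i ∈ t, HasAllMoments P (g i)) (hr : ∀ i ∈ t, 0 ≤ r i)
    (h : ∀ i ∈ t, ∫ ω, g i ω ^ (2 * m) ∂P ≤ r i ^ (2 * m)) :
    ∫ ω, (∑ i ∈ t, g i ω) ^ (2 * m) ∂P ≤ (∑ i ∈ t, r i) ^ (2 * m) := by
  have htop : ((2 * m : ℕ) : ℝ≥0∞) ≠ ∞ := ENNReal.natCast_ne_top _
  rw [← eLpNorm_le_ofReal_iff hm (HasAllMoments.sum t hg _ htop) (Finset.sum_nonneg hr),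
    ENNReal.ofReal_sum_of_nonneg hr]
  have h1 := eLpNorm_sum_le (s := t) (f := g) (p := (2 * m : ℕ)) (μ := P)
    (fun i hi => (hg i hi _ htop).aestronglyMeasurable) (by exact_mod_cast (by omega : 1 ≤ 2 * m))
  have h2 : (fun ω => ∑ i ∈ t, g i ω) = ∑ i ∈ t, g i := by
    funext ω
    simp
  rw [h2]
  exact h1.trans (Finset.sum_le_sum fun i hi =>
    (eLpNorm_le_ofReal_iff hm (hg i hi _ htop) (hr i hi)).mpr (h i hi))

namespace IsStdGaussSeq

variable {ξ : ℕ → Ω → ℝ}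

/-- A Hermite polynomial of `ξ d` is independent of random variables that depend on finitely many
other coordinates. -/
lemma indepFun_hermiteFun (hξ : IsStdGaussSeq P ξ) {s : Finset ℕ} {d : ℕ} (hd : d ∉ s)
    {F : Ω → ℝ} (hF : Measurable[⨆ k ∈ (s : Set ℕ), MeasurableSpace.comap (ξ k) inferInstance] F)
    (n : ℕ) : IndepFun F (fun ω => hermiteFun n (ξ d ω)) P := by
  have h1 := indep_iSup_of_disjoint (m := fun k => MeasurableSpace.comap (ξ k) inferInstance)
    (fun k => (hξ.measurable k).comap_le) hξ.indep.iIndep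
    (S := (s : Set ℕ)) (T := {d}) (by simpa using hd)
  rw [IndepFun_iff_Indep]
  refine indep_of_indep_of_le_left (indep_of_indep_of_le_right h1 ?_) hF.comap_le
  simp only [mem_singleton_iff, iSup_iSup_eq_left]
  have : (fun ω => hermiteFun n (ξ d ω)) = hermiteFun n ∘ ξ d := rfl
  rw [this, ← MeasurableSpace.comap_comp]
  exact MeasurableSpace.comap_mono (continuous_hermiteFun n).measurable.comap_le

end IsStdGaussSeq

end Moments

/-- Splitting one coordinate off the multi-indices below a given one. -/
lemma sum_Iic_single_add {d N : ℕ} {γ : MultiIndex} (hd : d ∉ γ.support) (g : MultiIndex → ℝ) :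
    ∑ α ∈ Finset.Iic (Finsupp.single d N + γ), g α =
      ∑ n ∈ Finset.range (N + 1), ∑ β ∈ Finset.Iic γ, g (Finsupp.single d n + β) := by
  have hγd : γ d = 0 := Finsupp.notMem_support_iff.mp hd
  rw [← Finset.sum_product']
  symm
  refine Finset.sum_nbij' (fun p => Finsupp.single d p.1 + p.2) (fun α => (α d, α.erase d))
    ?_ ?_ ?_ ?_ fun p _ => rfl
  · rintro ⟨n, β⟩ h
    rw [Finset.mem_product, Finset.mem_range, Finset.mem_Iic] at h
    rw [Finset.mem_Iic]
    exact add_le_add (Finsupp.single_le_single.mpr (Nat.lt_succ_iff.mp h.1)) h.2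
  · intro α h
    rw [Finset.mem_Iic] at h
    rw [Finset.mem_product, Finset.mem_range, Finset.mem_Iic]
    refine ⟨?_, fun k => ?_⟩
    · have := h d
      simp only [Finsupp.add_apply, Finsupp.single_eq_same, hγd] at this
      exact Nat.lt_succ_iff.mpr this
    · by_cases hk : k = d
      · simp [hk]
      · have := h k
        simpa [Finsupp.erase_ne hk, hk] using this
  -- Recovering `(n, β)` from `α` uses that `β ≤ γ` vanishes at `d`.
  · rintro ⟨n, β⟩ h
    rw [Finset.mem_product, Finset.mem_Iic] at h
    have hβd : β d = 0 := Nat.le_zero.mp (hγd ▸ h.2 d)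
    ext1
    · simp [hβd]
    · ext k
      by_cases hk : k = d
      · simp [hk, hβd]
      · simp [Finsupp.erase_ne hk]
  · intro α _
    exact Finsupp.single_add_erase d α

lemma hermiteProd_single_add {Ω : Type*} (ξ : ℕ → Ω → ℝ) {d : ℕ} {β : MultiIndex}
    (hd : d ∉ β.support) (n : ℕ) (ω : Ω) :
    hermiteProd ξ (Finsupp.single d n + β) ω = hermiteFun n (ξ d ω) * hermiteProd ξ β ω := by
  have hs : (Finsupp.single d n + β).support ⊆ insert d β.support := by
    refine Finsupp.support_add.trans (Finset.union_subset ?_ (Finset.subset_insert _ _))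
    exact Finsupp.support_single_subset.trans (by simp)
  rw [hermiteProd_eq_prod ξ hs, Finset.prod_insert hd]
  congr 1
  · simp [Finsupp.notMem_support_iff.mp hd]
  · refine Finset.prod_congr rfl fun k hk => ?_
    have : k ≠ d := fun h => hd (h ▸ hk)
    simp [this]

/-- The Cauchy–Schwarz inequality against a geometric sequence. -/
lemma sum_geom_mul_sqrt_sq_le {ρ δ : ℝ} (h1 : ρ ^ 2 ≤ 1 / 2) (h2 : 2 * ρ ^ 2 ≤ δ)
    {S : ℕ → ℝ} (hS : ∀ n, 0 ≤ S n) (N : ℕ) :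
    (∑ n ∈ Finset.range N, ρ ^ (n + 1) * √(S n)) ^ 2 ≤ δ * ∑ n ∈ Finset.range N, S n := by
  refine (Finset.sum_mul_sq_le_sq_mul_sq _ _ _).trans ?_
  simp_rw [Real.sq_sqrt (hS _)]
  refine mul_le_mul_of_nonneg_right (le_trans ?_ h2) (Finset.sum_nonneg fun n _ => hS n)
  have h3 : ∑ n ∈ Finset.range N, (ρ ^ 2) ^ n ≤ 2 := by
    refine (Summable.sum_le_tsum _ (fun n _ => by positivity)
      (summable_geometric_of_lt_one (sq_nonneg ρ) (by linarith))).trans ?_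
    rw [tsum_geometric_of_lt_one (sq_nonneg ρ) (by linarith)]
    rw [inv_le_comm₀ (by linarith) (by norm_num)]
    linarith
  calc ∑ n ∈ Finset.range N, (ρ ^ (n + 1)) ^ 2 = ρ ^ 2 * ∑ n ∈ Finset.range N, (ρ ^ 2) ^ n := by
        rw [Finset.mul_sum]
        exact Finset.sum_congr rfl fun n _ => by ring
    _ ≤ ρ ^ 2 * 2 := by gcongr
    _ = _ := mul_comm _ _

namespace IsStdGaussSeq

variable {Ω : Type*} [MeasurableSpace Ω] {P : Measure Ω} [IsProbabilityMeasure P]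
variable {ξ : ℕ → Ω → ℝ}

/-- Weak hypercontractivity on boxes of multi-indices. The proof splits off one Gaussian variable
at a time: relative to the others, the part of positive degree in that variable is centred and,
for small `ε`, small. -/
lemma integral_sum_Iic_pow_le (hξ : IsStdGaussSeq P ξ) {m : ℕ} (hm : 1 ≤ m) {K : ℝ} (hK : 1 ≤ K)
    (hKm : ∀ n, ∫ x, hermiteFun n x ^ (2 * m) ∂stdGauss ≤ (K ^ n) ^ (2 * m)) {ε : ℝ}
    (hε : 0 ≤ ε) (hεK : ε * K = 1 / 4 ^ (m + 1)) (γ : MultiIndex) :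
    ∀ c : MultiIndex → ℝ,
      ∫ ω, (∑ α ∈ Finset.Iic γ, c α * (ε ^ α.degree * hermiteProd ξ α ω)) ^ (2 * m) ∂P ≤
        (∑ α ∈ Finset.Iic γ, c α ^ 2) ^ m := by
  induction γ using Finsupp.induction with
  | zero =>
    intro c
    have : Finset.Iic (0 : MultiIndex) = {0} := by
      ext α
      simp [nonpos_iff_eq_zero]
    simp [this, hermiteProd, pow_mul]
  | single_add d N γ hd _ ih =>
    intro c
    set F : ℕ → Ω → ℝ := fun n ω => ∑ β ∈ Finset.Iic γ,
      c (Finsupp.single d n + β) * (ε ^ β.degree * hermiteProd ξ β ω) with hF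
    set S : ℕ → ℝ := fun n => ∑ β ∈ Finset.Iic γ, c (Finsupp.single d n + β) ^ 2 with hS
    have hFS : ∀ n, ∫ ω, F n ω ^ (2 * m) ∂P ≤ S n ^ m := fun n => ih _
    have hS0 : ∀ n, 0 ≤ S n := fun n => Finset.sum_nonneg fun β _ => sq_nonneg _
    have hFm : ∀ n, HasAllMoments P (F n) := fun n => HasAllMoments.sum _ fun β _ =>
      ((hξ.hasAllMoments_hermiteProd β).const_mul _).const_mul _
    have hh : ∀ n, HasAllMoments P fun ω => hermiteFun n (ξ d ω) :=
      fun n => hξ.hasAllMoments_hermiteFun d n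
    have hFmeas : ∀ n, Measurable[⨆ k ∈ (γ.support : Set ℕ),
        MeasurableSpace.comap (ξ k) inferInstance] (F n) := fun n => by
      refine Finset.measurable_fun_sum _ fun β hβ => ?_
      refine Measurable.const_mul (Measurable.const_mul (measurable_hermiteProd ?_) _) _
      exact Finsupp.support_mono (Finset.mem_Iic.mp hβ)
    have hsplit : ∀ ω, ∑ α ∈ Finset.Iic (Finsupp.single d N + γ),
        c α * (ε ^ α.degree * hermiteProd ξ α ω) = F 0 ω +
          ∑ n ∈ Finset.range N, ε ^ (n + 1) * (F (n + 1) ω * hermiteFun (n + 1) (ξ d ω)) := by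
      intro ω
      rw [sum_Iic_single_add hd, Finset.sum_range_succ', add_comm]
      congr 1
      · simp [hF]
      · refine Finset.sum_congr rfl fun n _ => ?_
        simp only [hF]
        rw [Finset.sum_mul, Finset.mul_sum]
        refine Finset.sum_congr rfl fun β hβ => ?_
        rw [hermiteProd_single_add ξ fun h => hd (Finsupp.support_mono (Finset.mem_Iic.mp hβ) h),
          map_add, Finsupp.degree_single, pow_add]
        ring
    have hSsplit : ∑ α ∈ Finset.Iic (Finsupp.single d N + γ), c α ^ 2 =
        S 0 + ∑ n ∈ Finset.range N, S (n + 1) := by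
      rw [sum_Iic_single_add hd, Finset.sum_range_succ', add_comm]
    have hgm : ∀ n, HasAllMoments P fun ω =>
        ε ^ (n + 1) * (F (n + 1) ω * hermiteFun (n + 1) (ξ d ω)) := fun n =>
      ((hFm (n + 1)).mul (hh (n + 1))).const_mul _
    simp_rw [hsplit, hSsplit]
    -- The terms of degree zero in `ξ d` play the role of `a`, the remaining ones that of `b`.
    refine integral_add_pow_le (hFm 0) (HasAllMoments.sum _ fun n _ => hgm n) hm ?_ (hS0 0)
      (Finset.sum_nonneg fun n _ => hS0 _) (hFS 0) ?_
    · simp_rw [Finset.mul_sum]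
      rw [integral_finsetSum _ fun n _ => (((hFm 0).pow _).mul (hgm n)).integrable]
      refine Finset.sum_eq_zero fun n _ => ?_
      have hind := hξ.indepFun_hermiteFun hd
        (((hFmeas 0).pow_const (2 * m - 1)).mul (hFmeas (n + 1))) (n + 1)
      have h0 := hind.integral_fun_mul_eq_mul_integral
        (((hFm 0).pow _).mul (hFm (n + 1))).integrable.aestronglyMeasurable
        (hh (n + 1)).integrable.aestronglyMeasurable
      rw [hξ.integral_comp d (continuous_hermiteFun _), integral_hermiteFun_succ, mul_zero] at h0
      rw [← mul_zero (ε ^ (n + 1)), ← h0, ← integral_const_mul]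
      refine integral_congr_ae (Eventually.of_forall fun ω => ?_)
      simp only [Pi.mul_apply]
      ring
    · have hpiece : ∀ n ∈ Finset.range N,
          ∫ ω, (ε ^ (n + 1) * (F (n + 1) ω * hermiteFun (n + 1) (ξ d ω))) ^ (2 * m) ∂P ≤
            ((ε * K) ^ (n + 1) * √(S (n + 1))) ^ (2 * m) := by
        intro n _
        have hind : IndepFun (fun ω => F (n + 1) ω ^ (2 * m))
            (fun ω => hermiteFun (n + 1) (ξ d ω) ^ (2 * m)) P :=
          (hξ.indepFun_hermiteFun hd (hFmeas (n + 1)) (n + 1)).comp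
            (φ := fun x => x ^ (2 * m)) (ψ := fun x => x ^ (2 * m)) (by fun_prop) (by fun_prop)
        have h0 := hind.integral_fun_mul_eq_mul_integral
          ((hFm (n + 1)).pow _).integrable.aestronglyMeasurable
          ((hh (n + 1)).pow _).integrable.aestronglyMeasurable
        rw [hξ.integral_comp d (f := fun x => hermiteFun (n + 1) x ^ (2 * m))
          ((continuous_hermiteFun _).pow _)] at h0
        simp_rw [mul_pow ε K, mul_pow]
        rw [integral_const_mul, h0]
        have h1 : √(S (n + 1)) ^ (2 * m) = S (n + 1) ^ m := by
          rw [pow_mul, Real.sq_sqrt (hS0 _)]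
        have h2 : 0 ≤ ∫ x, hermiteFun (n + 1) x ^ (2 * m) ∂stdGauss :=
          integral_nonneg fun x => (even_two_mul m).pow_nonneg _
        calc _ ≤ (ε ^ (n + 1)) ^ (2 * m) * (S (n + 1) ^ m * (K ^ (n + 1)) ^ (2 * m)) := by
              have := hFS (n + 1)
              have := hKm (n + 1)
              have := hS0 (n + 1)
              gcongr
          _ = _ := by
              rw [h1]
              ring
      refine (integral_sum_pow_le _ hm (fun n _ => hgm n) (fun n _ => by positivity)
        hpiece).trans ?_
      rw [pow_mul]
      refine pow_le_pow_left₀ (sq_nonneg _) ?_ m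
      have h4 : (4 : ℝ) ≤ 4 ^ (m + 1) := by
        simpa using pow_le_pow_right₀ (by norm_num : (1 : ℝ) ≤ 4) (by omega : 1 ≤ m + 1)
      have h5 : 2 * (ε * K) ^ 2 ≤ 1 / 4 ^ (m + 1) := by
        rw [hεK, div_pow, one_pow, sq, mul_one_div, div_le_div_iff₀ (by positivity) (by positivity)]
        nlinarith
      have h6 : (1 : ℝ) / 4 ^ (m + 1) ≤ 1 / 4 := by gcongr
      refine (sum_geom_mul_sqrt_sq_le (by linarith) h5
        (fun n => hS0 (n + 1)) N).trans_eq ?_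
      ring

/-- Weak hypercontractivity: an even moment of a finite chaos expansion is controlled by its
coefficients, at the price of a geometric factor in the degree. -/
lemma exists_integral_sum_pow_le (hξ : IsStdGaussSeq P ξ) {m : ℕ} (hm : 1 ≤ m) :
    ∃ q : ℝ, 0 < q ∧ ∀ (A : Finset MultiIndex) (c : MultiIndex → ℝ),
      ∫ ω, (∑ α ∈ A, c α * hermiteProd ξ α ω) ^ (2 * m) ∂P ≤
        (∑ α ∈ A, q ^ α.degree * c α ^ 2) ^ m := by
  classical
  obtain ⟨K, hK, hKm⟩ := exists_integral_hermiteFun_pow_le m hm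
  have hK0 : 0 < K := by linarith
  set ε : ℝ := 1 / 4 ^ (m + 1) / K with hε
  have hε0 : 0 < ε := by positivity
  refine ⟨(ε ^ 2)⁻¹, by positivity, fun A c => ?_⟩
  -- Enlarge `A` to a box, the extra coefficients being zero.
  have hA : A ⊆ Finset.Iic (∑ α ∈ A, α) := fun α hα =>
    Finset.mem_Iic.mpr (Finset.single_le_sum (f := fun α : MultiIndex => α)
      (fun _ _ => zero_le) hα)
  have h := hξ.integral_sum_Iic_pow_le hm hK hKm hε0.le (by rw [hε]; field_simp) (∑ α ∈ A, α)
    fun α => if α ∈ A then c α * (ε ^ α.degree)⁻¹ else 0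
  simp only [ite_mul, zero_mul, ite_pow, zero_pow two_ne_zero, Finset.sum_ite_mem,
    Finset.inter_eq_right.mpr hA] at h
  have e1 : ∀ α ∈ A, c α * (ε ^ α.degree)⁻¹ * (ε ^ α.degree * 1) = c α := fun α _ => by
    field_simp
  refine le_trans (le_of_eq ?_) (h.trans_eq ?_)
  · congr 1
    funext ω
    congr 1
    refine Finset.sum_congr rfl fun α _ => ?_
    field_simp
  · congr 1
    refine Finset.sum_congr rfl fun α _ => ?_
    rw [mul_pow, inv_pow, inv_pow, ← pow_mul, ← pow_mul, mul_comm 2]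
    ring

end IsStdGaussSeq

/-! ### Random variables with a given chaos expansion -/

section Expansion

lemma measurable_xi {Ω : Type*} (W : L2 → Ω → ℝ) (α : MultiIndex) :
    Measurable[noiseSigma W] (xi W α) := by
  rw [xi_eq_hermiteProd]
  refine (measurable_hermiteProd (s := α.support) Finset.Subset.rfl).mono ?_ le_rfl
  exact iSup₂_le fun k _ => le_iSup (fun h => MeasurableSpace.comap (W h) inferInstance) _

variable {Ω : Type*} [MeasurableSpace Ω] {P : Measure Ω} {W : L2 → Ω → ℝ} {c : MultiIndex → ℝ}
  {η : Ω → ℝ}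

namespace IsWhiteNoise

lemma noiseSigma_le (hW : IsWhiteNoise P W) : noiseSigma W ≤ ‹MeasurableSpace Ω› :=
  iSup_le fun h => (hW.measurable h).comap_le

lemma hasAllMoments_xi [IsProbabilityMeasure P] (hW : IsWhiteNoise P W) (α : MultiIndex) :
    HasAllMoments P (xi W α) :=
  hW.isStdGaussSeq.hasAllMoments_hermiteProd α

lemma integral_xi_mul [IsProbabilityMeasure P] (hW : IsWhiteNoise P W) (α β : MultiIndex) :
    ∫ ω, xi W α ω * xi W β ω ∂P = if α = β then 1 else 0 :=
  hW.isStdGaussSeq.integral_hermiteProd_mul α β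

end IsWhiteNoise

/-- Riesz–Fischer for the Cameron-Martin basis. Working with the restriction of the measure to the
noise sigma-algebra makes the limit measurable with respect to the noise. -/
lemma IsWhiteNoise.exists_hasChaosExpansion [IsProbabilityMeasure P] (hW : IsWhiteNoise P W)
    (hc : Summable fun α => c α ^ 2) :
    ∃ η, MemL2W P W η ∧ HasChaosExpansion P W c η ∧ ∀ α, chaosCoeff P W η α = c α := by
  have hm := hW.noiseSigma_le
  have hs : ∀ α, StronglyMeasurable[noiseSigma W] (xi W α) :=
    fun α => (measurable_xi W α).stronglyMeasurable
  have hxi : ∀ α, MemLp (xi W α) 2 (P.trim hm) := fun α =>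
    ⟨(hs α).aestronglyMeasurable, by
      rw [eLpNorm_trim hm (hs α)]
      exact (hW.hasAllMoments_xi α 2 (by simp)).eLpNorm_lt_top⟩
  set e : MultiIndex → Lp ℝ 2 (P.trim hm) := fun α => (hxi α).toLp (xi W α) with he
  have hinner : ∀ (f : Lp ℝ 2 (P.trim hm)) α, inner ℝ (e α) f = chaosCoeff P W f α := by
    intro f α
    rw [L2.inner_def, chaosCoeff, integral_trim hm (f := fun ω => f ω * xi W α ω)
      ((Lp.stronglyMeasurable f).mul (hs α))]
    refine integral_congr_ae ?_
    filter_upwards [(hxi α).coeFn_toLp] with ω h1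
    rw [he, h1]
    simp
  have hon : Orthonormal ℝ e := by
    rw [orthonormal_iff_ite]
    intro α β
    rw [← hW.integral_xi_mul, L2.inner_def, integral_trim hm
      (f := fun ω => xi W α ω * xi W β ω) ((hs α).mul (hs β))]
    refine integral_congr_ae ?_
    filter_upwards [(hxi α).coeFn_toLp, (hxi β).coeFn_toLp] with ω h1 h2
    rw [he, h1, h2]
    simp [mul_comm]
  have hsum : Summable fun α => c α • e α := by
    have h1 := (hon.orthogonalFamily.summable_iff_norm_sq_summable fun α => c α).mpr
      (by simpa using hc)
    simpa using h1
  obtain ⟨f, hf⟩ := hsum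
  have hfs : StronglyMeasurable[noiseSigma W] f := Lp.stronglyMeasurable f
  refine ⟨f, ⟨hfs.measurable, memLp_of_memLp_trim hm (Lp.memLp f)⟩, ?_, fun α => ?_⟩
  · have h1 : Tendsto (fun s : Finset MultiIndex => ‖f - ∑ α ∈ s, c α • e α‖ₑ) atTop (𝓝 0) := by
      have h2 := (tendsto_const_nhds (x := f)).sub hf
      rw [sub_self] at h2
      simpa using h2.enorm
    refine h1.congr fun s => ?_
    rw [Lp.enorm_def, ← eLpNorm_trim hm (f := fun ω => f ω - ∑ α ∈ s, c α * xi W α ω)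
      (hfs.sub (Finset.stronglyMeasurable_fun_sum s fun α _ => (hs α).const_mul (c α)))]
    refine eLpNorm_congr_ae ?_
    have h3 : ∀ᵐ ω ∂(P.trim hm), ∀ α ∈ s, (c α • e α : Lp ℝ 2 (P.trim hm)) ω = c α * xi W α ω :=
      (Finset.eventually_all s).mpr fun α _ => by
        filter_upwards [Lp.coeFn_smul (c α) (e α), (hxi α).coeFn_toLp] with ω h4 h5
        rw [h4, Pi.smul_apply, he, h5, smul_eq_mul]
    filter_upwards [h3, Lp.coeFn_sub f (∑ α ∈ s, c α • e α),
      Lp.coeFn_finsetSum s fun α => c α • e α] with ω h4 h5 h6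
    rw [h5, Pi.sub_apply, h6, Finset.sum_apply]
    exact congrArg _ (Finset.sum_congr rfl h4)
  · have h1 := (innerSL ℝ (e α)).hasSum hf
    simp only [innerSL_apply_apply, inner_smul_right, orthonormal_iff_ite.mp hon] at h1
    rw [← hinner]
    refine h1.unique ?_
    simpa using hasSum_single (f := fun β => c β * if α = β then 1 else 0) α
      fun β hβ => by simp [hβ.symm]

/-- If the chaos coefficients decay faster than geometrically in the degree, then
hypercontractivity bounds all moments of the partial sums, and these bounds pass to the limit. -/
lemma HasChaosExpansion.memLp [IsProbabilityMeasure P] (hη : HasChaosExpansion P W c η)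
    (hW : IsWhiteNoise P W) (hm : AEStronglyMeasurable η P)
    (hc : ∀ q : ℝ, 0 < q → Summable fun α => q ^ α.degree * c α ^ 2) {r : ℝ≥0∞} (hr : r ≠ ∞) :
    MemLp η r P := by
  obtain ⟨n, hn⟩ := ENNReal.exists_nat_gt hr
  obtain ⟨q, hq, hqm⟩ := hW.isStdGaussSeq.exists_integral_sum_pow_le (m := n + 1) (by omega)
  -- It suffices to bound an even moment of order larger than `r`.
  refine MemLp.mono_exponent (q := (2 * (n + 1) : ℕ)) ?_
    (hn.le.trans (by exact_mod_cast (by omega : n ≤ 2 * (n + 1))))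
  set g : Finset MultiIndex → Ω → ℝ := fun s ω => ∑ α ∈ s, c α * xi W α ω with hg
  have hgm : ∀ s, HasAllMoments P (g s) := fun s =>
    HasAllMoments.sum s fun α _ => (hW.hasAllMoments_xi α).const_mul (c α)
  have hga : ∀ s, AEStronglyMeasurable (g s) P := fun s => (hgm s).integrable.aestronglyMeasurable
  have hlim : TendstoInMeasure P g atTop η := by
    refine tendstoInMeasure_of_tendsto_eLpNorm (p := 2) (by simp) hga hm ?_
    refine hη.congr fun s => ?_
    rw [← eLpNorm_neg]
    congr 1
    funext ω
    simp [hg]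
  set T := ∑' α, q ^ α.degree * c α ^ 2 with hT
  have hT0 : 0 ≤ T := tsum_nonneg fun α => by positivity
  have hbound : ∀ s, eLpNorm (g s) (2 * (n + 1) : ℕ) P ≤ ENNReal.ofReal (√T) := by
    intro s
    rw [eLpNorm_le_ofReal_iff (by omega) (hgm s _ (ENNReal.natCast_ne_top _)) (Real.sqrt_nonneg _),
      pow_mul, Real.sq_sqrt hT0]
    refine (hqm s c).trans (pow_le_pow_left₀ (Finset.sum_nonneg fun α _ => by positivity) ?_ _)
    exact (hc q hq).sum_le_tsum s fun α _ => by positivity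
  exact ⟨hm, (eLpNorm_le_of_tendstoInMeasure (Eventually.of_forall hbound) hlim hga).trans_lt
    ENNReal.ofReal_lt_top⟩

end Expansion

end WickHeat

end

theorem mainTheorem3 {Ω : Type*} [MeasurableSpace Ω] (P : Measure Ω) [IsProbabilityMeasure P]
    (W : WickHeat.L2 → Ω → ℝ) (hW : WickHeat.IsWhiteNoise P W)
    (p : ℝ≥0∞) (hp : 1 ≤ p) (u₀ : ℝ → ℝ) (hu₀ : MemLp u₀ p WickHeat.mu) :
    (∃ U : WickHeat.MultiIndex → ℝ → ℝ → ℝ, WickHeat.IsChaosSolution u₀ U) ∧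
    (∀ U V : WickHeat.MultiIndex → ℝ → ℝ → ℝ,
      WickHeat.IsChaosSolution u₀ U → WickHeat.IsChaosSolution u₀ V →
        ∀ α, ∀ t > 0, ∀ x ∈ Set.Icc 0 Real.pi, U α t x = V α t x) ∧
    (∀ U : WickHeat.MultiIndex → ℝ → ℝ → ℝ, WickHeat.IsChaosSolution u₀ U →
      ∃ u : ℝ → ℝ → Ω → ℝ, ∀ t > 0, ∀ x ∈ Set.Icc 0 Real.pi,
        WickHeat.HasChaosExpansion P W (fun α => U α t x) (u t x) ∧
        (∀ α, WickHeat.chaosCoeff P W (u t x) α = U α t x) ∧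
        (∀ q : ℝ, 1 < q → WickHeat.MemL2qW P W q (u t x)) ∧
        (∀ r : ℝ≥0∞, 1 ≤ r → r < ∞ → MemLp (u t x) r P)) := by
  have hfin : IsFiniteMeasure WickHeat.mu := by
    refine ⟨?_⟩
    rw [WickHeat.mu, Measure.restrict_apply_univ]
    exact measure_Ioo_lt_top
  have hu : IntervalIntegrable u₀ volume 0 Real.pi := by
    rw [intervalIntegrable_iff_integrableOn_Ioo_of_le Real.pi_pos.le]
    exact hu₀.integrable hp
  refine ⟨⟨_, WickHeat.isChaosSolution_chaosSol hu⟩, fun U V hU hV α t ht x hx => ?_,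
    fun U hU => ?_⟩
  · rw [hU.eq_chaosSol hu α t ht x hx, hV.eq_chaosSol hu α t ht x hx]
  · have hdecay : ∀ t > 0, ∀ x ∈ Set.Icc 0 Real.pi, ∀ q : ℝ, 0 < q →
        Summable fun α : WickHeat.MultiIndex => q ^ α.degree * U α t x ^ 2 := by
      intro t ht x hx q hq
      simp_rw [hU.eq_chaosSol hu _ t ht x hx]
      exact WickHeat.summable_pow_degree_mul_chaosSol_sq hu hq ht hx
    -- Outside the domain of the solution the value of the random field is irrelevant.
    have hex : ∀ t x, ∃ η : Ω → ℝ, 0 < t → x ∈ Set.Icc 0 Real.pi → WickHeat.MemL2W P W η ∧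
        WickHeat.HasChaosExpansion P W (fun α => U α t x) η ∧
        ∀ α, WickHeat.chaosCoeff P W η α = U α t x := by
      intro t x
      by_cases h : 0 < t ∧ x ∈ Set.Icc 0 Real.pi
      · obtain ⟨η, hη⟩ := hW.exists_hasChaosExpansion (c := fun α => U α t x)
          (by simpa using hdecay t h.1 x h.2 1 one_pos)
        exact ⟨η, fun _ _ => hη⟩
      · exact ⟨0, fun ht hx => absurd ⟨ht, hx⟩ h⟩
    choose u hu' using hex
    refine ⟨u, fun t ht x hx => ?_⟩
    obtain ⟨h1, h2, h3⟩ := hu' t x ht hx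
    refine ⟨h2, h3, fun q hq => ⟨h1, ?_⟩, fun r _ hr =>
      h2.memLp hW h1.2.aestronglyMeasurable (hdecay t ht x hx) hr.ne⟩
    simp_rw [h3]
    exact hdecay t ht x hx q (one_pos.trans hq)
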